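/- **Setting.** Let $\theta=(\theta_1,\theta_2,\theta_3)$ denote angles modulo $2\pi$. Of the three directions the first $d\in\{0,1,2\}$ are spatial ($\theta_j=\Phi_j$ is the flux twisting the periodic boundary condition in direction $j\le d$), and the other $D=3-d$ are drive phases. Let $\Omega\in\mathbb R^3$ with $\Omega_j=0$ for $j\le d$ and with incommensurate drive components: $k\cdot\Omega=0$, with $k\in\mathbb Z^3$ and $k_j=0$ for $j\le d$, only for $k=0$. Call $\Omega$ *Diophantine* if there are $\gamma>0$ and $\tau\in\mathbb N$ with $|k\cdot\Omega|\ge\gamma|k|^{-\tau}$ for all such $k\ne0$. Write $|\Omega|$ for the Euclidean norm, $\hat\Omega=\Omega/|\Omega|$ and $\theta_t=\Omega t+\theta_0$. Let $H(\theta)$ be a smooth, $2\pi$-periodic Hermitian matrix function on a finite-dimensional space, and let $U(t)=U(t,0;\theta_0)$ solve $i\partial_tU=H(\theta_t)U$, $U(0)=1$. Suppose there is a complete set of quasienergy states: a smooth $2\pi$-periodic unitary matrix function $V(\theta)$ (the micromotion operator) with columns $\phi_\alpha(\theta)$, and real quasienergies $\epsilon_\alpha$, independent of the drive phases but possibly depending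 on the fluxes, such that $e^{-i\epsilon_\alpha t}\phi_\alpha(\theta_t)$ solves the Schrödinger equation for every $\theta_0$. Put $$W[V]=\frac{1}{3!\,(2\pi i)^2}\int_{\mathbb T^3}d^3\theta\;\epsilon^{jkl}\,\mathrm{tr}\big[(V^\dagger\partial_jV)(V^\dagger\partial_kV)(V^\dagger\partial_lV)\big],$$ $$\dot n_j(t)=U^\dagger(t)\,(-\partial_{\theta_j}H)(\theta_t)\,U(t),\qquad n_j(t)=n_j(0)+\int_0^t\dot n_j(s)\,ds,$$ where the $n_j(0)$ are arbitrary constant operators, and $$M(t)=\tfrac14\,(n\times\dot n)\cdot\hat\Omega+\mathrm{h.c.},\qquad \langle\!\langle M\rangle\!\rangle_T=\frac1T\int_0^T\mathrm{tr}\,M(t)\,dt .$$ Let $\nu$ be the sum of the absolute values of all matrix entries of $n_1(0),n_2(0),n_3(0)$. **(a) No spatial dimension ($d=0$: a qudit driven by three tones).** For all $\theta_0$ and $n(0)$, $$\lim_{T\to\infty}\langle\!\langle M\rangle\!\rangle_T=\frac{|\Omega|}{2\pi}W[V].$$ If $\Omega$ is Diophantine, then moreover $$\langle\!\langle M\rangle\!\rangle_T=\frac{|\Omega|}{2\pi}W[V]+O(T^{-1}):$$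 there is a constant $C$, independent of $\theta_0$, $n(0)$ and $T$, such that the error is at most $C(1+\nu)/T$ for all $T>0$. **(b) $d=1$ or $d=2$ spatial dimensions.** The Hilbert space has basis $|r,s\rangle$ with $r\in\{0,\dots,L-1\}^d$ and $s\in\{1,\dots,N\}$. Write Fourier series as $f(\theta)=\sum_{m\in\mathbb Z^3}f_me^{-im\cdot\theta}$. To site $r$ and Fourier index $m$ assign the point $R(r,m)\in\mathbb Z^3$ of the unwrapped frequency lattice with coordinates $r_j+Lm_j$ for $j\le d$ and $m_j$ for $j>d$. For $x\in\mathbb Z^3$ let $|x|_{\rm sp}$ and $|x|_{\rm dr}$ be the largest absolute values of its spatial and of its drive components. Given $\xi>0$ and constants $K=(K_k)_{k\in\mathbb N}$, a vector function $\psi(\theta)$ is *localized at* $x\in\mathbb Z^3$ if $$|\langle r,s|\psi_m\rangle|\le K_k\,e^{-|R(r,m)-x|_{\rm sp}/\xi}\,(1+|R(r,m)-x|_{\rm dr})^{-k}\qquad\text{for all }k,m,r,s.$$ Assume that $H$ is quasilocal, i.e. $H(\theta)|r',s'\rangle$ is localized at $R(r',0)$ for all $r',s'$, and that each quasienergy state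 $\phi_\alpha$ is localized at some $x_\alpha\in\mathbb Z^3$. Then for every $\xi'>\xi$ there is a constant $C$ depending only on $d,N,\Omega,\xi,\xi',K$ (not on $L$, on the system, on $\theta_0$, on $n(0)$ or on $T$) such that $$\Big|\langle\!\langle M\rangle\!\rangle_T-\frac{|\Omega|}{2\pi}W[V]\Big|\le C(1+\nu)\,e^{-L/\xi'}\quad\text{for all sufficiently large }T,$$ and, if $\Omega$ is Diophantine, $$\Big|\langle\!\langle M\rangle\!\rangle_T-\frac{|\Omega|}{2\pi}W[V]\Big|\le C(1+\nu)\big(T^{-1}+e^{-L/\xi'}\big)\quad\text{for all }T>0.$$ -/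

import Mathlib

open scoped Matrix ContDiff
open MeasureTheory Filter Topology

namespace ALTP

noncomputable section

/-! Everything lives on the three-dimensional torus of angles `θ : Fin 3 → ℝ` (modulo `2π`).
For a system with `d` spatial dimensions and `3 - d` drives, the coordinates `θ j` with
`(j : ℕ) < d` are the fluxes twisting the periodic boundary conditions, and the others are the
drive phases. Operators are complex matrices; derivatives and integrals of operators are taken
entry by entry. -/

section General

variable {ι : Type} [Fintype ι] [DecidableEq ι]

/-- The fundamental cube `[0, 2π]³` of the torus. -/
def cube : Set (Fin 3 → ℝ) := Set.Icc 0 (fun _ => 2 * Real.pi)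

/-- The partial derivative `∂ⱼ A` of an operator-valued function. -/
def pderiv (j : Fin 3) (A : (Fin 3 → ℝ) → Matrix ι ι ℂ) (θ : Fin 3 → ℝ) : Matrix ι ι ℂ :=
  Matrix.of fun a b => deriv (fun s : ℝ => A (θ + Pi.single j s) a b) 0

/-- A smooth operator-valued function on the torus. -/
def SmoothPeriodic (A : (Fin 3 → ℝ) → Matrix ι ι ℂ) : Prop :=
  (∀ a b, ContDiff ℝ ∞ fun θ => A θ a b) ∧
    ∀ θ j, A (θ + Pi.single j (2 * Real.pi)) = A θ

/-- A smooth Hermitian Hamiltonian on the torus. -/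
def IsHamiltonian (H : (Fin 3 → ℝ) → Matrix ι ι ℂ) : Prop :=
  SmoothPeriodic H ∧ ∀ θ, (H θ).IsHermitian

/-- The phases `θ_t = Ω t + θ₀` at time `t`. -/
def phase (Ω θ₀ : Fin 3 → ℝ) (t : ℝ) : Fin 3 → ℝ := θ₀ + t • Ω

/-- `U θ₀ t` is the evolution operator `U(t, 0; θ₀)`: the solution of `i ∂ₜ U = H(θ_t) U` with
`U = 1` at time `0`. -/
def IsEvolution (H : (Fin 3 → ℝ) → Matrix ι ι ℂ) (Ω : Fin 3 → ℝ)
    (U : (Fin 3 → ℝ) → ℝ → Matrix ι ι ℂ) : Prop :=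
  ∀ θ₀, U θ₀ 0 = 1 ∧ ∀ t a b,
    HasDerivAt (fun s => U θ₀ s a b) (-Complex.I * (H (phase Ω θ₀ t) * U θ₀ t) a b) t

/-- `V` is a micromotion operator with quasienergies `ε`: `V` is smooth and unitary on the torus,
and its columns `φ_α` are quasienergy states, that is, `exp (-i ε_α t) φ_α(θ_t)` solves the
Schrödinger equation for every initial phase. The quasienergies may depend on the `d` fluxes, but
not on the drive phases. -/
structure IsMicromotion (d : ℕ) (H : (Fin 3 → ℝ) → Matrix ι ι ℂ) (Ω : Fin 3 → ℝ)
    (V : (Fin 3 → ℝ) → Matrix ι ι ℂ) (ε : ι → (Fin 3 → ℝ) → ℝ) : Prop where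
  smooth : SmoothPeriodic V
  unitary : ∀ θ, V θ ∈ Matrix.unitaryGroup ι ℂ
  quasienergy : ∀ α θ θ', (∀ j : Fin 3, (j : ℕ) < d → θ j = θ' j) → ε α θ = ε α θ'
  schrodinger : ∀ θ₀ α t a,
    HasDerivAt
      (fun s : ℝ => Complex.exp (-Complex.I * ε α θ₀ * s) * V (phase Ω θ₀ s) a α)
      (-Complex.I * ∑ b, H (phase Ω θ₀ t) a b *
        (Complex.exp (-Complex.I * ε α θ₀ * t) * V (phase Ω θ₀ t) b α)) t

/-- The winding number
`W[V] = C₃ ∫ ε^{jkl} tr ((V† ∂ⱼ V) (V† ∂ₖ V) (V† ∂ₗ V)) d³θ`, `C₃ = 1! / (3! (2πi)²)`. -/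
def windingNumber (V : (Fin 3 → ℝ) → Matrix ι ι ℂ) : ℂ :=
  1 / (6 * (2 * Real.pi * Complex.I) ^ 2) *
    ∫ θ in cube, ∑ σ : Equiv.Perm (Fin 3), ((Equiv.Perm.sign σ : ℤ) : ℂ) *
      (((V θ)ᴴ * pderiv (σ 0) V θ) * ((V θ)ᴴ * pderiv (σ 1) V θ) *
        ((V θ)ᴴ * pderiv (σ 2) V θ)).trace

/-- The Heisenberg current `ṅⱼ(t; θ₀) = U† (-∂ⱼ H)(θ_t) U`. -/
def ndot (H : (Fin 3 → ℝ) → Matrix ι ι ℂ) (Ω : Fin 3 → ℝ)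
    (U : (Fin 3 → ℝ) → ℝ → Matrix ι ι ℂ) (θ₀ : Fin 3 → ℝ) (t : ℝ) (j : Fin 3) : Matrix ι ι ℂ :=
  (U θ₀ t)ᴴ * (-pderiv j H (phase Ω θ₀ t)) * U θ₀ t

/-- The position `nⱼ(t; θ₀) = nⱼ(0) + ∫₀ᵗ ṅⱼ`, with arbitrary constant of integration `n₀`. -/
def npos (H : (Fin 3 → ℝ) → Matrix ι ι ℂ) (Ω : Fin 3 → ℝ)
    (U : (Fin 3 → ℝ) → ℝ → Matrix ι ι ℂ) (n₀ : Fin 3 → Matrix ι ι ℂ)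
    (θ₀ : Fin 3 → ℝ) (t : ℝ) (j : Fin 3) : Matrix ι ι ℂ :=
  n₀ j + Matrix.of fun a b => ∫ s in (0 : ℝ)..t, ndot H Ω U θ₀ s j a b

/-- The Euclidean length `|Ω|`. -/
def freqNorm (Ω : Fin 3 → ℝ) : ℝ := Real.sqrt (∑ j, Ω j ^ 2)

/-- `(A × B) · u` for vectors of operators `A`, `B` and a real vector `u`
(indices in `Fin 3` are added cyclically). -/
def tripleProduct (A B : Fin 3 → Matrix ι ι ℂ) (u : Fin 3 → ℝ) : Matrix ι ι ℂ :=
  ∑ c : Fin 3, (u c : ℂ) • (A (c + 1) * B (c + 2) - A (c + 2) * B (c + 1))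

/-- The circulation operator `M(t) = ¼ (n × ṅ) · Ω̂ + h.c.` -/
def circulation (H : (Fin 3 → ℝ) → Matrix ι ι ℂ) (Ω : Fin 3 → ℝ)
    (U : (Fin 3 → ℝ) → ℝ → Matrix ι ι ℂ) (n₀ : Fin 3 → Matrix ι ι ℂ)
    (θ₀ : Fin 3 → ℝ) (t : ℝ) : Matrix ι ι ℂ :=
  let X := (1 / 4 : ℂ) • tripleProduct (npos H Ω U n₀ θ₀ t) (ndot H Ω U θ₀ t)
    (fun j => Ω j / freqNorm Ω)
  X + Xᴴ

/-- `⟪A⟫_T = (1/T) ∫₀ᵀ tr A(t) dt`. -/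
def timeAverage (A : ℝ → Matrix ι ι ℂ) (T : ℝ) : ℂ :=
  (1 / T : ℂ) * ∫ t in (0 : ℝ)..T, (A t).trace

/-- The deviation `|⟪M⟫_T - (|Ω| / 2π) W[V]|` of the averaged circulation from its quantized
value. -/
def deviation (H : (Fin 3 → ℝ) → Matrix ι ι ℂ) (Ω : Fin 3 → ℝ)
    (V : (Fin 3 → ℝ) → Matrix ι ι ℂ) (U : (Fin 3 → ℝ) → ℝ → Matrix ι ι ℂ)
    (n₀ : Fin 3 → Matrix ι ι ℂ) (θ₀ : Fin 3 → ℝ) (T : ℝ) : ℝ :=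
  ‖timeAverage (circulation H Ω U n₀ θ₀) T
    - (freqNorm Ω / (2 * Real.pi) : ℂ) * windingNumber V‖

/-- The size (sum of the absolute values of all entries) of the constant of integration. -/
def size (n₀ : Fin 3 → Matrix ι ι ℂ) : ℝ := ∑ j, ∑ a, ∑ b, ‖n₀ j a b‖

end General

/-- The drive frequencies `Ω j`, `d ≤ j`, are incommensurate (and the other components vanish). -/
def Incommensurate (d : ℕ) (Ω : Fin 3 → ℝ) : Prop :=
  (∀ j : Fin 3, (j : ℕ) < d → Ω j = 0) ∧
    ∀ k : Fin 3 → ℤ, (∀ j : Fin 3, (j : ℕ) < d → k j = 0) → ∑ j, (k j : ℝ) * Ω j = 0 → k = 0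

/-- The drive frequencies are Diophantine: `|k · Ω| ≥ γ / |k|^τ` for all nonzero integer vectors
`k` in the drive directions, for some `γ > 0` and some `τ`. -/
def Diophantine (d : ℕ) (Ω : Fin 3 → ℝ) : Prop :=
  (∀ j : Fin 3, (j : ℕ) < d → Ω j = 0) ∧
    ∃ γ : ℝ, 0 < γ ∧ ∃ τ : ℕ, ∀ k : Fin 3 → ℤ, (∀ j : Fin 3, (j : ℕ) < d → k j = 0) → k ≠ 0 →
      γ ≤ |∑ j, (k j : ℝ) * Ω j| * ‖fun j => (k j : ℝ)‖ ^ τ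

/-- The single-particle basis of a `d`-dimensional periodic lattice of linear size `L` with `N`
internal states per site. -/
abbrev Site (d L N : ℕ) : Type := ({j : Fin 3 // (j : ℕ) < d} → Fin L) × Fin N

/-- The point of the unwrapped frequency lattice `ℤ³` with coordinates `rⱼ + L mⱼ` in the spatial
directions and `mⱼ` in the drive directions. It corresponds to the term `e^{-i m·θ}` on site `r`:
a winding by `mⱼ` around the `j`th spatial direction acquires the phase `e^{-i mⱼ Φⱼ}`. -/
def latticePoint {d L : ℕ} (r : {j : Fin 3 // (j : ℕ) < d} → Fin L) (m : Fin 3 → ℤ) :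
    Fin 3 → ℤ :=
  fun j => if h : (j : ℕ) < d then ((r ⟨j, h⟩ : ℕ) : ℤ) + L * m j else m j

/-- The largest absolute value of a spatial component. -/
def spatialNorm (d : ℕ) (x : Fin 3 → ℤ) : ℝ := ‖fun j : {j : Fin 3 // (j : ℕ) < d} => (x j : ℝ)‖

/-- The largest absolute value of a drive component. -/
def driveNorm (d : ℕ) (x : Fin 3 → ℤ) : ℝ := ‖fun j : {j : Fin 3 // d ≤ (j : ℕ)} => (x j : ℝ)‖

/-- The Fourier coefficient `f_m` in `f(θ) = ∑ₘ f_m e^{-i m·θ}`. -/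
def torusCoeff (f : (Fin 3 → ℝ) → ℂ) (m : Fin 3 → ℤ) : ℂ :=
  1 / (2 * Real.pi) ^ 3 * ∫ θ in cube, f θ * Complex.exp (Complex.I * ∑ j, (m j : ℂ) * (θ j : ℂ))

/-- The family of states `ψ(θ)` is localized around the point `x` of the frequency lattice:
exponentially, with length `ξ`, in the spatial directions, and faster than any power in the drive
directions (which expresses smoothness in the drive phases). -/
def LocalizedAt {d L N : ℕ} (ξ : ℝ) (K : ℕ → ℝ) (ψ : (Fin 3 → ℝ) → Site d L N → ℂ)
    (x : Fin 3 → ℤ) : Prop :=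
  ∀ (k : ℕ) (a : Site d L N) (m : Fin 3 → ℤ),
    ‖torusCoeff (fun θ => ψ θ a) m‖ ≤
      K k * Real.exp (-spatialNorm d (latticePoint a.1 m - x) / ξ) /
        (1 + driveNorm d (latticePoint a.1 m - x)) ^ k

/-- A quasilocal tight-binding Hamiltonian: the amplitudes for hopping on the frequency lattice
away from the site `b` are localized around that site. -/
def IsTightBinding {d L N : ℕ} (ξ : ℝ) (K : ℕ → ℝ)
    (H : (Fin 3 → ℝ) → Matrix (Site d L N) (Site d L N) ℂ) : Prop :=
  ∀ b, LocalizedAt ξ K (fun θ a => H θ a b) (latticePoint b.1 0)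

/-- Every quasienergy state is localized around some point of the frequency lattice. -/
def IsLocalized {d L N : ℕ} (ξ : ℝ) (K : ℕ → ℝ)
    (V : (Fin 3 → ℝ) → Matrix (Site d L N) (Site d L N) ℂ) : Prop :=
  ∀ α, ∃ x : Fin 3 → ℤ, LocalizedAt ξ K (fun θ a => V θ a α) x

end

end ALTP

/-! In the frame of the quasienergy states the evolution is `U(t) = V(θ_t) S(t)` with `S(t) =
e^{-iεt} V(θ₀)†` (`evolution_eq`). Write `A_j = V†∂_jV` and `Q_j = S†A_jS`. Differentiating the
Floquet equation `Vε = HV - iΩ·∂V` in `θ_j` shows that `ṅ_j = -i dQ_j/dt - P_j`, where the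
persistent current `P_j = V(∂_jε)V†` does not depend on time (`ndot_eq`). So `n_j` is explicit, and
`tr(n_jṅ_k - n_kṅ_j)` is a total time derivative, minus `tr(A_jR_k - A_kR_j)` with `R_j = i[ε,A_j] +
Ω·∂A_j`, minus a persistent-current term; the last two are functions of `θ_t` alone
(`integral_pair`).

The torus average of this integrand is topological. The connection `A` is flat, so an integration by
parts cancels the commutators with `ε` against the persistent-current term. The remaining integrals
of `tr A_j∂_lA_k` vanish for coinciding indices and are otherwise fixed by the integral of `tr
A₀[A₁,A₂]`. Weighting the planes by `Ω` produces `|Ω|²` times that integral (`planeSum_integral`,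
`quantized_eq`).

The error thus has three sources: boundary terms divided by `T`, persistent currents, and the
difference between time and torus averages (`deviation_le`). A Fourier mode with `m·Ω ≠ 0` averages
out like `1/(T|m·Ω|)`; under the Diophantine condition smoothness pays for the small divisors, and
otherwise dominated convergence suffices. Resonant modes `m ≠ 0`, `m·Ω = 0` need a nonzero flux
component. Without spatial dimensions there are none, and `ε` is constant, which gives (a).

For lattices everything must be uniform in `L`. Multiplying the states by Fourier modes moves their
centres to the home cell without changing the winding number (`windingNumber_mul_modeMatrix`).
Afterwards the mode `m` of a matrix element is a hop to the copy displaced by `Lm`. The exponential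
weight of such hops is submultiplicative along paths (`hopWeight_add`), so weighted Fourier bounds
survive matrix products. Closed paths with nonzero flux winding cost `e^{-κL}`, which makes
resonances and flux derivatives of `ε` exponentially small. It remains to avoid a volume factor in
the traces. Flux derivatives of the states only see hops across the wall of the home cell, and a
plane normal to a drive direction contains all spatial directions. The product of its two connection
components therefore lives near one corner, and its trace is bounded independently of `L`
(`connEstimate`). The volume factor in the persistent currents is absorbed by lowering the decay
rate towards `1/ξ'`. -/

namespace ALTP

/-! ### Smooth periodic functions on the torus -/

/-- A smooth `2π`-periodic function of three angles. -/
def SmoothTorus (f : (Fin 3 → ℝ) → ℂ) : Prop :=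
  ContDiff ℝ ∞ f ∧ ∀ θ j, f (θ + Pi.single j (2 * Real.pi)) = f θ

/-- The partial derivative `∂ⱼ f`. -/
noncomputable def partialD (j : Fin 3) (f : (Fin 3 → ℝ) → ℂ) (θ : Fin 3 → ℝ) : ℂ :=
  deriv (fun s : ℝ => f (θ + Pi.single j s)) 0

/-- The derivative `Ω · ∂ f` along the drive. -/
noncomputable def driftD (Ω : Fin 3 → ℝ) (f : (Fin 3 → ℝ) → ℂ) (θ : Fin 3 → ℝ) : ℂ :=
  ∑ j, (Ω j : ℂ) * partialD j f θ

lemma hasDerivAt_add_single (j : Fin 3) (θ : Fin 3 → ℝ) (t : ℝ) :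
    HasDerivAt (fun s : ℝ => θ + Pi.single j s) (Pi.single j 1) t := by
  refine (hasDerivAt_pi.2 fun i => ?_)
  by_cases h : i = j
  · subst h
    simpa using (hasDerivAt_id t).const_add (θ i)
  · simpa [h] using hasDerivAt_const t (θ i)

lemma partialD_eq_fderiv {f : (Fin 3 → ℝ) → ℂ} {θ : Fin 3 → ℝ} (h : DifferentiableAt ℝ f θ)
    (j : Fin 3) : partialD j f θ = fderiv ℝ f θ (Pi.single j 1) := by
  have h0 : HasFDerivAt f (fderiv ℝ f θ) (θ + Pi.single j (0 : ℝ)) := by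
    simpa using h.hasFDerivAt
  exact (h0.comp_hasDerivAt 0 (hasDerivAt_add_single j θ 0)).deriv

lemma hasDerivAt_partialD {f : (Fin 3 → ℝ) → ℂ} (h : Differentiable ℝ f) (j : Fin 3)
    (θ : Fin 3 → ℝ) (t : ℝ) :
    HasDerivAt (fun s : ℝ => f (θ + Pi.single j s)) (partialD j f (θ + Pi.single j t)) t := by
  rw [partialD_eq_fderiv (h _)]
  exact (h _).hasFDerivAt.comp_hasDerivAt t (hasDerivAt_add_single j θ t)

lemma partialD_of_hasDerivAt {f : (Fin 3 → ℝ) → ℂ} {j : Fin 3} {θ : Fin 3 → ℝ} {c : ℂ}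
    (h : HasDerivAt (fun s : ℝ => f (θ + Pi.single j s)) c 0) : partialD j f θ = c :=
  h.deriv

namespace SmoothTorus

variable {f g : (Fin 3 → ℝ) → ℂ}

lemma differentiable (hf : SmoothTorus f) : Differentiable ℝ f :=
  hf.1.differentiable (by simp)

lemma continuous (hf : SmoothTorus f) : Continuous f := hf.1.continuous

lemma const (c : ℂ) : SmoothTorus fun _ => c := ⟨contDiff_const, fun _ _ => rfl⟩

lemma add (hf : SmoothTorus f) (hg : SmoothTorus g) : SmoothTorus fun θ => f θ + g θ :=
  ⟨hf.1.add hg.1, fun θ j => by simp only [hf.2, hg.2]⟩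

lemma sub (hf : SmoothTorus f) (hg : SmoothTorus g) : SmoothTorus fun θ => f θ - g θ :=
  ⟨hf.1.sub hg.1, fun θ j => by simp only [hf.2, hg.2]⟩

lemma mul (hf : SmoothTorus f) (hg : SmoothTorus g) : SmoothTorus fun θ => f θ * g θ :=
  ⟨hf.1.mul hg.1, fun θ j => by simp only [hf.2, hg.2]⟩

lemma const_mul (c : ℂ) (hf : SmoothTorus f) : SmoothTorus fun θ => c * f θ :=
  (const c).mul hf

lemma star (hf : SmoothTorus f) : SmoothTorus fun θ => star (f θ) :=
  ⟨(Complex.conjCLE.contDiff.comp hf.1 :), fun θ j => by simp only [hf.2]⟩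

lemma sum {κ : Type*} (s : Finset κ) {F : κ → (Fin 3 → ℝ) → ℂ}
    (h : ∀ i ∈ s, SmoothTorus (F i)) : SmoothTorus fun θ => ∑ i ∈ s, F i θ :=
  ⟨ContDiff.sum fun i hi => (h i hi).1,
    fun θ j => Finset.sum_congr rfl fun i hi => (h i hi).2 θ j⟩

lemma partialD_eq (hf : SmoothTorus f) (j : Fin 3) :
    partialD j f = fun θ => fderiv ℝ f θ (Pi.single j 1) :=
  funext fun θ => partialD_eq_fderiv (hf.differentiable θ) j

lemma partialD (hf : SmoothTorus f) (j : Fin 3) : SmoothTorus (partialD j f) := by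
  refine ⟨?_, fun θ k => ?_⟩
  · rw [hf.partialD_eq]
    exact (hf.1.fderiv_right (m := ∞) (by simp)).clm_apply contDiff_const
  · unfold ALTP.partialD
    congr 1
    funext s
    rw [add_right_comm, hf.2]

lemma driftD (hf : SmoothTorus f) (Ω : Fin 3 → ℝ) : SmoothTorus (driftD Ω f) :=
  sum _ fun j _ => (hf.partialD j).const_mul _

lemma hasDerivAt_phase (hf : SmoothTorus f) (Ω θ₀ : Fin 3 → ℝ) (t : ℝ) :
    HasDerivAt (fun s => f (phase Ω θ₀ s)) (ALTP.driftD Ω f (phase Ω θ₀ t)) t := by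
  have h1 : HasDerivAt (fun s => phase Ω θ₀ s) Ω t := by
    unfold phase
    simpa using ((hasDerivAt_id t).smul_const Ω).const_add θ₀
  have h2 := (hf.differentiable (phase Ω θ₀ t)).hasFDerivAt.comp_hasDerivAt t h1
  convert! h2 using 1
  unfold ALTP.driftD
  have : Ω = ∑ j, Ω j • (Pi.single j 1 : Fin 3 → ℝ) := by
    funext i
    simp [Finset.sum_apply, Pi.single_apply]
  have h3 : ∀ Λ : (Fin 3 → ℝ) →L[ℝ] ℂ, Λ Ω = Λ (∑ j, Ω j • (Pi.single j 1 : Fin 3 → ℝ)) :=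
    fun Λ => congrArg Λ this
  rw [h3, map_sum]
  refine Finset.sum_congr rfl fun j _ => ?_
  rw [map_smul, hf.partialD_eq, Complex.real_smul]

end SmoothTorus

/-! ### Differentiation rules for smooth functions on the torus. -/

section Rules

variable {f g : (Fin 3 → ℝ) → ℂ}

lemma partialD_const (j : Fin 3) (c : ℂ) (θ : Fin 3 → ℝ) : partialD j (fun _ => c) θ = 0 := by
  simp [partialD]

lemma hasDerivAt_partialD_zero (hf : SmoothTorus f) (j : Fin 3) (θ : Fin 3 → ℝ) :
    HasDerivAt (fun s : ℝ => f (θ + Pi.single j s)) (partialD j f θ) 0 := by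
  simpa using hasDerivAt_partialD hf.differentiable j θ 0

lemma partialD_sub (hf : SmoothTorus f) (hg : SmoothTorus g) (j : Fin 3) (θ : Fin 3 → ℝ) :
    partialD j (fun θ => f θ - g θ) θ = partialD j f θ - partialD j g θ :=
  ((hasDerivAt_partialD_zero hf j θ).sub (hasDerivAt_partialD_zero hg j θ)).deriv

lemma partialD_mul (hf : SmoothTorus f) (hg : SmoothTorus g) (j : Fin 3) (θ : Fin 3 → ℝ) :
    partialD j (fun θ => f θ * g θ) θ = partialD j f θ * g θ + f θ * partialD j g θ := by
  refine ((hasDerivAt_partialD_zero hf j θ).mul (hasDerivAt_partialD_zero hg j θ)).deriv.trans ?_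
  simp

lemma partialD_const_mul (c : ℂ) (hf : SmoothTorus f) (j : Fin 3) (θ : Fin 3 → ℝ) :
    partialD j (fun θ => c * f θ) θ = c * partialD j f θ :=
  ((hasDerivAt_partialD_zero hf j θ).const_mul c).deriv

lemma partialD_star (hf : SmoothTorus f) (j : Fin 3) (θ : Fin 3 → ℝ) :
    partialD j (fun θ => star (f θ)) θ = star (partialD j f θ) :=
  (hasDerivAt_partialD_zero hf j θ).star.deriv

lemma partialD_sum {κ : Type*} (s : Finset κ) {F : κ → (Fin 3 → ℝ) → ℂ}
    (h : ∀ i ∈ s, SmoothTorus (F i)) (j : Fin 3) (θ : Fin 3 → ℝ) :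
    partialD j (fun θ => ∑ i ∈ s, F i θ) θ = ∑ i ∈ s, partialD j (F i) θ :=
  (HasDerivAt.fun_sum fun i hi => hasDerivAt_partialD_zero (h i hi) j θ).deriv

lemma partialD_comm (hf : SmoothTorus f) (j k : Fin 3) (θ : Fin 3 → ℝ) :
    partialD j (partialD k f) θ = partialD k (partialD j f) θ := by
  have h2 : ∀ i l : Fin 3, partialD i (partialD l f) θ =
      fderiv ℝ (fderiv ℝ f) θ (Pi.single i 1) (Pi.single l 1) := fun i l => by
    rw [partialD_eq_fderiv ((hf.partialD l).differentiable θ), hf.partialD_eq]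
    have hd : DifferentiableAt ℝ (fderiv ℝ f) θ :=
      ((hf.1.fderiv_right (m := ∞) (by simp)).differentiable (by simp)) θ
    rw [fderiv_clm_apply hd (differentiableAt_const _)]
    simp
  rw [h2, h2]
  exact (hf.1.contDiffAt.isSymmSndFDerivAt (by
    rw [minSmoothness_of_isRCLikeNormedField]
    exact WithTop.coe_le_coe.2 (le_top : (2 : ℕ∞) ≤ ⊤))) _ _

end Rules

/-! ### Integrals over the torus -/

lemma SmoothTorus.integrableOn {f : (Fin 3 → ℝ) → ℂ} (hf : Continuous f) :
    IntegrableOn f cube :=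
  hf.continuousOn.integrableOn_compact isCompact_Icc

/-- The integral of a derivative over the torus vanishes. -/
lemma integral_partialD {f : (Fin 3 → ℝ) → ℂ} (hf : SmoothTorus f) (j : Fin 3) :
    ∫ θ in cube, partialD j f θ = 0 := by
  -- Divergence theorem for the vector field with `f` in direction `j` and zero elsewhere.
  have key := integral_divergence_of_hasFDerivAt_off_countable' (n := 2) (E := ℂ)
    0 (fun _ => 2 * Real.pi) (fun _ => by simpa using Real.pi_pos.le)
    (fun i => if i = j then f else 0) (fun i => if i = j then fderiv ℝ f else 0) ∅
    Set.countable_empty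
    (fun i => by
      split_ifs
      · exact hf.continuous.continuousOn
      · exact continuousOn_const)
    (fun x _ i => by
      split_ifs
      · exact (hf.differentiable x).hasFDerivAt
      · exact hasFDerivAt_const (0 : ℂ) x)
    (by
      have : (fun x => ∑ i, (if i = j then fderiv ℝ f else 0) x (Pi.single i 1)) =
          partialD j f := by
        rw [hf.partialD_eq]
        funext x
        rw [Finset.sum_eq_single j] <;> simp +contextual
      rw [this]
      exact SmoothTorus.integrableOn (hf.partialD j).continuous)
  have e1 : ∀ x, ∑ i, (if i = j then fderiv ℝ f else 0) x (Pi.single i 1) = partialD j f x := by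
    intro x
    rw [hf.partialD_eq, Finset.sum_eq_single j] <;> simp +contextual
  simp only [e1] at key
  unfold cube
  rw [key]
  refine Finset.sum_eq_zero fun i _ => ?_
  by_cases hi : i = j
  · subst hi
    simp only [if_true]
    -- Opposite faces carry the same values by periodicity.
    rw [sub_eq_zero]
    congr 1
    funext x
    refine (congrArg f ?_).trans (hf.2 (Fin.insertNth i 0 x) i)
    funext l
    refine Fin.succAboveCases i ?_ (fun m => ?_) l <;> simp
  · simp [hi]

/-! ### Matrix-valued functions -/

section MatrixCalculus

set_option linter.unusedSectionVars false

variable {ι : Type} [Fintype ι] [DecidableEq ι]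

/-- All matrix entries are smooth functions on the torus. -/
def SmoothMatrix (A : (Fin 3 → ℝ) → Matrix ι ι ℂ) : Prop :=
  ∀ a b, SmoothTorus fun θ => A θ a b

/-- The entrywise derivative of a curve of matrices. -/
def MatrixDeriv (A : ℝ → Matrix ι ι ℂ) (A' : Matrix ι ι ℂ) (t : ℝ) : Prop :=
  ∀ a b, HasDerivAt (fun s => A s a b) (A' a b) t

/-- The derivative `Ω · ∂ A` along the drive. -/
noncomputable def driftM (Ω : Fin 3 → ℝ) (A : (Fin 3 → ℝ) → Matrix ι ι ℂ) (θ : Fin 3 → ℝ) :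
    Matrix ι ι ℂ :=
  ∑ j, (Ω j : ℂ) • pderiv j A θ

lemma SmoothPeriodic.smoothMatrix {A : (Fin 3 → ℝ) → Matrix ι ι ℂ} (h : SmoothPeriodic A) :
    SmoothMatrix A := fun a b => ⟨h.1 a b, fun θ j => by simp only [h.2]⟩

lemma SmoothMatrix.smoothPeriodic {A : (Fin 3 → ℝ) → Matrix ι ι ℂ} (h : SmoothMatrix A) :
    SmoothPeriodic A := ⟨fun a b => (h a b).1, fun θ j => by ext a b; exact (h a b).2 θ j⟩

lemma pderiv_apply (j : Fin 3) (A : (Fin 3 → ℝ) → Matrix ι ι ℂ) (θ : Fin 3 → ℝ) (a b : ι) :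
    pderiv j A θ a b = partialD j (fun θ => A θ a b) θ := rfl

lemma driftM_apply (Ω : Fin 3 → ℝ) (A : (Fin 3 → ℝ) → Matrix ι ι ℂ) (θ : Fin 3 → ℝ) (a b : ι) :
    driftM Ω A θ a b = driftD Ω (fun θ => A θ a b) θ := by
  simp [driftM, driftD, Matrix.sum_apply, pderiv_apply]

namespace SmoothMatrix

variable {A B : (Fin 3 → ℝ) → Matrix ι ι ℂ}

lemma add (hA : SmoothMatrix A) (hB : SmoothMatrix B) : SmoothMatrix fun θ => A θ + B θ :=
  fun a b => (hA a b).add (hB a b)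

lemma sub (hA : SmoothMatrix A) (hB : SmoothMatrix B) : SmoothMatrix fun θ => A θ - B θ :=
  fun a b => (hA a b).sub (hB a b)

lemma smul (c : ℂ) (hA : SmoothMatrix A) : SmoothMatrix fun θ => c • A θ :=
  fun a b => (hA a b).const_mul c

lemma conjTranspose (hA : SmoothMatrix A) : SmoothMatrix fun θ => (A θ)ᴴ :=
  fun a b => (hA b a).star

lemma mul (hA : SmoothMatrix A) (hB : SmoothMatrix B) : SmoothMatrix fun θ => A θ * B θ :=
  fun a b => by
    simp only [Matrix.mul_apply]
    exact SmoothTorus.sum _ fun c _ => (hA a c).mul (hB c b)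

lemma pderiv (hA : SmoothMatrix A) (j : Fin 3) : SmoothMatrix (pderiv j A) :=
  fun a b => (hA a b).partialD j

lemma driftM (hA : SmoothMatrix A) (Ω : Fin 3 → ℝ) : SmoothMatrix (driftM Ω A) := fun a b => by
  simp only [driftM_apply]
  exact (hA a b).driftD Ω

lemma trace (hA : SmoothMatrix A) : SmoothTorus fun θ => (A θ).trace :=
  SmoothTorus.sum _ fun a _ => hA a a

lemma matrixDeriv (hA : SmoothMatrix A) (Ω θ₀ : Fin 3 → ℝ) (t : ℝ) :
    MatrixDeriv (fun s => A (phase Ω θ₀ s)) (ALTP.driftM Ω A (phase Ω θ₀ t)) t := fun a b => by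
  rw [driftM_apply]
  exact (hA a b).hasDerivAt_phase Ω θ₀ t

end SmoothMatrix

variable {A B : (Fin 3 → ℝ) → Matrix ι ι ℂ}

lemma pderiv_sub (hA : SmoothMatrix A) (hB : SmoothMatrix B) (j : Fin 3) (θ : Fin 3 → ℝ) :
    pderiv j (fun θ => A θ - B θ) θ = pderiv j A θ - pderiv j B θ := by
  ext a b; exact partialD_sub (hA a b) (hB a b) j θ

lemma pderiv_smul (c : ℂ) (hA : SmoothMatrix A) (j : Fin 3) (θ : Fin 3 → ℝ) :
    pderiv j (fun θ => c • A θ) θ = c • pderiv j A θ := by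
  ext a b; exact partialD_const_mul c (hA a b) j θ

lemma pderiv_conjTranspose (hA : SmoothMatrix A) (j : Fin 3) (θ : Fin 3 → ℝ) :
    pderiv j (fun θ => (A θ)ᴴ) θ = (pderiv j A θ)ᴴ := by
  ext a b; exact partialD_star (hA b a) j θ

lemma pderiv_mul (hA : SmoothMatrix A) (hB : SmoothMatrix B) (j : Fin 3) (θ : Fin 3 → ℝ) :
    pderiv j (fun θ => A θ * B θ) θ = pderiv j A θ * B θ + A θ * pderiv j B θ := by
  ext a b
  simp only [pderiv_apply, Matrix.mul_apply, Matrix.add_apply]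
  rw [partialD_sum _ fun c _ => (hA a c).mul (hB c b), ← Finset.sum_add_distrib]
  exact Finset.sum_congr rfl fun c _ => partialD_mul (hA a c) (hB c b) j θ

lemma pderiv_const (C : Matrix ι ι ℂ) (j : Fin 3) (θ : Fin 3 → ℝ) :
    pderiv j (fun _ => C) θ = 0 := by
  ext a b; exact partialD_const j _ θ

lemma pderiv_comm (hA : SmoothMatrix A) (j k : Fin 3) (θ : Fin 3 → ℝ) :
    pderiv j (pderiv k A) θ = pderiv k (pderiv j A) θ := by
  ext a b; exact partialD_comm (hA a b) j k θ

lemma partialD_trace (hA : SmoothMatrix A) (j : Fin 3) (θ : Fin 3 → ℝ) :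
    partialD j (fun θ => (A θ).trace) θ = (pderiv j A θ).trace :=
  partialD_sum _ (fun a _ => hA a a) j θ

/-- Integration by parts on the torus. -/
lemma integral_trace_pderiv_mul (hA : SmoothMatrix A) (hB : SmoothMatrix B) (j : Fin 3) :
    ∫ θ in cube, (A θ * pderiv j B θ).trace = -∫ θ in cube, (pderiv j A θ * B θ).trace := by
  have h := integral_partialD (hA.mul hB).trace j
  rw [← add_eq_zero_iff_eq_neg, ← integral_add, ← h]
  · congr 1
    funext θ
    rw [partialD_trace (hA.mul hB), pderiv_mul hA hB, Matrix.trace_add, add_comm]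
  · exact SmoothTorus.integrableOn (hA.mul (hB.pderiv j)).trace.continuous
  · exact SmoothTorus.integrableOn ((hA.pderiv j).mul hB).trace.continuous

lemma driftM_mul (Ω : Fin 3 → ℝ) (hA : SmoothMatrix A) (hB : SmoothMatrix B) (θ : Fin 3 → ℝ) :
    driftM Ω (fun θ => A θ * B θ) θ = driftM Ω A θ * B θ + A θ * driftM Ω B θ := by
  simp only [driftM, pderiv_mul hA hB, Finset.sum_mul, Finset.mul_sum, smul_add,
    Finset.sum_add_distrib, Matrix.smul_mul, Matrix.mul_smul]

lemma driftM_conjTranspose (Ω : Fin 3 → ℝ) (hA : SmoothMatrix A) (θ : Fin 3 → ℝ) :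
    driftM Ω (fun θ => (A θ)ᴴ) θ = (driftM Ω A θ)ᴴ := by
  simp [driftM, pderiv_conjTranspose hA, Matrix.conjTranspose_sum, Matrix.conjTranspose_smul]

lemma pderiv_driftM (Ω : Fin 3 → ℝ) (hA : SmoothMatrix A) (j : Fin 3) (θ : Fin 3 → ℝ) :
    pderiv j (driftM Ω A) θ = driftM Ω (pderiv j A) θ := by
  ext a b
  rw [pderiv_apply]
  simp only [driftM_apply, driftD]
  rw [partialD_sum _ fun l _ => ((hA a b).partialD l).const_mul _]
  refine Finset.sum_congr rfl fun l _ => ?_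
  rw [partialD_const_mul _ ((hA a b).partialD l), partialD_comm (hA a b)]
  rfl

namespace MatrixDeriv

variable {X Y : ℝ → Matrix ι ι ℂ} {X' Y' : Matrix ι ι ℂ} {t : ℝ}

lemma const (C : Matrix ι ι ℂ) : MatrixDeriv (fun _ => C) 0 t := fun _ _ => hasDerivAt_const _ _

lemma conjTranspose (h : MatrixDeriv X X' t) : MatrixDeriv (fun s => (X s)ᴴ) X'ᴴ t :=
  fun a b => (h b a).star

lemma mul (hX : MatrixDeriv X X' t) (hY : MatrixDeriv Y Y' t) :
    MatrixDeriv (fun s => X s * Y s) (X' * Y t + X t * Y') t := fun a b => by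
  simp only [Matrix.mul_apply, Matrix.add_apply, ← Finset.sum_add_distrib]
  exact HasDerivAt.fun_sum fun c _ => (hX a c).mul (hY c b)

lemma trace (hX : MatrixDeriv X X' t) : HasDerivAt (fun s => (X s).trace) X'.trace t :=
  HasDerivAt.fun_sum fun a _ => hX a a

lemma congr_deriv {X'' : Matrix ι ι ℂ} (hX : MatrixDeriv X X' t) (h : X' = X'') :
    MatrixDeriv X X'' t := h ▸ hX

lemma eq_of_zero (h : ∀ t, MatrixDeriv X 0 t) (s t : ℝ) : X s = X t := by
  ext a b
  exact is_const_of_deriv_eq_zero (fun t => (h t a b).differentiableAt)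
    (fun t => (h t a b).deriv) s t

end MatrixDeriv

end MatrixCalculus

/-! ### The Floquet representation of the evolution -/

section Floquet

set_option linter.unusedSectionVars false

variable {ι : Type} [Fintype ι] [DecidableEq ι]

/-- The pulled-back connection `V† ∂ⱼ V`. -/
noncomputable def conn (V : (Fin 3 → ℝ) → Matrix ι ι ℂ) (j : Fin 3) (θ : Fin 3 → ℝ) :
    Matrix ι ι ℂ := (V θ)ᴴ * pderiv j V θ

/-- The diagonal matrix of quasienergies. -/
noncomputable def energyMatrix (ε : ι → (Fin 3 → ℝ) → ℝ) (θ : Fin 3 → ℝ) : Matrix ι ι ℂ :=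
  Matrix.diagonal fun α => (ε α θ : ℂ)

/-- The covariant time derivative `i [ε, Aⱼ] + Ω · ∂ Aⱼ` of the connection. -/
noncomputable def connRate (Ω : Fin 3 → ℝ) (V : (Fin 3 → ℝ) → Matrix ι ι ℂ)
    (ε : ι → (Fin 3 → ℝ) → ℝ) (j : Fin 3) (θ : Fin 3 → ℝ) : Matrix ι ι ℂ :=
  Complex.I • (energyMatrix ε θ * conn V j θ - conn V j θ * energyMatrix ε θ)
    + driftM Ω (conn V j) θ

/-- The evolution `exp (-i ε t) V(θ₀)†` in the frame of the quasienergy states. -/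
noncomputable def frame (V : (Fin 3 → ℝ) → Matrix ι ι ℂ) (ε : ι → (Fin 3 → ℝ) → ℝ)
    (θ₀ : Fin 3 → ℝ) (t : ℝ) : Matrix ι ι ℂ :=
  Matrix.diagonal (fun α => Complex.exp (-Complex.I * ε α θ₀ * t)) * (V θ₀)ᴴ

variable {d : ℕ} {H V : (Fin 3 → ℝ) → Matrix ι ι ℂ} {Ω : Fin 3 → ℝ} {ε : ι → (Fin 3 → ℝ) → ℝ}
  {U : (Fin 3 → ℝ) → ℝ → Matrix ι ι ℂ}

lemma phase_zero (Ω θ₀ : Fin 3 → ℝ) : phase Ω θ₀ 0 = θ₀ := by simp [phase]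

lemma IsMicromotion.star_mul_self (hV : IsMicromotion d H Ω V ε) (θ : Fin 3 → ℝ) :
    (V θ)ᴴ * V θ = 1 := (Matrix.mem_unitaryGroup_iff').1 (hV.unitary θ)

lemma IsMicromotion.mul_star_self (hV : IsMicromotion d H Ω V ε) (θ : Fin 3 → ℝ) :
    V θ * (V θ)ᴴ = 1 := (Matrix.mem_unitaryGroup_iff).1 (hV.unitary θ)

/-- Since every phase may serve as initial phase, the Schrödinger equation of the states at time `0`
already gives the Floquet eigenvalue equation on the whole torus. -/
lemma IsMicromotion.floquet (hV : IsMicromotion d H Ω V ε) (θ : Fin 3 → ℝ) :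
    V θ * energyMatrix ε θ = H θ * V θ - Complex.I • driftM Ω V θ := by
  ext a α
  have h1 := hV.schrodinger θ α 0 a
  have h2 : HasDerivAt (fun s : ℝ => Complex.exp (-Complex.I * ε α θ * s))
      (Complex.exp (-Complex.I * ε α θ * (0 : ℝ)) * (-Complex.I * ε α θ * 1)) 0 :=
    ((Complex.ofRealCLM.hasDerivAt (x := (0 : ℝ))).const_mul _).cexp
  have h3 := h1.unique (h2.mul (hV.smooth.smoothMatrix.matrixDeriv Ω θ 0 a α))
  simp only [phase_zero, Complex.ofReal_zero, mul_zero, Complex.exp_zero, one_mul, mul_one] at h3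
  rw [energyMatrix, Matrix.mul_diagonal]
  simp only [Matrix.sub_apply, Matrix.smul_apply, smul_eq_mul, Matrix.mul_apply]
  linear_combination -Complex.I * h3 +
    (ε α θ * V θ a α - ∑ b, H θ a b * V θ b α) * Complex.I_mul_I

/-- Smoothness of the quasienergies is not assumed. Solving the Floquet equation for `ε` supplies
it, and later also transfers localization bounds from `H` and `V` to `ε`. -/
lemma IsMicromotion.energyMatrix_eq (hV : IsMicromotion d H Ω V ε) :
    energyMatrix ε = fun θ =>
      (V θ)ᴴ * (H θ * V θ) - Complex.I • ((V θ)ᴴ * driftM Ω V θ) := by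
  funext θ
  rw [← Matrix.mul_smul, ← Matrix.mul_sub, ← hV.floquet, ← Matrix.mul_assoc, hV.star_mul_self,
    Matrix.one_mul]

lemma IsMicromotion.smoothMatrix_energy (hV : IsMicromotion d H Ω V ε) (hH : IsHamiltonian H) :
    SmoothMatrix (energyMatrix ε) := by
  have h := hV.smooth.smoothMatrix
  rw [hV.energyMatrix_eq]
  exact (h.conjTranspose.mul (hH.1.smoothMatrix.mul h)).sub
    ((h.conjTranspose.mul (h.driftM Ω)).smul _)

lemma IsMicromotion.smoothMatrix_conn (hV : IsMicromotion d H Ω V ε) (j : Fin 3) :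
    SmoothMatrix (conn V j) :=
  hV.smooth.smoothMatrix.conjTranspose.mul (hV.smooth.smoothMatrix.pderiv j)

lemma IsMicromotion.smoothMatrix_connRate (hV : IsMicromotion d H Ω V ε) (hH : IsHamiltonian H)
    (j : Fin 3) : SmoothMatrix (connRate Ω V ε j) :=
  ((((hV.smoothMatrix_energy hH).mul (hV.smoothMatrix_conn j)).sub
    ((hV.smoothMatrix_conn j).mul (hV.smoothMatrix_energy hH))).smul _).add
    ((hV.smoothMatrix_conn j).driftM Ω)

lemma conjTranspose_energyMatrix (ε : ι → (Fin 3 → ℝ) → ℝ) (θ : Fin 3 → ℝ) :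
    (energyMatrix ε θ)ᴴ = energyMatrix ε θ := by
  unfold energyMatrix
  rw [Matrix.diagonal_conjTranspose]
  congr 1
  funext α
  exact Complex.conj_ofReal _

lemma driftM_conn (h : SmoothMatrix V) (j : Fin 3) (θ : Fin 3 → ℝ) :
    driftM Ω (conn V j) θ =
      (driftM Ω V θ)ᴴ * pderiv j V θ + (V θ)ᴴ * driftM Ω (pderiv j V) θ := by
  have := driftM_mul Ω h.conjTranspose (h.pderiv j) θ
  rw [driftM_conjTranspose Ω h] at this
  exact this

/-- The current in the frame of the quasienergy states. -/
lemma IsMicromotion.conj_pderiv (hV : IsMicromotion d H Ω V ε) (hH : IsHamiltonian H)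
    (j : Fin 3) (θ : Fin 3 → ℝ) :
    (V θ)ᴴ * pderiv j H θ * V θ =
      Complex.I • connRate Ω V ε j θ + pderiv j (energyMatrix ε) θ := by
  have h := hV.smooth.smoothMatrix
  have hHs := hH.1.smoothMatrix
  have hE := hV.smoothMatrix_energy hH
  have h1 : pderiv j (fun θ => V θ * energyMatrix ε θ) θ =
      pderiv j (fun θ => H θ * V θ - Complex.I • driftM Ω V θ) θ := by
    congr 1
    funext θ
    exact hV.floquet θ
  rw [pderiv_mul h hE, pderiv_sub (hHs.mul h) ((h.driftM Ω).smul _), pderiv_mul hHs h,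
    pderiv_smul _ (h.driftM Ω), pderiv_driftM Ω h] at h1
  have h2 : (V θ)ᴴ * H θ = energyMatrix ε θ * (V θ)ᴴ - Complex.I • (driftM Ω V θ)ᴴ := by
    have := congrArg Matrix.conjTranspose (hV.floquet θ)
    rw [Matrix.conjTranspose_mul, Matrix.conjTranspose_sub, Matrix.conjTranspose_mul,
      Matrix.conjTranspose_smul, conjTranspose_energyMatrix, (hH.2 θ).eq] at this
    rw [this]
    simp
  have h3 : pderiv j H θ * V θ = pderiv j V θ * energyMatrix ε θ + V θ * pderiv j (energyMatrix ε) θ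
      + Complex.I • driftM Ω (pderiv j V) θ - H θ * pderiv j V θ := by
    rw [h1]; abel
  rw [Matrix.mul_assoc, h3, Matrix.mul_sub, ← Matrix.mul_assoc _ (H θ), h2, connRate,
    driftM_conn h]
  simp only [Matrix.mul_add, Matrix.sub_mul, Matrix.mul_smul, Matrix.smul_mul, conn, smul_add,
    smul_sub, smul_smul, Complex.I_mul_I, ← Matrix.mul_assoc, hV.star_mul_self, Matrix.one_mul]
  simp only [neg_smul, one_smul]
  abel

lemma matrixDeriv_frame (V : (Fin 3 → ℝ) → Matrix ι ι ℂ) (ε : ι → (Fin 3 → ℝ) → ℝ)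
    (θ₀ : Fin 3 → ℝ) (t : ℝ) :
    MatrixDeriv (frame V ε θ₀) (-Complex.I • (energyMatrix ε θ₀ * frame V ε θ₀ t)) t := by
  intro α b
  simp only [frame, energyMatrix, Matrix.diagonal_mul, Matrix.smul_apply, smul_eq_mul]
  have h2 : HasDerivAt (fun s : ℝ => Complex.exp (-Complex.I * ε α θ₀ * s))
      (Complex.exp (-Complex.I * ε α θ₀ * t) * (-Complex.I * ε α θ₀ * 1)) t :=
    ((Complex.ofRealCLM.hasDerivAt (x := t)).const_mul _).cexp
  exact (h2.mul_const _).congr_deriv (by ring)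

/-- The flow moves only drive phases, on which the quasienergies do not depend. -/
lemma IsMicromotion.energyMatrix_phase (hV : IsMicromotion d H Ω V ε)
    (hΩ : ∀ j : Fin 3, (j : ℕ) < d → Ω j = 0) (θ₀ : Fin 3 → ℝ) (t : ℝ) :
    energyMatrix ε (phase Ω θ₀ t) = energyMatrix ε θ₀ := by
  unfold energyMatrix
  congr 1
  funext α
  rw [hV.quasienergy α _ θ₀ fun j hj => by simp [phase, hΩ j hj]]

lemma IsMicromotion.pderiv_energyMatrix_phase (hV : IsMicromotion d H Ω V ε)
    (hΩ : ∀ j : Fin 3, (j : ℕ) < d → Ω j = 0) (θ₀ : Fin 3 → ℝ) (t : ℝ) (j : Fin 3) :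
    pderiv j (energyMatrix ε) (phase Ω θ₀ t) = pderiv j (energyMatrix ε) θ₀ := by
  ext a b
  simp only [pderiv, Matrix.of_apply]
  congr 1
  funext s
  have : phase Ω θ₀ t + Pi.single j s = phase Ω (θ₀ + Pi.single j s) t := by
    simp only [phase]; abel
  rw [this, hV.energyMatrix_phase hΩ]

lemma IsMicromotion.pderiv_energyMatrix_drive (hV : IsMicromotion d H Ω V ε) {j : Fin 3}
    (hj : d ≤ (j : ℕ)) (θ : Fin 3 → ℝ) : pderiv j (energyMatrix ε) θ = 0 := by
  have : ∀ s, energyMatrix ε (θ + Pi.single j s) = energyMatrix ε θ := fun s => by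
    unfold energyMatrix
    congr 1
    funext α
    rw [hV.quasienergy α _ θ fun i hi => by
      have : i ≠ j := by rintro rfl; omega
      simp [this]]
  ext a b
  simp [pderiv, this]

lemma pderiv_energyMatrix (ε : ι → (Fin 3 → ℝ) → ℝ) (j : Fin 3) (θ : Fin 3 → ℝ) :
    pderiv j (energyMatrix ε) θ =
      Matrix.diagonal fun α => partialD j (fun θ => (ε α θ : ℂ)) θ := by
  ext a b
  by_cases h : a = b
  · subst h; simp [pderiv_apply, energyMatrix]
  · simp [pderiv_apply, energyMatrix, h, partialD_const]

lemma frame_mul_star (hV : IsMicromotion d H Ω V ε) (θ₀ : Fin 3 → ℝ) (t : ℝ) :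
    frame V ε θ₀ t * (frame V ε θ₀ t)ᴴ = 1 := by
  have : (Matrix.diagonal (fun α => Complex.exp (-Complex.I * ε α θ₀ * t)) : Matrix ι ι ℂ) *
      (Matrix.diagonal (fun α => Complex.exp (-Complex.I * ε α θ₀ * t)))ᴴ = 1 := by
    rw [Matrix.diagonal_conjTranspose, Matrix.diagonal_mul_diagonal, ← Matrix.diagonal_one]
    congr 1
    funext α
    rw [Pi.star_apply, Complex.star_def, ← Complex.exp_conj, ← Complex.exp_add]
    simp
  rw [frame, Matrix.conjTranspose_mul, Matrix.conjTranspose_conjTranspose, Matrix.mul_assoc,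
    ← Matrix.mul_assoc _ (V θ₀), hV.star_mul_self, Matrix.one_mul, this]

/-- Conjugation of a diagonal matrix by the frame. -/
lemma star_frame_mul_diagonal (V : (Fin 3 → ℝ) → Matrix ι ι ℂ) (ε : ι → (Fin 3 → ℝ) → ℝ)
    (θ₀ : Fin 3 → ℝ) (t : ℝ) (e : ι → ℂ) :
    (frame V ε θ₀ t)ᴴ * Matrix.diagonal e * frame V ε θ₀ t =
      V θ₀ * Matrix.diagonal e * (V θ₀)ᴴ := by
  have : (Matrix.diagonal (fun α => Complex.exp (-Complex.I * ε α θ₀ * t)) : Matrix ι ι ℂ)ᴴ *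
      Matrix.diagonal e * Matrix.diagonal (fun α => Complex.exp (-Complex.I * ε α θ₀ * t)) =
      Matrix.diagonal e := by
    rw [Matrix.diagonal_conjTranspose, Matrix.diagonal_mul_diagonal, Matrix.diagonal_mul_diagonal]
    congr 1
    funext α
    rw [Pi.star_apply, Complex.star_def, ← Complex.exp_conj, mul_right_comm, ← Complex.exp_add]
    simp
  rw [frame, Matrix.conjTranspose_mul, Matrix.conjTranspose_conjTranspose]
  simp only [Matrix.mul_assoc] at this ⊢
  rw [← Matrix.mul_assoc (Matrix.diagonal e), ← Matrix.mul_assoc _ (_ * _) (V θ₀)ᴴ, this]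

/-- The evolution operator in terms of the micromotion operator. -/
lemma IsMicromotion.evolution_eq (hV : IsMicromotion d H Ω V ε) (hH : IsHamiltonian H)
    (hU : IsEvolution H Ω U) (hΩ : ∀ j : Fin 3, (j : ℕ) < d → Ω j = 0) (θ₀ : Fin 3 → ℝ) (t : ℝ) :
    U θ₀ t = V (phase Ω θ₀ t) * frame V ε θ₀ t := by
  have hW : ∀ t, MatrixDeriv (fun s => V (phase Ω θ₀ s) * frame V ε θ₀ s)
      (-Complex.I • (H (phase Ω θ₀ t) * (V (phase Ω θ₀ t) * frame V ε θ₀ t))) t := fun t => by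
    refine ((hV.smooth.smoothMatrix.matrixDeriv Ω θ₀ t).mul
      (matrixDeriv_frame V ε θ₀ t)).congr_deriv ?_
    rw [← hV.energyMatrix_phase hΩ θ₀ t, Matrix.mul_smul, ← Matrix.mul_assoc, hV.floquet,
      Matrix.sub_mul, Matrix.smul_mul, smul_sub, smul_smul, neg_mul, Complex.I_mul_I,
      Matrix.mul_assoc]
    simp
  have hUd : ∀ t, MatrixDeriv (U θ₀) (-Complex.I • (H (phase Ω θ₀ t) * U θ₀ t)) t :=
    fun t a b => (hU θ₀).2 t a b
  -- Uniqueness of the evolution: for Hermitian `H` the product `W†U` of two solutions is constant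
  -- in time.
  have hP : ∀ t, MatrixDeriv (fun s => (V (phase Ω θ₀ s) * frame V ε θ₀ s)ᴴ * U θ₀ s) 0 t :=
    fun t => by
    refine ((hW t).conjTranspose.mul (hUd t)).congr_deriv ?_
    rw [Matrix.conjTranspose_smul, Matrix.conjTranspose_mul (H _), (hH.2 _).eq]
    simp only [Matrix.smul_mul, Matrix.mul_smul, Matrix.mul_assoc]
    simp
  have h1 := MatrixDeriv.eq_of_zero hP t 0
  have h0 : V (phase Ω θ₀ 0) * frame V ε θ₀ 0 = 1 := by
    simp [phase_zero, frame, hV.mul_star_self]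
  simp only [h0, (hU θ₀).1, Matrix.conjTranspose_one, Matrix.mul_one] at h1
  have h2 : (V (phase Ω θ₀ t) * frame V ε θ₀ t) * (V (phase Ω θ₀ t) * frame V ε θ₀ t)ᴴ = 1 := by
    rw [Matrix.conjTranspose_mul, Matrix.mul_assoc, ← Matrix.mul_assoc _ _ (V _)ᴴ,
      frame_mul_star hV, Matrix.one_mul, hV.mul_star_self]
  calc U θ₀ t = (V (phase Ω θ₀ t) * frame V ε θ₀ t) *
        ((V (phase Ω θ₀ t) * frame V ε θ₀ t)ᴴ * U θ₀ t) := by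
        rw [← Matrix.mul_assoc, h2, Matrix.one_mul]
    _ = _ := by rw [h1, Matrix.mul_one]

end Floquet

/-! ### The averaged circulation -/

section Circulation

set_option linter.unusedSectionVars false

variable {ι : Type} [Fintype ι] [DecidableEq ι]

/-- The connection in the Heisenberg picture. -/
noncomputable def heisConn (Ω : Fin 3 → ℝ) (V : (Fin 3 → ℝ) → Matrix ι ι ℂ)
    (ε : ι → (Fin 3 → ℝ) → ℝ) (θ₀ : Fin 3 → ℝ) (j : Fin 3) (t : ℝ) : Matrix ι ι ℂ :=
  (frame V ε θ₀ t)ᴴ * conn V j (phase Ω θ₀ t) * frame V ε θ₀ t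

/-- The time derivative of `heisConn`. -/
noncomputable def heisRate (Ω : Fin 3 → ℝ) (V : (Fin 3 → ℝ) → Matrix ι ι ℂ)
    (ε : ι → (Fin 3 → ℝ) → ℝ) (θ₀ : Fin 3 → ℝ) (j : Fin 3) (t : ℝ) : Matrix ι ι ℂ :=
  (frame V ε θ₀ t)ᴴ * connRate Ω V ε j (phase Ω θ₀ t) * frame V ε θ₀ t

/-- The persistent current operator `V (∂ⱼ ε) V†`. -/
noncomputable def persistent (V : (Fin 3 → ℝ) → Matrix ι ι ℂ)
    (ε : ι → (Fin 3 → ℝ) → ℝ) (θ₀ : Fin 3 → ℝ) (j : Fin 3) : Matrix ι ι ℂ :=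
  V θ₀ * pderiv j (energyMatrix ε) θ₀ * (V θ₀)ᴴ

/-- The quasi-periodic part of the circulation in the plane `j, k`. -/
noncomputable def curvPair (Ω : Fin 3 → ℝ) (V : (Fin 3 → ℝ) → Matrix ι ι ℂ)
    (ε : ι → (Fin 3 → ℝ) → ℝ) (j k : Fin 3) (θ : Fin 3 → ℝ) : ℂ :=
  (conn V j θ * connRate Ω V ε k θ).trace - (conn V k θ * connRate Ω V ε j θ).trace

/-- The part of the circulation in the plane `j, k` due to persistent currents. -/
noncomputable def persPair (V : (Fin 3 → ℝ) → Matrix ι ι ℂ)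
    (ε : ι → (Fin 3 → ℝ) → ℝ) (j k : Fin 3) (θ : Fin 3 → ℝ) : ℂ :=
  (pderiv j (energyMatrix ε) θ * conn V k θ).trace
    - (pderiv k (energyMatrix ε) θ * conn V j θ).trace

variable {d : ℕ} {H V : (Fin 3 → ℝ) → Matrix ι ι ℂ} {Ω : Fin 3 → ℝ} {ε : ι → (Fin 3 → ℝ) → ℝ}
  {U : (Fin 3 → ℝ) → ℝ → Matrix ι ι ℂ}

lemma MatrixDeriv.continuous {X X' : ℝ → Matrix ι ι ℂ} (h : ∀ t, MatrixDeriv X (X' t) t) :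
    Continuous X :=
  continuous_matrix fun a b =>
    continuous_iff_continuousAt.2 fun t => (h t a b).continuousAt

lemma IsMicromotion.matrixDeriv_heisConn (hV : IsMicromotion d H Ω V ε)
    (hΩ : ∀ j : Fin 3, (j : ℕ) < d → Ω j = 0) (θ₀ : Fin 3 → ℝ) (j : Fin 3) (t : ℝ) :
    MatrixDeriv (heisConn Ω V ε θ₀ j) (heisRate Ω V ε θ₀ j t) t := by
  have hS := matrixDeriv_frame V ε θ₀ t
  refine ((hS.conjTranspose.mul ((hV.smoothMatrix_conn j).matrixDeriv Ω θ₀ t)).mul hS).congr_deriv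
    ?_
  rw [heisRate, connRate, hV.energyMatrix_phase hΩ, Matrix.conjTranspose_smul,
    Matrix.conjTranspose_mul, conjTranspose_energyMatrix]
  simp only [Matrix.mul_add, Matrix.add_mul, Matrix.smul_mul, Matrix.mul_smul, Matrix.mul_sub,
    Matrix.sub_mul, smul_sub, Matrix.mul_assoc]
  simp
  abel

lemma IsMicromotion.continuous_heisRate (hV : IsMicromotion d H Ω V ε) (hH : IsHamiltonian H)
    (θ₀ : Fin 3 → ℝ) (j : Fin 3) : Continuous (heisRate Ω V ε θ₀ j) := by
  have hS := fun t => matrixDeriv_frame V ε θ₀ t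
  exact MatrixDeriv.continuous fun t =>
    ((hS t).conjTranspose.mul ((hV.smoothMatrix_connRate hH j).matrixDeriv Ω θ₀ t)).mul (hS t)

/-- `conj_pderiv` conjugated with the frame. The diagonal part `∂_jε` commutes with the phases in
the frame and is constant along the flow, hence gives a constant operator; the rest is a total time
derivative. -/
lemma IsMicromotion.ndot_eq (hV : IsMicromotion d H Ω V ε) (hH : IsHamiltonian H)
    (hU : IsEvolution H Ω U) (hΩ : ∀ j : Fin 3, (j : ℕ) < d → Ω j = 0) (θ₀ : Fin 3 → ℝ) (t : ℝ)
    (j : Fin 3) :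
    ndot H Ω U θ₀ t j = -(Complex.I • heisRate Ω V ε θ₀ j t) - persistent V ε θ₀ j := by
  have h1 : ndot H Ω U θ₀ t j = -((frame V ε θ₀ t)ᴴ *
      ((V (phase Ω θ₀ t))ᴴ * pderiv j H (phase Ω θ₀ t) * V (phase Ω θ₀ t)) * frame V ε θ₀ t) := by
    rw [ndot, hV.evolution_eq hH hU hΩ, Matrix.conjTranspose_mul]
    simp only [Matrix.mul_assoc, Matrix.neg_mul, Matrix.mul_neg]
  rw [h1, hV.conj_pderiv hH, hV.pderiv_energyMatrix_phase hΩ, Matrix.mul_add, Matrix.add_mul,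
    pderiv_energyMatrix, star_frame_mul_diagonal, ← pderiv_energyMatrix, neg_add,
    ← sub_eq_add_neg, persistent, heisRate, Matrix.mul_smul, Matrix.smul_mul]

lemma IsMicromotion.continuous_ndot (hV : IsMicromotion d H Ω V ε) (hH : IsHamiltonian H)
    (hU : IsEvolution H Ω U) (hΩ : ∀ j : Fin 3, (j : ℕ) < d → Ω j = 0) (θ₀ : Fin 3 → ℝ)
    (j : Fin 3) : Continuous fun t => ndot H Ω U θ₀ t j := by
  simp only [hV.ndot_eq hH hU hΩ]
  exact ((hV.continuous_heisRate hH θ₀ j).const_smul Complex.I).neg.sub continuous_const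

/-- The current integrates in closed form: apart from the constant of integration, the position is a
bounded part `-iQ_j(t)` and the linear drift of the persistent current. -/
lemma IsMicromotion.npos_eq (hV : IsMicromotion d H Ω V ε) (hH : IsHamiltonian H)
    (hU : IsEvolution H Ω U) (hΩ : ∀ j : Fin 3, (j : ℕ) < d → Ω j = 0)
    (n₀ : Fin 3 → Matrix ι ι ℂ) (θ₀ : Fin 3 → ℝ) (t : ℝ) (j : Fin 3) :
    npos H Ω U n₀ θ₀ t j = (n₀ j + Complex.I • heisConn Ω V ε θ₀ j 0)
      - Complex.I • heisConn Ω V ε θ₀ j t - (t : ℂ) • persistent V ε θ₀ j := by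
  ext a b
  have hd : ∀ s, HasDerivAt (fun s : ℝ => -(Complex.I * heisConn Ω V ε θ₀ j s a b) -
      s * persistent V ε θ₀ j a b) (ndot H Ω U θ₀ s j a b) s := fun s => by
    rw [hV.ndot_eq hH hU hΩ]
    simp only [Matrix.sub_apply, Matrix.neg_apply, Matrix.smul_apply, smul_eq_mul]
    have h2 := (Complex.ofRealCLM.hasDerivAt (x := s)).mul_const (persistent V ε θ₀ j a b)
    simp only [Complex.ofRealCLM_apply, Complex.ofReal_one, one_mul] at h2
    exact (((hV.matrixDeriv_heisConn hΩ θ₀ j s a b).const_mul Complex.I).neg).sub h2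
  have hc : Continuous fun s => ndot H Ω U θ₀ s j a b :=
    (hV.continuous_ndot hH hU hΩ θ₀ j).matrix_elem a b
  have := intervalIntegral.integral_eq_sub_of_hasDerivAt (a := 0) (b := t)
    (fun s _ => hd s) (hc.intervalIntegrable _ _)
  simp only [npos, Matrix.add_apply, Matrix.of_apply, this, Matrix.sub_apply, Matrix.smul_apply,
    smul_eq_mul]
  simp
  ring

lemma IsMicromotion.continuous_npos (hV : IsMicromotion d H Ω V ε) (hH : IsHamiltonian H)
    (hU : IsEvolution H Ω U) (hΩ : ∀ j : Fin 3, (j : ℕ) < d → Ω j = 0)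
    (n₀ : Fin 3 → Matrix ι ι ℂ) (θ₀ : Fin 3 → ℝ)
    (j : Fin 3) : Continuous fun t => npos H Ω U n₀ θ₀ t j := by
  simp only [hV.npos_eq hH hU hΩ]
  have := MatrixDeriv.continuous (hV.matrixDeriv_heisConn hΩ θ₀ j)
  fun_prop

/-- The frame is unitary and drops out of traces, so traces of Heisenberg operators at equal times
are functions of the current phase alone. -/
lemma trace_conj_mul_conj (hV : IsMicromotion d H Ω V ε) (θ₀ : Fin 3 → ℝ) (t : ℝ)
    (A B : Matrix ι ι ℂ) :
    (((frame V ε θ₀ t)ᴴ * A * frame V ε θ₀ t) *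
      ((frame V ε θ₀ t)ᴴ * B * frame V ε θ₀ t)).trace = (A * B).trace := by
  have : ((frame V ε θ₀ t)ᴴ * A * frame V ε θ₀ t) * ((frame V ε θ₀ t)ᴴ * B * frame V ε θ₀ t) =
      (frame V ε θ₀ t)ᴴ * (A * B) * frame V ε θ₀ t := by
    simp only [Matrix.mul_assoc]
    rw [← Matrix.mul_assoc (frame V ε θ₀ t) (frame V ε θ₀ t)ᴴ, frame_mul_star hV, Matrix.one_mul]
  rw [this, Matrix.mul_assoc, Matrix.trace_mul_comm, Matrix.mul_assoc, frame_mul_star hV,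
    Matrix.mul_one]

/-- The persistent current looks the same when written with the frame of any time, so it can be
taken at the time `t` of the other factor. -/
lemma IsMicromotion.trace_persistent_mul (hV : IsMicromotion d H Ω V ε)
    (hΩ : ∀ j : Fin 3, (j : ℕ) < d → Ω j = 0) (θ₀ : Fin 3 → ℝ) (t : ℝ) (j k : Fin 3) :
    (persistent V ε θ₀ j * heisConn Ω V ε θ₀ k t).trace =
      (pderiv j (energyMatrix ε) (phase Ω θ₀ t) * conn V k (phase Ω θ₀ t)).trace := by
  rw [persistent, pderiv_energyMatrix, ← star_frame_mul_diagonal V ε θ₀ t, heisConn,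
    trace_conj_mul_conj hV, ← pderiv_energyMatrix, hV.pderiv_energyMatrix_phase hΩ]

/-- The boundary contribution to the circulation in the plane `j, k`. -/
noncomputable def boundaryPair (Ω : Fin 3 → ℝ) (V : (Fin 3 → ℝ) → Matrix ι ι ℂ)
    (ε : ι → (Fin 3 → ℝ) → ℝ) (n₀ : Fin 3 → Matrix ι ι ℂ) (θ₀ : Fin 3 → ℝ) (j k : Fin 3) (t : ℝ) :
    ℂ :=
  -Complex.I * (((n₀ j + Complex.I • heisConn Ω V ε θ₀ j 0) * heisConn Ω V ε θ₀ k t).trace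
    - ((n₀ k + Complex.I • heisConn Ω V ε θ₀ k 0) * heisConn Ω V ε θ₀ j t).trace)
  + Complex.I * (t * ((persistent V ε θ₀ j * heisConn Ω V ε θ₀ k t).trace
    - (persistent V ε θ₀ k * heisConn Ω V ε θ₀ j t).trace))
  - t * (((n₀ j + Complex.I • heisConn Ω V ε θ₀ j 0) * persistent V ε θ₀ k).trace
    - ((n₀ k + Complex.I • heisConn Ω V ε θ₀ k 0) * persistent V ε θ₀ j).trace)

/-- Integration by parts in time. The product of the two bounded parts leaves `curvPair`. The cross
terms `t tr(P_jQ̇_k)` become total derivatives at the price of `tr(P_jQ_k)`, which doubles the cross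
terms `tr(Q_jP_k)` already present; this is the factor `2i`. The terms `t tr(P_jP_k)` cancel by
antisymmetry. -/
lemma IsMicromotion.hasDerivAt_boundaryPair (hV : IsMicromotion d H Ω V ε) (hH : IsHamiltonian H)
    (hU : IsEvolution H Ω U) (hΩ : ∀ j : Fin 3, (j : ℕ) < d → Ω j = 0)
    (n₀ : Fin 3 → Matrix ι ι ℂ) (θ₀ : Fin 3 → ℝ) (t : ℝ) (j k : Fin 3) :
    HasDerivAt (boundaryPair Ω V ε n₀ θ₀ j k)
      ((npos H Ω U n₀ θ₀ t j * ndot H Ω U θ₀ t k - npos H Ω U n₀ θ₀ t k * ndot H Ω U θ₀ t j).trace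
        + curvPair Ω V ε j k (phase Ω θ₀ t)
        + 2 * Complex.I * persPair V ε j k (phase Ω θ₀ t)) t := by
  have hQ : ∀ (X : Matrix ι ι ℂ) (l : Fin 3), HasDerivAt
      (fun s => (X * heisConn Ω V ε θ₀ l s).trace) ((X * heisRate Ω V ε θ₀ l t).trace) t := by
    intro X l
    have := ((MatrixDeriv.const X (t := t)).mul (hV.matrixDeriv_heisConn hΩ θ₀ l t)).trace
    simpa using this
  have ht : HasDerivAt (fun s : ℝ => (s : ℂ)) 1 t := Complex.ofRealCLM.hasDerivAt
  have hf : curvPair Ω V ε j k (phase Ω θ₀ t) =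
      (heisConn Ω V ε θ₀ j t * heisRate Ω V ε θ₀ k t).trace -
      (heisConn Ω V ε θ₀ k t * heisRate Ω V ε θ₀ j t).trace := by
    simp only [heisConn, heisRate, trace_conj_mul_conj hV]
    rfl
  have hg : persPair V ε j k (phase Ω θ₀ t) =
      (persistent V ε θ₀ j * heisConn Ω V ε θ₀ k t).trace -
      (persistent V ε θ₀ k * heisConn Ω V ε θ₀ j t).trace := by
    simp only [hV.trace_persistent_mul hΩ]
    rfl
  have h1 := (((hQ (n₀ j + Complex.I • heisConn Ω V ε θ₀ j 0) k).sub
    (hQ (n₀ k + Complex.I • heisConn Ω V ε θ₀ k 0) j)).const_mul (-Complex.I))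
  have h2 := (ht.mul ((hQ (persistent V ε θ₀ j) k).sub (hQ (persistent V ε θ₀ k) j))).const_mul
    Complex.I
  have h3 := ht.mul_const (((n₀ j + Complex.I • heisConn Ω V ε θ₀ j 0) *
    persistent V ε θ₀ k).trace - ((n₀ k + Complex.I • heisConn Ω V ε θ₀ k 0) *
    persistent V ε θ₀ j).trace)
  refine ((h1.add h2).sub h3).congr_deriv ?_
  rw [hf, hg, hV.npos_eq hH hU hΩ, hV.npos_eq hH hU hΩ, hV.ndot_eq hH hU hΩ, hV.ndot_eq hH hU hΩ]
  have c1 := Matrix.trace_mul_comm (persistent V ε θ₀ j) (persistent V ε θ₀ k)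
  have c2 := Matrix.trace_mul_comm (heisConn Ω V ε θ₀ j t) (persistent V ε θ₀ k)
  have c3 := Matrix.trace_mul_comm (heisConn Ω V ε θ₀ k t) (persistent V ε θ₀ j)
  simp only [Matrix.sub_mul, Matrix.mul_sub, Matrix.mul_neg, Matrix.smul_mul,
    Matrix.mul_smul, Matrix.trace_sub, Matrix.trace_neg, Matrix.trace_smul,
    smul_eq_mul, c1, c2, c3, Pi.sub_apply]
  linear_combination ((heisConn Ω V ε θ₀ k t * heisRate Ω V ε θ₀ j t).trace -
    (heisConn Ω V ε θ₀ j t * heisRate Ω V ε θ₀ k t).trace) * Complex.I_mul_I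

lemma IsMicromotion.integral_pair (hV : IsMicromotion d H Ω V ε) (hH : IsHamiltonian H)
    (hU : IsEvolution H Ω U) (hΩ : ∀ j : Fin 3, (j : ℕ) < d → Ω j = 0)
    (n₀ : Fin 3 → Matrix ι ι ℂ) (θ₀ : Fin 3 → ℝ) (T : ℝ) (j k : Fin 3) :
    ∫ t in (0 : ℝ)..T, (npos H Ω U n₀ θ₀ t j * ndot H Ω U θ₀ t k
        - npos H Ω U n₀ θ₀ t k * ndot H Ω U θ₀ t j).trace =
      boundaryPair Ω V ε n₀ θ₀ j k T - boundaryPair Ω V ε n₀ θ₀ j k 0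
      - (∫ t in (0 : ℝ)..T, curvPair Ω V ε j k (phase Ω θ₀ t))
      - 2 * Complex.I * ∫ t in (0 : ℝ)..T, persPair V ε j k (phase Ω θ₀ t) := by
  have hp : Continuous (phase Ω θ₀) := by unfold phase; fun_prop
  have hE := hV.smoothMatrix_energy hH
  have h1 : Continuous fun t => curvPair Ω V ε j k (phase Ω θ₀ t) :=
    ((((hV.smoothMatrix_conn j).mul (hV.smoothMatrix_connRate hH k)).trace.sub
      ((hV.smoothMatrix_conn k).mul (hV.smoothMatrix_connRate hH j)).trace).continuous).comp hp
  have h2 : Continuous fun t => persPair V ε j k (phase Ω θ₀ t) :=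
    ((((hE.pderiv j).mul (hV.smoothMatrix_conn k)).trace.sub
      ((hE.pderiv k).mul (hV.smoothMatrix_conn j)).trace).continuous).comp hp
  have h3 : Continuous fun t => (npos H Ω U n₀ θ₀ t j * ndot H Ω U θ₀ t k
        - npos H Ω U n₀ θ₀ t k * ndot H Ω U θ₀ t j).trace := by
    have e1 := fun l => hV.continuous_npos hH hU hΩ n₀ θ₀ l
    have e2 := fun l => hV.continuous_ndot hH hU hΩ θ₀ l
    exact (((e1 j).matrix_mul (e2 k)).sub ((e1 k).matrix_mul (e2 j))).matrix_trace
  have key := intervalIntegral.integral_eq_sub_of_hasDerivAt (a := 0) (b := T)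
    (fun t _ => hV.hasDerivAt_boundaryPair hH hU hΩ n₀ θ₀ t j k)
    (((h3.add h1).add (continuous_const.mul h2)).intervalIntegrable _ _)
  have h31 : Continuous fun t => (npos H Ω U n₀ θ₀ t j * ndot H Ω U θ₀ t k
      - npos H Ω U n₀ θ₀ t k * ndot H Ω U θ₀ t j).trace + curvPair Ω V ε j k (phase Ω θ₀ t) :=
    h3.add h1
  have h22 : Continuous fun t => 2 * Complex.I * persPair V ε j k (phase Ω θ₀ t) :=
    continuous_const.mul h2
  rw [intervalIntegral.integral_add (h31.intervalIntegrable _ _) (h22.intervalIntegrable _ _),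
    intervalIntegral.integral_add (h3.intervalIntegrable _ _) (h1.intervalIntegrable _ _),
    intervalIntegral.integral_const_mul] at key
  linear_combination key

/-- The sum over planes, weighted by the drive frequencies, of `∫ tr (nⱼ ṅₖ - nₖ ṅⱼ)`. -/
noncomputable def planeSum (Ω : Fin 3 → ℝ) (x : Fin 3 → Fin 3 → ℂ) : ℂ :=
  ∑ c : Fin 3, (Ω c : ℂ) * x (c + 1) (c + 2)

/-- The Hermitian conjugate in the circulation is kept as `star z`. The same form is produced by
`quantized_eq`, so the two sides can be compared through `z` alone. -/
lemma IsMicromotion.timeAverage_eq (hV : IsMicromotion d H Ω V ε) (hH : IsHamiltonian H)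
    (hU : IsEvolution H Ω U) (hΩ : ∀ j : Fin 3, (j : ℕ) < d → Ω j = 0)
    (n₀ : Fin 3 → Matrix ι ι ℂ) (θ₀ : Fin 3 → ℝ) (T : ℝ) (z : ℂ)
    (hz : z = (1 / (4 * freqNorm Ω * T) : ℂ) * planeSum Ω fun j k =>
      ∫ t in (0 : ℝ)..T, (npos H Ω U n₀ θ₀ t j * ndot H Ω U θ₀ t k
        - npos H Ω U n₀ θ₀ t k * ndot H Ω U θ₀ t j).trace) :
    timeAverage (circulation H Ω U n₀ θ₀) T = z + star z := by
  have e1 := fun l => hV.continuous_npos hH hU hΩ n₀ θ₀ l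
  have e2 := fun l => hV.continuous_ndot hH hU hΩ θ₀ l
  have hy : ∀ j k, Continuous fun t => (npos H Ω U n₀ θ₀ t j * ndot H Ω U θ₀ t k
        - npos H Ω U n₀ θ₀ t k * ndot H Ω U θ₀ t j).trace := fun j k =>
    (((e1 j).matrix_mul (e2 k)).sub ((e1 k).matrix_mul (e2 j))).matrix_trace
  set y : ℝ → ℂ := fun t => (1 / (4 * freqNorm Ω) : ℂ) * planeSum Ω fun j k =>
    (npos H Ω U n₀ θ₀ t j * ndot H Ω U θ₀ t k
        - npos H Ω U n₀ θ₀ t k * ndot H Ω U θ₀ t j).trace with hydef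
  have hyc : Continuous y := by
    refine continuous_const.mul (continuous_finsetSum _ fun c _ => continuous_const.mul (hy _ _))
  have h1 : ∀ t, (circulation H Ω U n₀ θ₀ t).trace = y t + star (y t) := fun t => by
    have : ((1 / 4 : ℂ) • tripleProduct (npos H Ω U n₀ θ₀ t) (ndot H Ω U θ₀ t)
      (fun j => Ω j / freqNorm Ω)).trace = y t := by
      simp only [tripleProduct, Matrix.trace_smul, Matrix.trace_sum, smul_eq_mul, hydef, planeSum,
        Finset.mul_sum]
      refine Finset.sum_congr rfl fun c _ => ?_
      push_cast
      ring
    rw [circulation]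
    simp only [Matrix.trace_add, Matrix.trace_conjTranspose, this]
  have h2 : (∫ t in (0 : ℝ)..T, star (y t)) = star (∫ t in (0 : ℝ)..T, y t) := by
    simp only [intervalIntegral, Complex.star_def, integral_conj, map_sub]
  have h3 : (1 / T : ℂ) * ∫ t in (0 : ℝ)..T, y t = z := by
    simp only [hydef, planeSum]
    rw [intervalIntegral.integral_const_mul, intervalIntegral.integral_finsetSum]
    · simp only [intervalIntegral.integral_const_mul, hz, planeSum, ← mul_assoc]
      congr 1
      simp only [one_div, mul_inv]
      ring
    · exact fun c _ => (continuous_const.mul (hy _ _)).intervalIntegrable _ _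
  rw [timeAverage]
  simp only [h1]
  rw [intervalIntegral.integral_add (hyc.intervalIntegrable _ _)
    (Continuous.intervalIntegrable (by fun_prop) _ _), h2, mul_add, h3]
  congr 1
  rw [← h3, star_mul', Complex.star_def]
  simp

end Circulation

/-! ### The winding number and the torus average of the circulation -/

section Winding

set_option linter.unusedSectionVars false

variable {ι : Type} [Fintype ι] [DecidableEq ι]
  {V : (Fin 3 → ℝ) → Matrix ι ι ℂ}

lemma SmoothMatrix.conn (hs : SmoothMatrix V) (j : Fin 3) : SmoothMatrix (ALTP.conn V j) :=
  hs.conjTranspose.mul (hs.pderiv j)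

/-- Differentiate `V†V = 1` and solve for the derivative of `V†`. -/
lemma conjTranspose_pderiv (hs : SmoothMatrix V) (hu : ∀ θ, (V θ)ᴴ * V θ = 1) (j : Fin 3)
    (θ : Fin 3 → ℝ) : (pderiv j V θ)ᴴ = -(conn V j θ * (V θ)ᴴ) := by
  have h1 := pderiv_mul hs.conjTranspose hs j θ
  rw [funext hu, pderiv_const, pderiv_conjTranspose hs] at h1
  have h2 : (pderiv j V θ)ᴴ * V θ = -conn V j θ := (eq_neg_of_add_eq_zero_left h1.symm)
  have h3 : V θ * (V θ)ᴴ = 1 := mul_eq_one_comm.1 (hu θ)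
  calc (pderiv j V θ)ᴴ = (pderiv j V θ)ᴴ * V θ * (V θ)ᴴ := by
        rw [Matrix.mul_assoc, h3, Matrix.mul_one]
    _ = _ := by rw [h2, Matrix.neg_mul]

lemma conjTranspose_conn (hs : SmoothMatrix V) (hu : ∀ θ, (V θ)ᴴ * V θ = 1) (j : Fin 3)
    (θ : Fin 3 → ℝ) : (conn V j θ)ᴴ = -conn V j θ := by
  rw [conn, Matrix.conjTranspose_mul, conjTranspose_pderiv hs hu, Matrix.conjTranspose_conjTranspose,
    Matrix.neg_mul, Matrix.mul_assoc, hu, Matrix.mul_one, conn]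

/-- The connection `V† ∂ V` is flat. -/
lemma conn_flat (hs : SmoothMatrix V) (hu : ∀ θ, (V θ)ᴴ * V θ = 1) (j k : Fin 3)
    (θ : Fin 3 → ℝ) : conn V j θ * conn V k θ - conn V k θ * conn V j θ =
      pderiv k (conn V j) θ - pderiv j (conn V k) θ := by
  -- The mixed second derivative of `V` is symmetric and disappears from the antisymmetrized
  -- derivative.
  have h : ∀ j k, pderiv j (conn V k) θ =
      -(conn V j θ * conn V k θ) + (V θ)ᴴ * pderiv j (pderiv k V) θ := fun j k => by
    have := pderiv_mul hs.conjTranspose (hs.pderiv k) j θ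
    rw [pderiv_conjTranspose hs, conjTranspose_pderiv hs hu, Matrix.neg_mul, Matrix.mul_assoc]
      at this
    exact this
  rw [h, h, pderiv_comm hs j k]
  abel

lemma integrableOn_trace {A : (Fin 3 → ℝ) → Matrix ι ι ℂ} (hA : SmoothMatrix A) :
    IntegrableOn (fun θ => (A θ).trace) cube :=
  SmoothTorus.integrableOn hA.trace.continuous

lemma integral_trace_sub {A B : (Fin 3 → ℝ) → Matrix ι ι ℂ} (hA : SmoothMatrix A)
    (hB : SmoothMatrix B) : ∫ θ in cube, (A θ - B θ).trace =
      (∫ θ in cube, (A θ).trace) - ∫ θ in cube, (B θ).trace := by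
  simp only [Matrix.trace_sub]
  exact integral_sub (integrableOn_trace hA) (integrableOn_trace hB)

/-- Pairing the curvature of the connection with a matrix function. -/
lemma integral_mul_commutator (hs : SmoothMatrix V) (hu : ∀ θ, (V θ)ᴴ * V θ = 1)
    {E : (Fin 3 → ℝ) → Matrix ι ι ℂ} (hE : SmoothMatrix E) (j k : Fin 3) :
    ∫ θ in cube, (E θ * (conn V j θ * conn V k θ - conn V k θ * conn V j θ)).trace =
      (∫ θ in cube, (pderiv j E θ * conn V k θ).trace)
        - ∫ θ in cube, (pderiv k E θ * conn V j θ).trace := by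
  have hA := hs.conn
  simp only [conn_flat hs hu, Matrix.mul_sub]
  rw [integral_trace_sub (hE.mul ((hA j).pderiv k)) (hE.mul ((hA k).pderiv j)),
    integral_trace_pderiv_mul hE (hA j), integral_trace_pderiv_mul hE (hA k)]
  ring

/-- The winding density `∫ tr A₀ [A₁, A₂]`. -/
noncomputable def windingIntegral (V : (Fin 3 → ℝ) → Matrix ι ι ℂ) (j l k : Fin 3) : ℂ :=
  ∫ θ in cube, (conn V j θ * (conn V l θ * conn V k θ - conn V k θ * conn V l θ)).trace

/-- The torus integral of `tr Aⱼ ∂ₗ Aₖ`. -/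
noncomputable def connIntegral (V : (Fin 3 → ℝ) → Matrix ι ι ℂ) (j l k : Fin 3) : ℂ :=
  ∫ θ in cube, (conn V j θ * pderiv l (conn V k) θ).trace

/-- Integration by parts followed by cyclicity of the trace. -/
lemma connIntegral_swap (hs : SmoothMatrix V) (j l k : Fin 3) :
    connIntegral V j l k = -connIntegral V k l j := by
  have hA := hs.conn
  rw [connIntegral, integral_trace_pderiv_mul (hA j) (hA k), connIntegral]
  simp only [Matrix.trace_mul_comm (pderiv l (conn V j) _)]

/-- Flatness paired with `A_j`. Together with `connIntegral_swap` this determines all the integrals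
that occur. -/
lemma connIntegral_sub (hs : SmoothMatrix V) (hu : ∀ θ, (V θ)ᴴ * V θ = 1) (j l k : Fin 3) :
    connIntegral V j k l - connIntegral V j l k = windingIntegral V j l k := by
  have hA := hs.conn
  rw [windingIntegral]
  simp only [conn_flat hs hu, Matrix.mul_sub]
  rw [integral_trace_sub ((hA j).mul ((hA l).pderiv k)) ((hA j).mul ((hA k).pderiv l))]
  rfl

lemma windingIntegral_cycle (V : (Fin 3 → ℝ) → Matrix ι ι ℂ) (j l k : Fin 3) :
    windingIntegral V l k j = windingIntegral V j l k := by
  unfold windingIntegral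
  congr 1
  funext θ
  simp only [Matrix.mul_sub, Matrix.trace_sub, ← Matrix.mul_assoc]
  rw [Matrix.trace_mul_cycle (conn V j θ), Matrix.trace_mul_cycle (conn V j θ),
    Matrix.trace_mul_cycle (conn V k θ)]

lemma windingIntegral_swap (V : (Fin 3 → ℝ) → Matrix ι ι ℂ) (j l k : Fin 3) :
    windingIntegral V j k l = -windingIntegral V j l k := by
  unfold windingIntegral
  rw [← integral_neg]
  congr 1
  funext θ
  rw [← Matrix.trace_neg, ← Matrix.mul_neg, neg_sub]

/-- The three anti-Hermitian factors contribute a sign, and reversing the order inside the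
commutator contributes another. -/
lemma star_windingIntegral (hs : SmoothMatrix V) (hu : ∀ θ, (V θ)ᴴ * V θ = 1) (j l k : Fin 3) :
    star (windingIntegral V j l k) = windingIntegral V j l k := by
  unfold windingIntegral
  rw [Complex.star_def, ← integral_conj]
  congr 1
  funext θ
  rw [← Complex.star_def, ← Matrix.trace_conjTranspose, Matrix.conjTranspose_mul,
    Matrix.conjTranspose_sub, Matrix.conjTranspose_mul, Matrix.conjTranspose_mul]
  simp only [conjTranspose_conn hs hu, neg_mul_neg, Matrix.mul_neg, Matrix.trace_neg]
  rw [Matrix.trace_mul_comm, ← Matrix.trace_neg, ← Matrix.mul_neg, neg_sub]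

/-- By cyclicity of the trace the three even and the three odd permutations each give one term, so
the alternating sum is `3 tr A₀[A₁,A₂]`. -/
lemma windingNumber_eq (V : (Fin 3 → ℝ) → Matrix ι ι ℂ) :
    windingNumber V = -(windingIntegral V 0 1 2) / (8 * Real.pi ^ 2) := by
  have h1 : ∀ θ, ∑ σ : Equiv.Perm (Fin 3), ((Equiv.Perm.sign σ : ℤ) : ℂ) *
      (((V θ)ᴴ * pderiv (σ 0) V θ) * ((V θ)ᴴ * pderiv (σ 1) V θ) *
        ((V θ)ᴴ * pderiv (σ 2) V θ)).trace =
      3 * (conn V 0 θ * (conn V 1 θ * conn V 2 θ - conn V 2 θ * conn V 1 θ)).trace := fun θ => by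
    have hu : (Finset.univ : Finset (Equiv.Perm (Fin 3))) =
        {1, Equiv.swap 0 1, Equiv.swap 0 2, Equiv.swap 1 2, finRotate 3, (finRotate 3)⁻¹} := by
      decide
    have hc : ∀ j, (V θ)ᴴ * pderiv j V θ = conn V j θ := fun j => rfl
    simp only [hc]
    rw [hu, Finset.sum_insert (by decide), Finset.sum_insert (by decide),
      Finset.sum_insert (by decide), Finset.sum_insert (by decide), Finset.sum_insert (by decide),
      Finset.sum_singleton]
    have e1 : Equiv.Perm.sign (finRotate 3) = 1 := by decide
    have e2 : Equiv.Perm.sign (finRotate 3)⁻¹ = 1 := by decide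
    have e3 : Equiv.Perm.sign (Equiv.swap (0 : Fin 3) 1) = -1 := by decide
    have e4 : Equiv.Perm.sign (Equiv.swap (0 : Fin 3) 2) = -1 := by decide
    have e5 : Equiv.Perm.sign (Equiv.swap (1 : Fin 3) 2) = -1 := by decide
    have f : ∀ (σ : Equiv.Perm (Fin 3)) (a b c : Fin 3), σ 0 = a → σ 1 = b → σ 2 = c →
      (conn V (σ 0) θ * conn V (σ 1) θ * conn V (σ 2) θ).trace =
        (conn V a θ * conn V b θ * conn V c θ).trace := by
      rintro σ a b c rfl rfl rfl; rfl
    rw [e1, e2, e3, e4, e5, Equiv.Perm.sign_one,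
      f 1 0 1 2 rfl rfl rfl, f (Equiv.swap 0 1) 1 0 2 (by decide) (by decide) (by decide),
      f (Equiv.swap 0 2) 2 1 0 (by decide) (by decide) (by decide),
      f (Equiv.swap 1 2) 0 2 1 (by decide) (by decide) (by decide),
      f (finRotate 3) 1 2 0 (by decide) (by decide) (by decide),
      f (finRotate 3)⁻¹ 2 0 1 (by decide) (by decide) (by decide),
      Matrix.trace_mul_cycle (conn V 1 θ) (conn V 0 θ), Matrix.trace_mul_cycle (conn V 2 θ) (conn V 1 θ),
      Matrix.trace_mul_cycle (conn V 2 θ) (conn V 0 θ), Matrix.trace_mul_cycle (conn V 1 θ) (conn V 2 θ)]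
    simp only [Matrix.mul_sub, Matrix.trace_sub, ← Matrix.mul_assoc]
    push_cast
    ring
  have hpi : (Real.pi : ℂ) ≠ 0 := by exact_mod_cast Real.pi_ne_zero
  rw [windingNumber]
  simp only [h1]
  rw [integral_const_mul, ← windingIntegral]
  have : (2 * Real.pi * Complex.I : ℂ) ^ 2 = -(4 * Real.pi ^ 2) := by
    rw [mul_pow, Complex.I_sq]; ring
  rw [this]
  field_simp
  ring

variable {d : ℕ} {H : (Fin 3 → ℝ) → Matrix ι ι ℂ} {Ω : Fin 3 → ℝ} {ε : ι → (Fin 3 → ℝ) → ℝ}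

/-- The commutators with `ε` combine to `-2i tr(ε[A_j,A_k])`. By flatness and integration by parts
its integral is the persistent term; the two drift terms are equal after integration by parts. -/
lemma IsMicromotion.integral_curvPair (hV : IsMicromotion d H Ω V ε) (hH : IsHamiltonian H)
    (j k : Fin 3) : ∫ θ in cube, curvPair Ω V ε j k θ =
      2 * ∑ l, Ω l * connIntegral V j l k - 2 * Complex.I * ∫ θ in cube, persPair V ε j k θ := by
  have hs := hV.smooth.smoothMatrix
  have hu := hV.star_mul_self
  have hA := hs.conn
  have hE := hV.smoothMatrix_energy hH
  have h1 : ∀ j k θ, (conn V j θ * driftM Ω (conn V k) θ).trace =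
      ∑ l, Ω l * (conn V j θ * pderiv l (conn V k) θ).trace := fun j k θ => by
    simp [driftM, Finset.mul_sum, Matrix.trace_sum]
  have h2 : ∀ j k, ∫ θ in cube, (conn V j θ * driftM Ω (conn V k) θ).trace =
      ∑ l, Ω l * connIntegral V j l k := fun j k => by
    simp only [h1]
    rw [integral_finsetSum]
    · simp only [integral_const_mul, connIntegral]
    · exact fun l _ => (integrableOn_trace ((hA j).mul ((hA k).pderiv l))).const_mul _
  have h3 : ∀ θ, curvPair Ω V ε j k θ = ((conn V j θ * driftM Ω (conn V k) θ).trace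
      - (conn V k θ * driftM Ω (conn V j) θ).trace) - 2 * Complex.I *
      (energyMatrix ε θ * (conn V j θ * conn V k θ - conn V k θ * conn V j θ)).trace := fun θ => by
    simp only [curvPair, connRate, Matrix.mul_add, Matrix.mul_smul, Matrix.mul_sub,
      Matrix.trace_add, Matrix.trace_sub, Matrix.trace_smul, smul_eq_mul, ← Matrix.mul_assoc]
    have c3 := Matrix.trace_mul_cycle (energyMatrix ε θ) (conn V k θ) (conn V j θ)
    have c4 := Matrix.trace_mul_cycle (energyMatrix ε θ) (conn V j θ) (conn V k θ)
    have c5 := Matrix.trace_mul_cycle (conn V j θ) (conn V k θ) (energyMatrix ε θ)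
    have c6 := Matrix.trace_mul_cycle (conn V k θ) (conn V j θ) (energyMatrix ε θ)
    linear_combination Complex.I * (c4 - c3 + c6 - c5)
  have i1 : ∀ j k, IntegrableOn (fun θ => (conn V j θ * driftM Ω (conn V k) θ).trace) cube :=
    fun j k => integrableOn_trace ((hA j).mul ((hA k).driftM Ω))
  have i2 : IntegrableOn (fun θ => (energyMatrix ε θ *
      (conn V j θ * conn V k θ - conn V k θ * conn V j θ)).trace) cube :=
    integrableOn_trace (hE.mul (((hA j).mul (hA k)).sub ((hA k).mul (hA j))))
  have h4 : ∫ θ in cube, persPair V ε j k θ = (∫ θ in cube, (pderiv j (energyMatrix ε) θ *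
      conn V k θ).trace) - ∫ θ in cube, (pderiv k (energyMatrix ε) θ * conn V j θ).trace :=
    integral_sub (integrableOn_trace ((hE.pderiv j).mul (hA k)))
      (integrableOn_trace ((hE.pderiv k).mul (hA j)))
  have i3 : IntegrableOn (fun θ => (conn V j θ * driftM Ω (conn V k) θ).trace
      - (conn V k θ * driftM Ω (conn V j) θ).trace) cube := (i1 j k).sub (i1 k j)
  simp only [h3]
  rw [integral_sub i3 (i2.const_mul _),
    integral_sub (i1 j k) (i1 k j), integral_const_mul, integral_mul_commutator hs hu hE, h2, h2, h4]
  simp only [connIntegral_swap hs k]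
  rw [Finset.mul_sum, ← Finset.sum_sub_distrib]
  congr 1
  exact Finset.sum_congr rfl fun l _ => by ring

lemma ofReal_freqNorm_sq (Ω : Fin 3 → ℝ) :
    (freqNorm Ω : ℂ) ^ 2 = Ω 0 ^ 2 + Ω 1 ^ 2 + Ω 2 ^ 2 := by
  rw [← Complex.ofReal_pow, freqNorm, Real.sq_sqrt (Finset.sum_nonneg fun _ _ => sq_nonneg _),
    Fin.sum_univ_three]
  push_cast
  ring

/-- In the plane normal to `c` only the drift component `l = c` survives, since the integrals with a
repeated index vanish. The surviving ones all equal half the winding integral, whence the sum of the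
`Ω_c²`. -/
lemma IsMicromotion.planeSum_integral (hV : IsMicromotion d H Ω V ε) (hH : IsHamiltonian H) :
    planeSum Ω (fun j k => ∫ θ in cube, curvPair Ω V ε j k θ) =
      freqNorm Ω ^ 2 * windingIntegral V 0 1 2
        - 2 * Complex.I * planeSum Ω fun j k => ∫ θ in cube, persPair V ε j k θ := by
  have hs := hV.smooth.smoothMatrix
  have hu := hV.star_mul_self
  rw [ofReal_freqNorm_sq]
  simp only [hV.integral_curvPair hH, planeSum]
  have a := connIntegral_swap hs (V := V)
  have b := connIntegral_sub hs hu (V := V)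
  have c := windingIntegral_cycle V
  simp only [Fin.sum_univ_three, Fin.isValue]
  have w0 : ∀ j l, windingIntegral V j l j = 0 ∧ windingIntegral V j j l = 0 := fun j l => by
    have h1 := windingIntegral_cycle V j j l
    have h2 := windingIntegral_swap V j j l
    have h3 := windingIntegral_swap V l j j
    have h4 := windingIntegral_cycle V l j j
    constructor
    · linear_combination (h1 + h2) / 2
    · linear_combination (h2 - h1) / 2
  have z : ∀ j l, connIntegral V j l j = 0 := fun j l => by
    have := a j l j
    linear_combination this / 2
  have z' : ∀ j l, connIntegral V j j l = 0 := fun j l => by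
    have := b j l j
    rw [z, (w0 j l).1] at this
    linear_combination this
  have z'' : ∀ j l, connIntegral V l j j = 0 := fun j l => by rw [a, z', neg_zero]
  have k1 := b 0 1 2
  have k2 := b 1 2 0
  have k3 := b 2 0 1
  have d1 := c 0 1 2
  have d2 := c 1 2 0
  have e1 := a 0 1 2
  have e2 := a 1 2 0
  have e3 := a 2 0 1
  have r1 : (0 : Fin 3) + 1 = 1 := rfl
  have r2 : (0 : Fin 3) + 2 = 2 := rfl
  have r3 : (1 : Fin 3) + 1 = 2 := rfl
  have r4 : (1 : Fin 3) + 2 = 0 := rfl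
  have r5 : (2 : Fin 3) + 1 = 0 := rfl
  have r6 : (2 : Fin 3) + 2 = 1 := rfl
  rw [e1] at k1
  rw [e2, d1] at k2
  rw [e3, d2, d1] at k3
  -- With antisymmetry used in `k1`, `k2`, `k3`, three linear equations remain for three unknowns,
  -- each saying that the sum of two of them is the winding integral.
  have x1 : connIntegral V 1 0 2 = windingIntegral V 0 1 2 / 2 := by
    linear_combination (k2 + k3 - k1) / 2
  have x2 : connIntegral V 2 1 0 = windingIntegral V 0 1 2 / 2 := by
    linear_combination (k1 + k3 - k2) / 2
  have x3 : connIntegral V 0 2 1 = windingIntegral V 0 1 2 / 2 := by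
    linear_combination (k1 + k2 - k3) / 2
  simp only [r1, r2, r3, r4, r5, r6, z', z'', x1, x2, x3]
  ring

/-- The torus average of the circulation is quantized, up to persistent currents. -/
lemma IsMicromotion.quantized_eq (hV : IsMicromotion d H Ω V ε) (hH : IsHamiltonian H)
    (hΩ : freqNorm Ω ≠ 0) (z : ℂ)
    (hz : z = -(1 / (4 * freqNorm Ω) : ℂ) * (1 / (2 * Real.pi) ^ 3 *
      (planeSum Ω (fun j k => ∫ θ in cube, curvPair Ω V ε j k θ) +
        2 * Complex.I * planeSum Ω fun j k => ∫ θ in cube, persPair V ε j k θ))) :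
    (freqNorm Ω / (2 * Real.pi) : ℂ) * windingNumber V = z + star z := by
  have hs := hV.smooth.smoothMatrix
  have hu := hV.star_mul_self
  have hpi : (Real.pi : ℂ) ≠ 0 := by exact_mod_cast Real.pi_ne_zero
  have hΩ' : (freqNorm Ω : ℂ) ≠ 0 := by exact_mod_cast hΩ
  have h1 : z = -(freqNorm Ω * windingIntegral V 0 1 2) / (32 * Real.pi ^ 3) := by
    rw [hz, hV.planeSum_integral hH]
    field_simp
    ring
  have h2 : star z = z := by
    rw [h1]
    simp only [star_div₀, star_neg, star_mul', star_windingIntegral hs hu, star_pow]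
    simp
  rw [h2, h1, windingNumber_eq]
  field_simp
  ring

end Winding

/-! ### Absolutely convergent Fourier series with weights -/

/-- The Fourier mode `e^{-i m·θ}`. -/
noncomputable def fourierMode (m : Fin 3 → ℤ) (θ : Fin 3 → ℝ) : ℂ :=
  Complex.exp (-Complex.I * ∑ j, (m j : ℂ) * (θ j : ℂ))

lemma fourierMode_add (m n : Fin 3 → ℤ) (θ : Fin 3 → ℝ) :
    fourierMode (m + n) θ = fourierMode m θ * fourierMode n θ := by
  simp only [fourierMode, ← Complex.exp_add, Pi.add_apply, Int.cast_add, add_mul,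
    Finset.sum_add_distrib, mul_add]

lemma fourierMode_zero (θ : Fin 3 → ℝ) : fourierMode 0 θ = 1 := by simp [fourierMode]

lemma norm_fourierMode (m : Fin 3 → ℤ) (θ : Fin 3 → ℝ) : ‖fourierMode m θ‖ = 1 := by
  have : fourierMode m θ = Complex.exp ((-∑ j, (m j : ℝ) * θ j : ℝ) * Complex.I) := by
    rw [fourierMode]; congr 1; push_cast; ring
  rw [this, Complex.norm_exp_ofReal_mul_I]

lemma star_fourierMode (m : Fin 3 → ℤ) (θ : Fin 3 → ℝ) :
    star (fourierMode m θ) = fourierMode (-m) θ := by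
  rw [Complex.star_def, fourierMode, fourierMode, ← Complex.exp_conj]
  congr 1
  simp

lemma fourierMode_add_single (m : Fin 3 → ℤ) (θ : Fin 3 → ℝ) (j : Fin 3) (s : ℝ) :
    fourierMode m (θ + Pi.single j s) =
      fourierMode m θ * Complex.exp (-Complex.I * (m j * s)) := by
  rw [fourierMode, fourierMode, ← Complex.exp_add, ← mul_add]
  congr 2
  simp only [Pi.add_apply, Complex.ofReal_add, mul_add, Finset.sum_add_distrib]
  congr 1
  rw [Finset.sum_eq_single j] <;> simp +contextual

lemma hasDerivAt_fourierMode (m : Fin 3 → ℤ) (θ : Fin 3 → ℝ) (j : Fin 3) (s : ℝ) :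
    HasDerivAt (fun s : ℝ => fourierMode m (θ + Pi.single j s))
      (-Complex.I * m j * fourierMode m (θ + Pi.single j s)) s := by
  simp only [fourierMode_add_single]
  have h : HasDerivAt (fun s : ℝ => Complex.exp (-Complex.I * (m j * s)))
      (Complex.exp (-Complex.I * (m j * s)) * (-Complex.I * (m j * 1))) s :=
    (((Complex.ofRealCLM.hasDerivAt (x := s)).const_mul _).const_mul _).cexp
  exact (h.const_mul _).congr_deriv (by ring)

lemma smoothTorus_fourierMode (m : Fin 3 → ℤ) : SmoothTorus (fourierMode m) := by
  refine ⟨?_, fun θ j => ?_⟩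
  · unfold fourierMode
    have : ∀ j, ContDiff ℝ ∞ fun θ : Fin 3 → ℝ => (θ j : ℂ) := fun j =>
      Complex.ofRealCLM.contDiff.comp (contDiff_apply ℝ ℝ j)
    fun_prop
  · rw [fourierMode_add_single]
    have : -Complex.I * (m j * ((2 * Real.pi : ℝ) : ℂ)) =
        ((-m j : ℤ) : ℂ) * (2 * Real.pi * Complex.I) := by push_cast; ring
    rw [this, Complex.exp_int_mul_two_pi_mul_I, mul_one]

lemma partialD_fourierMode (m : Fin 3 → ℤ) (j : Fin 3) (θ : Fin 3 → ℝ) :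
    partialD j (fourierMode m) θ = -Complex.I * m j * fourierMode m θ := by
  simpa using partialD_of_hasDerivAt (hasDerivAt_fourierMode m θ j 0)

lemma volume_cube : (volume cube).toReal = (2 * Real.pi) ^ 3 := by
  rw [cube, Real.volume_Icc_pi_toReal (fun _ => by simpa using Real.pi_pos.le)]
  simp

lemma integral_fourierMode (m : Fin 3 → ℤ) :
    ∫ θ in cube, fourierMode m θ = if m = 0 then (2 * Real.pi : ℂ) ^ 3 else 0 := by
  split_ifs with h
  · subst h
    simp only [fourierMode_zero]
    rw [setIntegral_const, Measure.real, volume_cube]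
    simp
  · obtain ⟨j, hj⟩ := Function.ne_iff.1 h
    have h1 := integral_partialD (smoothTorus_fourierMode m) j
    simp only [partialD_fourierMode] at h1
    rw [integral_const_mul] at h1
    have : (-Complex.I * m j : ℂ) ≠ 0 :=
      mul_ne_zero (neg_ne_zero.2 Complex.I_ne_zero) (by exact_mod_cast hj)
    exact (mul_eq_zero.1 h1).resolve_left this

attribute [irreducible] fourierMode

/-- The function `f` is the sum of an absolutely convergent Fourier series whose coefficients,
weighted with `w`, have absolute values that add up to at most `B`. -/
def FourierBound (w : (Fin 3 → ℤ) → ℝ) (f : (Fin 3 → ℝ) → ℂ) (B : ℝ) : Prop :=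
  ∃ (I : Type) (_ : Countable I) (a : I → ℂ) (m : I → Fin 3 → ℤ),
    (Summable fun i => ‖a i‖ * w (m i)) ∧ ∑' i, ‖a i‖ * w (m i) ≤ B ∧
      ∀ θ, HasSum (fun i => a i * fourierMode (m i) θ) (f θ)

namespace FourierBound

variable {w w' w₁ w₂ : (Fin 3 → ℤ) → ℝ} {f g : (Fin 3 → ℝ) → ℂ} {B B' B₁ B₂ c : ℝ}

lemma summable_norm {I : Type} {a : I → ℂ} {m : I → Fin 3 → ℤ} (hw : ∀ m, 1 ≤ w m)
    (h : Summable fun i => ‖a i‖ * w (m i)) : Summable fun i => ‖a i‖ :=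
  Summable.of_nonneg_of_le (fun _ => norm_nonneg _)
    (fun _ => le_mul_of_one_le_right (norm_nonneg _) (hw _)) h

lemma mono (h : FourierBound w f B) (hw' : ∀ m, 0 ≤ w' m) (hw : ∀ m, w' m ≤ c * w m)
    (hc : 0 ≤ c) (hB : c * B ≤ B') : FourierBound w' f B' := by
  obtain ⟨I, hI, a, m, h1, h2, h3⟩ := h
  have hle : ∀ i, ‖a i‖ * w' (m i) ≤ c * (‖a i‖ * w (m i)) := fun i => by
    rw [mul_left_comm]
    exact mul_le_mul_of_nonneg_left (hw _) (norm_nonneg _)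
  have hs : Summable fun i => ‖a i‖ * w' (m i) :=
    Summable.of_nonneg_of_le (fun i => mul_nonneg (norm_nonneg _) (hw' _)) hle (h1.mul_left c)
  refine ⟨I, hI, a, m, hs, (hs.tsum_le_tsum hle (h1.mul_left c)).trans ?_, h3⟩
  rw [tsum_mul_left]
  exact (mul_le_mul_of_nonneg_left h2 hc).trans hB

lemma le_bound (h : FourierBound w f B) (hB : B ≤ B') : FourierBound w f B' := by
  obtain ⟨I, hI, a, m, h1, h2, h3⟩ := h
  exact ⟨I, hI, a, m, h1, h2.trans hB, h3⟩

lemma nonneg (h : FourierBound w f B) (hw : ∀ m, 0 ≤ w m) : 0 ≤ B := by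
  obtain ⟨I, hI, a, m, h1, h2, h3⟩ := h
  exact (tsum_nonneg fun i => mul_nonneg (norm_nonneg _) (hw _)).trans h2

lemma norm_le (h : FourierBound w f B) (hw : ∀ m, 1 ≤ w m) (θ : Fin 3 → ℝ) : ‖f θ‖ ≤ B := by
  obtain ⟨I, hI, a, m, h1, h2, h3⟩ := h
  have hn : ∀ i, ‖a i * fourierMode (m i) θ‖ = ‖a i‖ := fun i => by
    rw [norm_mul, norm_fourierMode, mul_one]
  have hs := summable_norm hw h1
  rw [← (h3 θ).tsum_eq]
  refine (norm_tsum_le_tsum_norm (by simpa only [hn] using hs)).trans ?_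
  simp only [hn]
  exact (hs.tsum_le_tsum (fun i => le_mul_of_one_le_right (norm_nonneg _) (hw _)) h1).trans h2

/-- Because frequencies may repeat in the index family, the product is indexed by pairs and no
regrouping into a convolution is needed. Three different weights are allowed, which is what
composition of hops between different sites requires. -/
lemma mul (hf : FourierBound w₁ f B₁) (hg : FourierBound w₂ g B₂) (hw₁ : ∀ m, 1 ≤ w₁ m)
    (hw₂ : ∀ m, 1 ≤ w₂ m) (hw0 : ∀ m, 0 ≤ w m) (hw : ∀ m n, w (m + n) ≤ w₁ m * w₂ n) :
    FourierBound w (fun θ => f θ * g θ) (B₁ * B₂) := by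
  obtain ⟨I, hI, a, m, h1, h2, h3⟩ := hf
  obtain ⟨J, hJ, b, n, k1, k2, k3⟩ := hg
  have n1 : ∀ i, 0 ≤ ‖a i‖ * w₁ (m i) := fun i =>
    mul_nonneg (norm_nonneg _) (zero_le_one.trans (hw₁ _))
  have n2 : ∀ i, 0 ≤ ‖b i‖ * w₂ (n i) := fun i =>
    mul_nonneg (norm_nonneg _) (zero_le_one.trans (hw₂ _))
  have hp := h1.mul_of_nonneg k1 n1 n2
  have hle : ∀ p : I × J, ‖a p.1 * b p.2‖ * w (m p.1 + n p.2) ≤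
      (‖a p.1‖ * w₁ (m p.1)) * (‖b p.2‖ * w₂ (n p.2)) := fun p => by
    rw [norm_mul, mul_mul_mul_comm]
    exact mul_le_mul_of_nonneg_left (hw _ _) (mul_nonneg (norm_nonneg _) (norm_nonneg _))
  have hs : Summable fun p : I × J => ‖a p.1 * b p.2‖ * w (m p.1 + n p.2) :=
    Summable.of_nonneg_of_le (fun p => mul_nonneg (norm_nonneg _) (hw0 _)) hle hp
  refine ⟨I × J, inferInstance, fun p => a p.1 * b p.2, fun p => m p.1 + n p.2, hs, ?_, fun θ => ?_⟩
  · refine (hs.tsum_le_tsum hle hp).trans ?_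
    rw [← h1.tsum_mul_tsum k1 hp]
    exact mul_le_mul h2 k2 (tsum_nonneg n2) ((tsum_nonneg n1).trans h2)
  · have e : ∀ p : I × J, a p.1 * b p.2 * fourierMode (m p.1 + n p.2) θ =
        (a p.1 * fourierMode (m p.1) θ) * (b p.2 * fourierMode (n p.2) θ) := fun p => by
      rw [fourierMode_add]; ring
    simp only [e]
    have s1 : Summable fun i => ‖a i * fourierMode (m i) θ‖ := by
      simpa only [norm_mul, norm_fourierMode, mul_one] using summable_norm hw₁ h1
    have s2 : Summable fun i => ‖b i * fourierMode (n i) θ‖ := by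
      simpa only [norm_mul, norm_fourierMode, mul_one] using summable_norm hw₂ k1
    have key : ∀ (F : I → ℂ) (G : J → ℂ) (x y : ℂ), HasSum F x → HasSum G y →
        (Summable fun i => ‖F i‖) → (Summable fun i => ‖G i‖) →
        HasSum (fun p : I × J => F p.1 * G p.2) (x * y) := fun F G x y hF hG sF sG =>
      hF.mul hG (summable_mul_of_summable_norm sF sG)
    have h := key (fun i => a i * fourierMode (m i) θ) (fun i => b i * fourierMode (n i) θ)
      (f θ) (g θ) (h3 θ) (k3 θ) s1 s2
    exact h

lemma star (hf : FourierBound w f B) (hw : ∀ m, w' (-m) = w m) :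
    FourierBound w' (fun θ => star (f θ)) B := by
  obtain ⟨I, hI, a, m, h1, h2, h3⟩ := hf
  refine ⟨I, hI, fun i => Star.star (a i), fun i => -m i, ?_, ?_, fun θ => ?_⟩
  · simpa only [norm_star, hw] using h1
  · simpa only [norm_star, hw] using h2
  · simpa only [star_mul', star_fourierMode] using (h3 θ).star

lemma const_mul (z : ℂ) (hf : FourierBound w f B) :
    FourierBound w (fun θ => z * f θ) (‖z‖ * B) := by
  obtain ⟨I, hI, a, m, h1, h2, h3⟩ := hf
  refine ⟨I, hI, fun i => z * a i, m, ?_, ?_, fun θ => ?_⟩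
  · simpa only [norm_mul, mul_assoc] using h1.mul_left ‖z‖
  · simp only [norm_mul, mul_assoc]
    rw [tsum_mul_left]
    exact mul_le_mul_of_nonneg_left h2 (norm_nonneg _)
  · simpa only [mul_assoc] using HasSum.mul_left z (h3 θ)

lemma sum {κ : Type} [Fintype κ] {F : κ → (Fin 3 → ℝ) → ℂ} {b : κ → ℝ} (hw : ∀ m, 1 ≤ w m)
    (h : ∀ i, FourierBound w (F i) (b i)) : FourierBound w (fun θ => ∑ i, F i θ) (∑ i, b i) := by
  choose I hI a m h1 h2 h3 using h
  have h0 : ∀ p : Σ k, I k, 0 ≤ ‖a p.1 p.2‖ * w (m p.1 p.2) := fun p =>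
    mul_nonneg (norm_nonneg _) (zero_le_one.trans (hw _))
  have hs : Summable fun p : Σ k, I k => ‖a p.1 p.2‖ * w (m p.1 p.2) :=
    (summable_sigma_of_nonneg h0).2 ⟨h1, (hasSum_fintype _).summable⟩
  refine ⟨Σ k, I k, inferInstance, fun p => a p.1 p.2, fun p => m p.1 p.2, hs, ?_, fun θ => ?_⟩
  · rw [hs.tsum_sigma' h1, tsum_fintype]
    exact Finset.sum_le_sum fun k _ => h2 k
  · refine HasSum.sigma_of_hasSum (hasSum_fintype fun k => F k θ) (fun k => h3 k θ) ?_
    refine Summable.of_norm ?_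
    simpa only [norm_mul, norm_fourierMode, mul_one] using summable_norm hw hs

lemma add (hw : ∀ m, 1 ≤ w m) (hf : FourierBound w f B₁) (hg : FourierBound w g B₂) :
    FourierBound w (fun θ => f θ + g θ) (B₁ + B₂) := by
  have := sum (κ := Fin 2) (F := ![f, g]) (b := ![B₁, B₂]) hw (by
    intro i; fin_cases i
    · exact hf
    · exact hg)
  simpa [Fin.sum_univ_two] using this

lemma sub (hw : ∀ m, 1 ≤ w m) (hf : FourierBound w f B₁) (hg : FourierBound w g B₂) :
    FourierBound w (fun θ => f θ - g θ) (B₁ + B₂) := by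
  have := add hw hf (hg.const_mul (-1))
  simpa [sub_eq_add_neg] using this

lemma zero (w : (Fin 3 → ℤ) → ℝ) : FourierBound w (fun _ => 0) 0 :=
  ⟨Empty, inferInstance, fun _ => 0, fun _ => 0, summable_empty, by simp, fun θ => by simp⟩

/-- Termwise differentiation multiplies coefficients by `m_j`. The comparison of weights pays for
this factor: a drive derivative costs one power, and a flux derivative can exploit that modes with
`m_j = 0` are killed. -/
lemma partialD (hf : FourierBound w f B) (j : Fin 3) (hw' : ∀ m, 1 ≤ w' m)
    (hw : ∀ m, |(m j : ℝ)| * w' m ≤ c * w m) (hc : 0 ≤ c) :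
    FourierBound w' (partialD j f) (c * B) := by
  obtain ⟨I, hI, a, m, h1, h2, h3⟩ := hf
  have hn : ∀ i, ‖-Complex.I * m i j * a i‖ = ‖a i‖ * |(m i j : ℝ)| := fun i => by
    rw [norm_mul, norm_mul, norm_neg, Complex.norm_I, one_mul, Complex.norm_intCast, mul_comm]
  have hle : ∀ i, ‖-Complex.I * m i j * a i‖ * w' (m i) ≤ c * (‖a i‖ * w (m i)) := fun i => by
    rw [hn, mul_left_comm, mul_assoc]
    exact mul_le_mul_of_nonneg_left (hw _) (norm_nonneg _)
  have hs : Summable fun i => ‖-Complex.I * m i j * a i‖ * w' (m i) :=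
    Summable.of_nonneg_of_le (fun i => mul_nonneg (norm_nonneg _)
      (zero_le_one.trans (hw' _))) hle (h1.mul_left c)
  have hu := summable_norm hw' hs
  refine ⟨I, hI, fun i => -Complex.I * m i j * a i, m, hs,
    (hs.tsum_le_tsum hle (h1.mul_left c)).trans ?_, fun θ => ?_⟩
  · rw [tsum_mul_left]
    exact mul_le_mul_of_nonneg_left h2 hc
  · have hd1 : ∀ i (s : ℝ), HasDerivAt (fun s : ℝ => a i * fourierMode (m i) (θ + Pi.single j s))
        (-Complex.I * m i j * a i * fourierMode (m i) (θ + Pi.single j s)) s := fun i s =>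
      ((hasDerivAt_fourierMode (m i) θ j s).const_mul (a i)).congr_deriv (by ring)
    have hd2 : ∀ i (s : ℝ), ‖-Complex.I * m i j * a i * fourierMode (m i) (θ + Pi.single j s)‖ ≤
        ‖-Complex.I * m i j * a i‖ := fun i s => by
      rw [norm_mul, norm_fourierMode, mul_one]
    have hd3 := (h3 (θ + Pi.single j 0)).summable
    have key : ∀ (G G' : I → ℝ → ℂ) (u : I → ℝ), Summable u →
        (∀ i s, HasDerivAt (G i) (G' i s) s) → (∀ i s, ‖G' i s‖ ≤ u i) →
        (Summable fun i => G i 0) → HasDerivAt (fun s => ∑' i, G i s) (∑' i, G' i 0) 0 :=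
      fun G G' u hu h1 h2 h3 => hasDerivAt_tsum hu h1 h2 h3 0
    have hd := key (fun i s => a i * fourierMode (m i) (θ + Pi.single j s))
      (fun i s => -Complex.I * m i j * a i * fourierMode (m i) (θ + Pi.single j s))
      (fun i => ‖-Complex.I * m i j * a i‖) hu hd1
    replace hd := hd hd2
    replace hd := hd hd3
    simp only [(h3 _).tsum_eq] at hd
    have hd' := partialD_of_hasDerivAt hd
    simp only [Pi.single_zero, add_zero] at hd'
    rw [hd']
    refine (Summable.of_norm ?_).hasSum
    simpa only [norm_mul _ (fourierMode _ _), norm_fourierMode, mul_one] using hu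

end FourierBound

/-! ### Time averages of quasi-periodic functions -/

/-- The time average of `f` along the drive. -/
noncomputable def timeMean (Ω θ₀ : Fin 3 → ℝ) (f : (Fin 3 → ℝ) → ℂ) (T : ℝ) : ℂ :=
  (1 / T : ℂ) * ∫ t in (0 : ℝ)..T, f (phase Ω θ₀ t)

/-- The average of `f` over the torus. -/
noncomputable def torusMean (f : (Fin 3 → ℝ) → ℂ) : ℂ :=
  1 / (2 * Real.pi) ^ 3 * ∫ θ in cube, f θ

/-- The frequency `m · Ω`. -/
noncomputable def modeFreq (Ω : Fin 3 → ℝ) (m : Fin 3 → ℤ) : ℝ := ∑ j, (m j : ℝ) * Ω j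

lemma continuous_fourierMode (m : Fin 3 → ℤ) : Continuous (fourierMode m) :=
  (smoothTorus_fourierMode m).continuous

lemma continuous_phase (Ω θ₀ : Fin 3 → ℝ) : Continuous (phase Ω θ₀) := by
  unfold phase; fun_prop

lemma fourierMode_phase (Ω θ₀ : Fin 3 → ℝ) (m : Fin 3 → ℤ) (t : ℝ) :
    fourierMode m (phase Ω θ₀ t) =
      fourierMode m θ₀ * Complex.exp ((-Complex.I * modeFreq Ω m) * t) := by
  unfold fourierMode
  rw [← Complex.exp_add]
  congr 1
  simp only [phase, modeFreq, Pi.add_apply, Pi.smul_apply, smul_eq_mul]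
  push_cast
  simp only [mul_add, Finset.sum_add_distrib, mul_assoc, Finset.sum_mul]
  congr 2
  exact Finset.sum_congr rfl fun j _ => by ring

lemma torusMean_fourierMode (m : Fin 3 → ℤ) :
    torusMean (fourierMode m) = if m = 0 then 1 else 0 := by
  have hpi : (Real.pi : ℂ) ≠ 0 := by exact_mod_cast Real.pi_ne_zero
  rw [torusMean, integral_fourierMode]
  split_ifs
  · field_simp
  · simp

lemma timeMean_fourierMode_of_eq_zero {Ω : Fin 3 → ℝ} {m : Fin 3 → ℤ} (h : modeFreq Ω m = 0)
    (θ₀ : Fin 3 → ℝ) {T : ℝ} (hT : 0 < T) :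
    timeMean Ω θ₀ (fourierMode m) T = fourierMode m θ₀ := by
  have hT' : (T : ℂ) ≠ 0 := by exact_mod_cast hT.ne'
  simp [timeMean, fourierMode_phase, h]
  field_simp

lemma norm_timeMean_fourierMode_le (Ω θ₀ : Fin 3 → ℝ) (m : Fin 3 → ℤ) {T : ℝ} (hT : 0 < T) :
    ‖timeMean Ω θ₀ (fourierMode m) T‖ ≤ 1 := by
  rw [timeMean, norm_mul]
  have h1 : ‖∫ t in (0 : ℝ)..T, fourierMode m (phase Ω θ₀ t)‖ ≤ 1 * |T - 0| :=
    intervalIntegral.norm_integral_le_of_norm_le_const fun t _ => (norm_fourierMode _ _).le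
  rw [one_mul, sub_zero, abs_of_pos hT] at h1
  have h2 : ‖(1 / T : ℂ)‖ = 1 / T := by
    rw [norm_div, norm_one, Complex.norm_real, Real.norm_of_nonneg hT.le]
  rw [h2, one_div_mul_eq_div, div_le_one hT]
  exact h1

lemma norm_timeMean_fourierMode_le_inv {Ω : Fin 3 → ℝ} {m : Fin 3 → ℤ} (h : modeFreq Ω m ≠ 0)
    (θ₀ : Fin 3 → ℝ) {T : ℝ} (hT : 0 < T) :
    ‖timeMean Ω θ₀ (fourierMode m) T‖ ≤ 2 * |modeFreq Ω m|⁻¹ * T⁻¹ := by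
  have hc : (-Complex.I * modeFreq Ω m : ℂ) ≠ 0 :=
    mul_ne_zero (neg_ne_zero.2 Complex.I_ne_zero) (by exact_mod_cast h)
  have hn : ‖(-Complex.I * modeFreq Ω m : ℂ)‖ = |modeFreq Ω m| := by
    rw [norm_mul, norm_neg, Complex.norm_I, one_mul, Complex.norm_real, Real.norm_eq_abs]
  have he : ∀ t : ℝ, ‖Complex.exp ((-Complex.I * modeFreq Ω m) * t)‖ = 1 := fun t => by
    rw [← Complex.norm_exp_ofReal_mul_I (-(modeFreq Ω m * t))]
    congr 2; push_cast; ring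
  simp only [timeMean, fourierMode_phase]
  rw [intervalIntegral.integral_const_mul, integral_exp_mul_complex hc, norm_mul, norm_mul,
    norm_fourierMode, one_mul, norm_div, norm_one, Complex.norm_real,
    Real.norm_of_nonneg hT.le, norm_div, hn]
  have h3 : ‖Complex.exp (-Complex.I * modeFreq Ω m * T)
      - Complex.exp (-Complex.I * modeFreq Ω m * (0 : ℝ))‖ ≤ 2 := by
    refine (norm_sub_le _ _).trans ?_
    rw [he, he]; norm_num
  rw [one_div, mul_comm, div_eq_mul_inv]
  gcongr

section Mean

variable {I : Type} {a : I → ℂ} {m : I → Fin 3 → ℤ} {f : (Fin 3 → ℝ) → ℂ}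

lemma hasSum_torusMean [Countable I] (hs : Summable fun i => ‖a i‖)
    (h : ∀ θ, HasSum (fun i => a i * fourierMode (m i) θ) (f θ)) :
    HasSum (fun i => a i * torusMean (fourierMode (m i))) (torusMean f) := by
  have hfin : IsFiniteMeasure (volume.restrict cube) :=
    ⟨by rw [Measure.restrict_apply_univ]; exact isCompact_Icc.measure_lt_top⟩
  have h1 := MeasureTheory.hasSum_integral_of_dominated_convergence (μ := volume.restrict cube)
    (F := fun i θ => a i * fourierMode (m i) θ) (f := f)
    (fun i _ => ‖a i‖)
    (fun i => (continuous_const.mul (continuous_fourierMode (m i))).aestronglyMeasurable)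
    (fun i => Eventually.of_forall fun θ => by rw [norm_mul, norm_fourierMode, mul_one])
    (Eventually.of_forall fun _ => hs) (integrable_const _) (Eventually.of_forall h)
  have h2 := HasSum.mul_left (1 / (2 * Real.pi) ^ 3 : ℂ) h1
  unfold torusMean
  convert! h2 using 1
  funext i
  rw [integral_const_mul]
  ring

lemma hasSum_timeMean [Countable I] (hs : Summable fun i => ‖a i‖)
    (h : ∀ θ, HasSum (fun i => a i * fourierMode (m i) θ) (f θ)) (Ω θ₀ : Fin 3 → ℝ) (T : ℝ) :
    HasSum (fun i => a i * timeMean Ω θ₀ (fourierMode (m i)) T) (timeMean Ω θ₀ f T) := by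
  have h1 := intervalIntegral.hasSum_integral_of_dominated_convergence (μ := volume)
    (a := 0) (b := T)
    (F := fun i t => a i * fourierMode (m i) (phase Ω θ₀ t)) (f := fun t => f (phase Ω θ₀ t))
    (fun i _ => ‖a i‖)
    (fun i => (continuous_const.mul
      ((continuous_fourierMode (m i)).comp (continuous_phase Ω θ₀))).aestronglyMeasurable)
    (fun i => Eventually.of_forall fun θ _ => by rw [norm_mul, norm_fourierMode, mul_one])
    (Eventually.of_forall fun _ _ => hs) intervalIntegrable_const
    (Eventually.of_forall fun t _ => h _)
  have h2 := HasSum.mul_left (1 / T : ℂ) h1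
  unfold timeMean
  convert! h2 using 1
  funext i
  rw [intervalIntegral.integral_const_mul]
  ring

/-- The oscillating part of the time average of a Fourier mode. -/
noncomputable def oscMean (Ω θ₀ : Fin 3 → ℝ) (m : Fin 3 → ℤ) (T : ℝ) : ℝ :=
  if modeFreq Ω m = 0 then 0 else ‖timeMean Ω θ₀ (fourierMode m) T‖

/-- The zero mode agrees in both averages. A nonzero resonant mode never averages out, and is only
controlled because its weight is at least `1/σ` when `σ > 0`; for `σ = 0` the hypothesis excludes
such modes. The other modes are left to the oscillating sum. -/
lemma norm_timeMean_sub_torusMean_le [Countable I] {w : (Fin 3 → ℤ) → ℝ} {σ B : ℝ} (hσ : 0 ≤ σ)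
    (hw : ∀ m, 1 ≤ w m) (h1 : Summable fun i => ‖a i‖ * w (m i))
    (h2 : ∑' i, ‖a i‖ * w (m i) ≤ B)
    (h3 : ∀ θ, HasSum (fun i => a i * fourierMode (m i) θ) (f θ)) (Ω θ₀ : Fin 3 → ℝ)
    (hΩ : ∀ m, m ≠ 0 → modeFreq Ω m = 0 → 1 ≤ σ * w m) {T : ℝ} (hT : 0 < T) :
    ‖timeMean Ω θ₀ f T - torusMean f‖ ≤ σ * B + ∑' i, ‖a i‖ * oscMean Ω θ₀ (m i) T := by
  have hs := FourierBound.summable_norm hw h1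
  have hd := (hasSum_timeMean hs h3 Ω θ₀ T).sub (hasSum_torusMean hs h3)
  have ho : Summable fun i => ‖a i‖ * oscMean Ω θ₀ (m i) T := by
    refine Summable.of_nonneg_of_le (fun i => mul_nonneg (norm_nonneg _) ?_)
      (fun i => mul_le_of_le_one_right (norm_nonneg _) ?_) hs
    · unfold oscMean; split_ifs <;> simp
    · unfold oscMean
      split_ifs
      · simp
      · exact norm_timeMean_fourierMode_le Ω θ₀ _ hT
  have hle : ∀ i, ‖a i * timeMean Ω θ₀ (fourierMode (m i)) T
      - a i * torusMean (fourierMode (m i))‖ ≤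
      σ * (‖a i‖ * w (m i)) + ‖a i‖ * oscMean Ω θ₀ (m i) T := fun i => by
    rw [← mul_sub, norm_mul, torusMean_fourierMode]
    have hn := norm_nonneg (a i)
    have hwi := zero_le_one.trans (hw (m i))
    by_cases h0 : m i = 0
    · have hf : modeFreq Ω (m i) = 0 := by simp [h0, modeFreq]
      rw [if_pos h0, timeMean_fourierMode_of_eq_zero hf θ₀ hT, h0, fourierMode_zero, sub_self,
        norm_zero, mul_zero, ← h0, oscMean, if_pos hf]
      positivity
    · rw [if_neg h0, sub_zero]
      by_cases hf : modeFreq Ω (m i) = 0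
      · rw [timeMean_fourierMode_of_eq_zero hf θ₀ hT, norm_fourierMode, oscMean, if_pos hf]
        have := mul_le_mul_of_nonneg_left (hΩ _ h0 hf) hn
        linarith
      · rw [oscMean, if_neg hf]
        have := mul_nonneg hσ (mul_nonneg hn hwi)
        linarith
  have hsum := (h1.mul_left σ).add ho
  rw [← hd.tsum_eq]
  refine (tsum_of_norm_bounded hsum.hasSum hle).trans ?_
  rw [(h1.mul_left σ).tsum_add ho, tsum_mul_left]
  gcongr

end Mean

namespace FourierBound

variable {w : (Fin 3 → ℤ) → ℝ} {f : (Fin 3 → ℝ) → ℂ} {B σ D : ℝ} {Ω : Fin 3 → ℝ}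

/-- Rate of convergence of the time average under a small-divisor condition. -/
lemma timeMean_rate (hf : FourierBound w f B) (hw : ∀ m, 1 ≤ w m) (hσ : 0 ≤ σ) (hD : 0 ≤ D)
    (hΩ : ∀ m, m ≠ 0 → modeFreq Ω m = 0 → 1 ≤ σ * w m)
    (hΩ' : ∀ m, modeFreq Ω m ≠ 0 → |modeFreq Ω m|⁻¹ ≤ D * w m) (θ₀ : Fin 3 → ℝ) {T : ℝ}
    (hT : 0 < T) : ‖timeMean Ω θ₀ f T - torusMean f‖ ≤ σ * B + 2 * D * B * T⁻¹ := by
  obtain ⟨I, hI, a, m, h1, h2, h3⟩ := hf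
  refine (norm_timeMean_sub_torusMean_le hσ hw h1 h2 h3 Ω θ₀ hΩ hT).trans ?_
  have hTi : 0 ≤ T⁻¹ := (inv_pos.2 hT).le
  have hle : ∀ i, ‖a i‖ * oscMean Ω θ₀ (m i) T ≤ (2 * D * T⁻¹) * (‖a i‖ * w (m i)) := fun i => by
    have hwi := zero_le_one.trans (hw (m i))
    have : oscMean Ω θ₀ (m i) T ≤ 2 * (D * w (m i)) * T⁻¹ := by
      unfold oscMean
      split_ifs with h
      · positivity
      · refine (norm_timeMean_fourierMode_le_inv h θ₀ hT).trans ?_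
        gcongr
        exact hΩ' _ h
    calc _ ≤ ‖a i‖ * (2 * (D * w (m i)) * T⁻¹) := by gcongr
      _ = _ := by ring
  have h4 : ∑' i, ‖a i‖ * oscMean Ω θ₀ (m i) T ≤ (2 * D * T⁻¹) * B := by
    have hs : Summable fun i => ‖a i‖ * oscMean Ω θ₀ (m i) T :=
      Summable.of_nonneg_of_le (fun i => mul_nonneg (norm_nonneg _)
        (by unfold oscMean; split_ifs <;> simp)) hle (h1.mul_left _)
    refine (hs.tsum_le_tsum hle (h1.mul_left _)).trans ?_
    rw [tsum_mul_left]
    gcongr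
  linarith

/-- Convergence of the time average up to the resonant Fourier modes. -/
lemma eventually_timeMean (hf : FourierBound w f B) (hw : ∀ m, 1 ≤ w m) (hσ : 0 ≤ σ)
    (hΩ : ∀ m, m ≠ 0 → modeFreq Ω m = 0 → 1 ≤ σ * w m) (θ₀ : Fin 3 → ℝ) {δ : ℝ} (hδ : 0 < δ) :
    ∀ᶠ T : ℝ in atTop, ‖timeMean Ω θ₀ f T - torusMean f‖ ≤ σ * B + δ := by
  obtain ⟨I, hI, a, m, h1, h2, h3⟩ := hf
  have hs := summable_norm hw h1
  -- Each mode decays but without uniform rate; the summable `‖a i‖` dominates.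
  have ht : Tendsto (fun T : ℝ => ∑' i, ‖a i‖ * oscMean Ω θ₀ (m i) T) atTop
      (𝓝 (∑' _ : I, (0 : ℝ))) := by
    refine tendsto_tsum_of_dominated_convergence hs (fun i => ?_) ?_
    · unfold oscMean
      split_ifs with h
      · simp
      · rw [← mul_zero ‖a i‖]
        refine Tendsto.const_mul _ ?_
        have hz : Tendsto (fun T : ℝ => 2 * |modeFreq Ω (m i)|⁻¹ * T⁻¹) atTop (𝓝 0) := by
          simpa using tendsto_inv_atTop_zero.const_mul (2 * |modeFreq Ω (m i)|⁻¹)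
        refine squeeze_zero' (Eventually.of_forall fun _ => norm_nonneg _) ?_ hz
        filter_upwards [eventually_gt_atTop 0] with T hT
        exact norm_timeMean_fourierMode_le_inv h θ₀ hT
    · filter_upwards [eventually_gt_atTop 0] with T hT i
      rw [norm_mul, norm_norm]
      refine mul_le_of_le_one_right (norm_nonneg _) ?_
      unfold oscMean
      split_ifs
      · simp
      · rw [norm_norm]
        exact norm_timeMean_fourierMode_le Ω θ₀ _ hT
  rw [tsum_zero] at ht
  filter_upwards [eventually_gt_atTop 0, ht.eventually_lt_const hδ] with T hT h
  have := norm_timeMean_sub_torusMean_le hσ hw h1 h2 h3 Ω θ₀ hΩ hT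
  linarith

end FourierBound

/-! ### Fourier inversion on the torus -/

section Inversion

open UnitAddTorus
open scoped Pointwise

lemma SmoothTorus.add_int {f : (Fin 3 → ℝ) → ℂ} (hf : SmoothTorus f) (θ : Fin 3 → ℝ)
    (n : Fin 3 → ℤ) : f (θ + fun j => 2 * Real.pi * n j) = f θ := by
  have h : ∀ (θ : Fin 3 → ℝ) (j : Fin 3) (k : ℤ),
      f (θ + Pi.single j (k * (2 * Real.pi))) = f θ := fun θ j k => by
    have hp : Function.Periodic (fun s : ℝ => f (θ + Pi.single j s)) (2 * Real.pi) := fun s => by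
      simp only [Pi.single_add, ← add_assoc, hf.2]
    simpa using hp.int_mul k 0
  have e : (θ + fun j => 2 * Real.pi * n j) = θ + Pi.single 0 (n 0 * (2 * Real.pi))
      + Pi.single 1 (n 1 * (2 * Real.pi)) + Pi.single 2 (n 2 * (2 * Real.pi)) := by
    funext j
    fin_cases j <;> simp [mul_comm]
  rw [e, h, h, h]

/-- The covering map of the torus. -/
noncomputable def torusCover : C(Fin 3 → ℝ, UnitAddTorus (Fin 3)) :=
  ⟨fun x i => (x i : UnitAddCircle), by fun_prop⟩

lemma isQuotientMap_torusCover : IsQuotientMap torusCover :=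
  (IsOpenQuotientMap.piMap fun _ : Fin 3 =>
    (QuotientAddGroup.isOpenQuotientMap_mk : IsOpenQuotientMap
      ((↑) : ℝ → UnitAddCircle))).isQuotientMap

/-- A periodic function is constant on the fibres of the covering, which is a quotient map; this
gives access to Fourier inversion on the unit torus. -/
lemma SmoothTorus.exists_lift {f : (Fin 3 → ℝ) → ℂ} (hf : SmoothTorus f) :
    ∃ g : C(UnitAddTorus (Fin 3), ℂ), ∀ x, g (torusCover x) = f ((2 * Real.pi) • x) := by
  let F : C(Fin 3 → ℝ, ℂ) := ⟨fun x => f ((2 * Real.pi) • x),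
    hf.continuous.comp (continuous_const_smul _)⟩
  have hfac : Function.FactorsThrough F torusCover := fun x y hxy => by
    have h : ∀ i, ∃ n : ℤ, x i = y i + n := fun i => by
      have h1 : ((x i - y i : ℝ) : UnitAddCircle) = 0 := by
        rw [AddCircle.coe_sub, sub_eq_zero]
        exact congrFun hxy i
      obtain ⟨n, hn⟩ := (AddCircle.coe_eq_zero_iff 1).1 h1
      exact ⟨n, by simp at hn; linarith⟩
    choose n hn using h
    change f ((2 * Real.pi) • x) = f ((2 * Real.pi) • y)
    rw [← hf.add_int ((2 * Real.pi) • y) n]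
    congr 1
    funext i
    simp [hn, mul_add]
  exact ⟨isQuotientMap_torusCover.lift F hfac, fun x =>
    congrFun (congrArg DFunLike.coe (isQuotientMap_torusCover.lift_comp F hfac)) x⟩

lemma mFourier_torusCover (n : Fin 3 → ℤ) (x : Fin 3 → ℝ) :
    mFourier n (torusCover x) = fourierMode (-n) ((2 * Real.pi) • x) := by
  unfold fourierMode
  simp only [mFourier, torusCover, ContinuousMap.coe_mk, fourier_coe_apply]
  rw [← Complex.exp_sum, Finset.mul_sum]
  congr 1
  refine Finset.sum_congr rfl fun j _ => ?_
  simp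
  ring

/-- The sign reflects the convention `e^{-im·θ}`, opposite to that of the characters `mFourier`. -/
lemma mFourierCoeff_lift {f : (Fin 3 → ℝ) → ℂ} {g : C(UnitAddTorus (Fin 3), ℂ)}
    (hg : ∀ x, g (torusCover x) = f ((2 * Real.pi) • x)) (n : Fin 3 → ℤ) :
    mFourierCoeff g n = torusCoeff f (-n) := by
  have hpi : (0 : ℝ) < 2 * Real.pi := by positivity
  rw [mFourierCoeff_eq_integral g n 0]
  have h1 : ∀ x : Fin 3 → ℝ, mFourier (-n) (fun i => (x i : UnitAddCircle)) •
      g (fun i => (x i : UnitAddCircle)) =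
      (fun θ => fourierMode n θ * f θ) ((2 * Real.pi) • x) := fun x => by
    have h2 := mFourier_torusCover (-n) x
    rw [neg_neg] at h2
    simp only [← h2, ← hg x, smul_eq_mul]
    rfl
  simp only [h1]
  rw [Measure.setIntegral_comp_smul_of_pos volume (fun θ => fourierMode n θ * f θ) _ hpi]
  have hset : (2 * Real.pi) • {x : Fin 3 → ℝ | ∀ i, x i ∈ Set.Ioc ((0 : Fin 3 → ℝ) i) ((0 : Fin 3 → ℝ) i + 1)} =
      Set.univ.pi fun _ : Fin 3 => Set.Ioc (0 : ℝ) (2 * Real.pi) := by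
    ext x
    rw [Set.mem_smul_set_iff_inv_smul_mem₀ hpi.ne']
    simp only [Set.mem_ofPred_eq, Set.mem_univ_pi, Pi.smul_apply, smul_eq_mul, Set.mem_Ioc,
      Pi.zero_apply, zero_add]
    refine forall_congr' fun i => ?_
    rw [inv_mul_le_iff₀ hpi, mul_one, mul_pos_iff_of_pos_left (inv_pos.2 hpi)]
  have hae : (Set.univ.pi fun _ : Fin 3 => Set.Ioc (0 : ℝ) (2 * Real.pi))
      =ᵐ[(volume : Measure (Fin 3 → ℝ))] Set.Icc (0 : Fin 3 → ℝ) (fun _ => 2 * Real.pi) := by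
    rw [volume_pi]
    exact Measure.univ_pi_Ioc_ae_eq_Icc (μ := fun _ : Fin 3 => (volume : Measure ℝ))
      (f := fun _ => (0 : ℝ)) (g := fun _ => 2 * Real.pi)
  rw [hset, setIntegral_congr_set hae, torusCoeff, cube, Module.finrank_fin_fun, Complex.real_smul]
  congr 1
  · push_cast; rw [one_div]
  · refine integral_congr_ae (Eventually.of_forall fun θ => ?_)
    simp only [fourierMode, Pi.neg_apply, Int.cast_neg, neg_mul, Finset.sum_neg_distrib, mul_neg]
    rw [mul_comm]

/-- A smooth function on the torus with summable Fourier coefficients is the sum of its Fourier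
series. -/
lemma SmoothTorus.hasSum_torusCoeff {f : (Fin 3 → ℝ) → ℂ} (hf : SmoothTorus f)
    (hs : Summable fun m => ‖torusCoeff f m‖) (θ : Fin 3 → ℝ) :
    HasSum (fun m => torusCoeff f m * fourierMode m θ) (f θ) := by
  obtain ⟨g, hg⟩ := hf.exists_lift
  have hpi : (2 * Real.pi) ≠ 0 := by positivity
  have hc : (mFourierCoeff g : (Fin 3 → ℤ) → ℂ) = fun n => torusCoeff f (-n) :=
    funext (mFourierCoeff_lift hg)
  have hs' : Summable (mFourierCoeff g : (Fin 3 → ℤ) → ℂ) := by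
    rw [hc]
    exact (Equiv.neg (Fin 3 → ℤ)).summable_iff.2 (Summable.of_norm hs)
  have h := hasSum_mFourier_series_apply_of_summable hs' (torusCover ((2 * Real.pi)⁻¹ • θ))
  rw [hg, smul_inv_smul₀ hpi] at h
  simp only [hc, mFourier_torusCover, smul_inv_smul₀ hpi] at h
  exact (Equiv.neg (Fin 3 → ℤ)).hasSum_iff.1 h

end Inversion

/-! ### Decay of Fourier coefficients -/

section Decay

lemma torusCoeff_eq (f : (Fin 3 → ℝ) → ℂ) (m : Fin 3 → ℤ) :
    torusCoeff f m = torusMean fun θ => f θ * fourierMode (-m) θ := by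
  unfold torusCoeff torusMean fourierMode
  simp

lemma torusCoeff_mul_fourierMode (f : (Fin 3 → ℝ) → ℂ) (m n : Fin 3 → ℤ) :
    torusCoeff (fun θ => f θ * fourierMode n θ) m = torusCoeff f (m - n) := by
  rw [torusCoeff_eq, torusCoeff_eq]
  congr 1
  funext θ
  rw [mul_assoc, ← fourierMode_add, neg_sub, sub_eq_add_neg]

lemma SmoothTorus.torusCoeff_partialD {f : (Fin 3 → ℝ) → ℂ} (hf : SmoothTorus f) (j : Fin 3)
    (m : Fin 3 → ℤ) : torusCoeff (ALTP.partialD j f) m = -Complex.I * m j * torusCoeff f m := by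
  have hs := smoothTorus_fourierMode (-m)
  have h := integral_partialD (hf.mul hs) j
  have e : ALTP.partialD j (fun θ => f θ * fourierMode (-m) θ) = fun θ =>
      ALTP.partialD j f θ * fourierMode (-m) θ
        + Complex.I * m j * (f θ * fourierMode (-m) θ) := funext fun θ => by
    rw [partialD_mul hf hs, partialD_fourierMode]
    simp
    ring
  rw [e, integral_add (SmoothTorus.integrableOn ((hf.partialD j).mul hs).continuous)
    (SmoothTorus.integrableOn ((hf.mul hs).const_mul _).continuous),
    integral_const_mul] at h
  rw [torusCoeff_eq, torusCoeff_eq, torusMean, torusMean, eq_neg_of_add_eq_zero_left h]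
  ring

lemma exists_norm_torusCoeff_le (f : (Fin 3 → ℝ) → ℂ) :
    ∃ C : ℝ, ∀ m, ‖torusCoeff f m‖ ≤ C := by
  refine ⟨‖(1 / (2 * Real.pi) ^ 3 : ℂ)‖ * ∫ θ in cube, ‖f θ‖, fun m => ?_⟩
  rw [torusCoeff_eq, torusMean, norm_mul]
  refine mul_le_mul_of_nonneg_left ((norm_integral_le_integral_norm _).trans (le_of_eq ?_))
    (norm_nonneg _)
  simp only [norm_mul, norm_fourierMode, mul_one]

lemma one_le_one_add_driveNorm (d : ℕ) (m : Fin 3 → ℤ) : 1 ≤ 1 + driveNorm d m :=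
  le_add_of_nonneg_right (norm_nonneg _)

lemma driveNorm_zero_le_sum (m : Fin 3 → ℤ) : driveNorm 0 m ≤ ∑ j, |(m j : ℝ)| := by
  refine (pi_norm_le_iff_of_nonneg (Finset.sum_nonneg fun j _ => abs_nonneg _)).2 fun j => ?_
  exact Finset.single_le_sum (f := fun j => |(m j : ℝ)|) (fun j _ => abs_nonneg _)
    (Finset.mem_univ j.1)

lemma abs_le_driveNorm {d : ℕ} (m : Fin 3 → ℤ) {j : Fin 3} (hj : d ≤ (j : ℕ)) :
    |(m j : ℝ)| ≤ driveNorm d m :=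
  norm_le_pi_norm (fun j : {j : Fin 3 // d ≤ (j : ℕ)} => (m j : ℝ)) ⟨j, hj⟩

/-- Each power of `1 + |m|` is traded for one derivative of `f`, and derivatives of `f` are again
smooth and periodic. -/
lemma SmoothTorus.exists_decay (s : ℕ) : ∀ {f : (Fin 3 → ℝ) → ℂ} (_ : SmoothTorus f),
    ∃ C : ℝ, ∀ m, ‖torusCoeff f m‖ * (1 + driveNorm 0 m) ^ s ≤ C := by
  induction s with
  | zero =>
    intro f hf
    simpa using exists_norm_torusCoeff_le f
  | succ s ih =>
    intro f hf
    obtain ⟨C, hC⟩ := ih hf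
    choose c hc using fun j => ih (hf.partialD j)
    refine ⟨C + ∑ j, c j, fun m => ?_⟩
    have h0 : 0 ≤ (1 + driveNorm 0 m) ^ s :=
      pow_nonneg (zero_le_one.trans (one_le_one_add_driveNorm 0 m)) s
    have h1 : ‖torusCoeff f m‖ * (1 + driveNorm 0 m) ^ (s + 1) ≤
        ‖torusCoeff f m‖ * (1 + driveNorm 0 m) ^ s * (1 + ∑ j, |(m j : ℝ)|) := by
      rw [pow_succ, ← mul_assoc]
      exact mul_le_mul_of_nonneg_left (add_le_add le_rfl (driveNorm_zero_le_sum m))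
        (mul_nonneg (norm_nonneg _) h0)
    refine h1.trans ?_
    rw [mul_add, mul_one, Finset.mul_sum]
    refine add_le_add (hC m) (Finset.sum_le_sum fun j _ => (le_of_eq ?_).trans (hc j m))
    rw [hf.torusCoeff_partialD, norm_mul, norm_mul, norm_neg, Complex.norm_I, one_mul,
      Complex.norm_intCast]
    ring

/-- Products of summable functions of the coordinates are summable over the lattice. -/
lemma summable_prod_coord {g : Fin 3 → ℤ → ℝ} (h0 : ∀ j k, 0 ≤ g j k)
    (hg : ∀ j, Summable (g j)) :
    (Summable fun m : Fin 3 → ℤ => ∏ j, g j (m j)) ∧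
      ∑' m : Fin 3 → ℤ, ∏ j, g j (m j) ≤ ∏ j, ∑' k, g j k := by
  have hfin : ∀ S : Finset (Fin 3 → ℤ), ∑ m ∈ S, ∏ j, g j (m j) ≤ ∏ j, ∑' k, g j k := fun S => by
    classical
    have hsub : S ⊆ Fintype.piFinset fun j => S.image fun m => m j := fun m hm =>
      Fintype.mem_piFinset.2 fun j => Finset.mem_image_of_mem _ hm
    refine (Finset.sum_le_sum_of_subset_of_nonneg hsub fun m _ _ =>
      Finset.prod_nonneg fun j _ => h0 _ _).trans ?_
    rw [← Finset.prod_univ_sum]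
    exact Finset.prod_le_prod (fun j _ => Finset.sum_nonneg fun k _ => h0 _ _) fun j _ =>
      (hg j).sum_le_tsum _ fun k _ => h0 _ _
  have hn : 0 ≤ fun m : Fin 3 → ℤ => ∏ j, g j (m j) := fun m => Finset.prod_nonneg fun j _ => h0 _ _
  have hs := summable_of_sum_le hn hfin
  exact ⟨hs, hs.tsum_le_of_sum_le hfin⟩

/-- Summability over the lattice is reduced to one-dimensional sums by a product majorant, one
factor per coordinate. -/
lemma SmoothTorus.fourierBound {f : (Fin 3 → ℝ) → ℂ} (hf : SmoothTorus f)
    {w : (Fin 3 → ℤ) → ℝ} (hw : ∀ m, 1 ≤ w m) {g : Fin 3 → ℤ → ℝ} (h0 : ∀ j k, 0 ≤ g j k)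
    (hg : ∀ j, Summable (g j)) {c B : ℝ} (hc : 0 ≤ c)
    (hle : ∀ m, ‖torusCoeff f m‖ * w m ≤ c * ∏ j, g j (m j)) (hB : ∀ j, ∑' k, g j k ≤ B) :
    FourierBound w f (c * B ^ 3) := by
  obtain ⟨h1, h2⟩ := summable_prod_coord h0 hg
  have hs : Summable fun m => ‖torusCoeff f m‖ * w m :=
    Summable.of_nonneg_of_le
      (fun m => mul_nonneg (norm_nonneg _) (zero_le_one.trans (hw m))) hle (h1.mul_left c)
  refine ⟨Fin 3 → ℤ, inferInstance, torusCoeff f, id, hs, ?_,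
    hf.hasSum_torusCoeff (FourierBound.summable_norm hw hs)⟩
  refine (hs.tsum_le_tsum hle (h1.mul_left c)).trans ?_
  rw [tsum_mul_left]
  refine mul_le_mul_of_nonneg_left (h2.trans ?_) hc
  refine (Finset.prod_le_prod (fun j _ => tsum_nonneg (h0 j)) fun j _ => hB j).trans ?_
  simp

lemma summable_int_inv_sq : Summable fun k : ℤ => ((1 + |(k : ℝ)|) ^ 2)⁻¹ := by
  have h : Summable fun n : ℕ => ((1 + (n : ℝ)) ^ 2)⁻¹ := by
    have h1 := (summable_nat_add_iff 1).2 (Real.summable_nat_pow_inv (p := 2).2 (by norm_num))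
    refine h1.congr fun n => ?_
    push_cast
    rw [add_comm]
  refine Summable.of_nat_of_neg ?_ ?_
  · simpa using h
  · simpa using h

lemma prod_coord_le (m : Fin 3 → ℤ) :
    ∏ j, (1 + |(m j : ℝ)|) ^ 2 ≤ (1 + driveNorm 0 m) ^ 6 := by
  have h : ∏ j : Fin 3, (1 + |(m j : ℝ)|) ^ 2 ≤ ∏ _j : Fin 3, (1 + driveNorm 0 m) ^ 2 :=
    Finset.prod_le_prod (fun j _ => by positivity) fun j _ =>
      pow_le_pow_left₀ (by positivity) (add_le_add le_rfl (abs_le_driveNorm m (Nat.zero_le _))) 2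
  refine h.trans (le_of_eq ?_)
  simp [← pow_mul]

/-- Six additional powers of decay are spent on the sum, two for each coordinate. -/
lemma SmoothTorus.exists_fourierBound {f : (Fin 3 → ℝ) → ℂ} (hf : SmoothTorus f) (s : ℕ) :
    ∃ B, FourierBound (fun m => (1 + driveNorm 0 m) ^ s) f B := by
  obtain ⟨C, hC⟩ := SmoothTorus.exists_decay (s + 6) hf
  refine ⟨_, hf.fourierBound (c := |C|) (fun m => one_le_pow₀ (one_le_one_add_driveNorm 0 m))
    (g := fun _ k => ((1 + |(k : ℝ)|) ^ 2)⁻¹) (fun _ k => by positivity)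
    (fun _ => summable_int_inv_sq) (abs_nonneg C) (fun m => ?_) (fun _ => le_rfl)⟩
  rw [Finset.prod_inv_distrib, ← div_eq_mul_inv, le_div_iff₀ (by positivity), mul_assoc]
  refine le_trans (mul_le_mul_of_nonneg_left ?_ (norm_nonneg _)) ((hC m).trans (le_abs_self C))
  rw [pow_add]
  exact mul_le_mul_of_nonneg_left (prod_coord_le m)
    (pow_nonneg (zero_le_one.trans (one_le_one_add_driveNorm 0 m)) s)

end Decay

/-! ### Gauge transformations of the quasienergy states -/

section Gauge

set_option linter.unusedSectionVars false

variable {ι : Type} [Fintype ι] [DecidableEq ι]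
  {d : ℕ} {H V : (Fin 3 → ℝ) → Matrix ι ι ℂ} {Ω : Fin 3 → ℝ} {ε : ι → (Fin 3 → ℝ) → ℝ}

/-- The diagonal matrix of Fourier modes. -/
noncomputable def modeMatrix (μ : ι → Fin 3 → ℤ) (θ : Fin 3 → ℝ) : Matrix ι ι ℂ :=
  Matrix.diagonal fun α => fourierMode (μ α) θ

/-- The diagonal matrix of wave numbers. -/
noncomputable def waveMatrix (μ : ι → Fin 3 → ℤ) (j : Fin 3) : Matrix ι ι ℂ :=
  Matrix.diagonal fun α => -Complex.I * μ α j

lemma smoothMatrix_modeMatrix (μ : ι → Fin 3 → ℤ) : SmoothMatrix (modeMatrix μ) := fun a b => by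
  by_cases h : a = b
  · subst h
    simpa [modeMatrix] using smoothTorus_fourierMode (μ a)
  · simpa [modeMatrix, h] using SmoothTorus.const 0

lemma modeMatrix_mul_star (μ : ι → Fin 3 → ℤ) (θ : Fin 3 → ℝ) :
    modeMatrix μ θ * (modeMatrix μ θ)ᴴ = 1 := by
  rw [modeMatrix, Matrix.diagonal_conjTranspose, Matrix.diagonal_mul_diagonal,
    ← Matrix.diagonal_one]
  congr 1
  funext α
  rw [Pi.star_apply, star_fourierMode, ← fourierMode_add, add_neg_cancel, fourierMode_zero]

lemma pderiv_modeMatrix (μ : ι → Fin 3 → ℤ) (j : Fin 3) (θ : Fin 3 → ℝ) :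
    pderiv j (modeMatrix μ) θ = waveMatrix μ j * modeMatrix μ θ := by
  ext a b
  rw [waveMatrix, modeMatrix, Matrix.diagonal_mul_diagonal, pderiv_apply]
  by_cases h : a = b
  · subst h
    simp [modeMatrix, partialD_fourierMode]
  · simp [modeMatrix, h, partialD_const]

lemma conn_mul_modeMatrix (hs : SmoothMatrix V) (hu : ∀ θ, (V θ)ᴴ * V θ = 1)
    (μ : ι → Fin 3 → ℤ) (j : Fin 3) (θ : Fin 3 → ℝ) :
    conn (fun θ => V θ * modeMatrix μ θ) j θ =
      (modeMatrix μ θ)ᴴ * (conn V j θ + waveMatrix μ j) * modeMatrix μ θ := by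
  rw [conn, pderiv_mul hs (smoothMatrix_modeMatrix μ), pderiv_modeMatrix,
    Matrix.conjTranspose_mul, conn]
  simp only [Matrix.mul_add, Matrix.add_mul, Matrix.mul_assoc]
  rw [← Matrix.mul_assoc (V θ)ᴴ (V θ), hu, Matrix.one_mul]

lemma waveMatrix_comm (μ : ι → Fin 3 → ℤ) (j k : Fin 3) :
    waveMatrix μ j * waveMatrix μ k = waveMatrix μ k * waveMatrix μ j := by
  simp only [waveMatrix, Matrix.diagonal_mul_diagonal, mul_comm]

lemma trace_conj_commutator {D : Matrix ι ι ℂ} (h : D * Dᴴ = 1) (A B C : Matrix ι ι ℂ) :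
    ((Dᴴ * A * D) * ((Dᴴ * B * D) * (Dᴴ * C * D) - (Dᴴ * C * D) * (Dᴴ * B * D))).trace =
      (A * (B * C - C * B)).trace := by
  have h2 : ∀ X Y : Matrix ι ι ℂ, (Dᴴ * X * D) * (Dᴴ * Y * D) = Dᴴ * (X * Y) * D := fun X Y => by
    simp only [Matrix.mul_assoc]
    rw [← Matrix.mul_assoc D Dᴴ, h, Matrix.one_mul]
  rw [h2, h2, ← Matrix.sub_mul, ← Matrix.mul_sub, h2, Matrix.trace_mul_comm, ← Matrix.mul_assoc, h,
    Matrix.one_mul]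

/-- For mutually commuting shifts, all terms with two or more of them cancel under the trace. Only
terms linear in the shifts remain. -/
lemma trace_shift_commutator (A B C a b c : Matrix ι ι ℂ) (hab : a * b = b * a)
    (hbc : b * c = c * b) (hca : c * a = a * c) :
    ((A + a) * ((B + b) * (C + c) - (C + c) * (B + b))).trace =
      (A * (B * C - C * B)).trace + (a * (B * C - C * B)).trace + (b * (C * A - A * C)).trace
        + (c * (A * B - B * A)).trace := by
  have e1 : (A * (b * c)).trace = (A * (c * b)).trace := by rw [hbc]
  have e2 : (a * (b * C)).trace = (a * (C * b)).trace := by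
    rw [← Matrix.mul_assoc, hab, Matrix.mul_assoc, Matrix.trace_mul_comm, Matrix.mul_assoc]
  have e3 : (a * (c * B)).trace = (a * (B * c)).trace := by
    rw [← Matrix.mul_assoc, ← hca, Matrix.mul_assoc, Matrix.trace_mul_comm, Matrix.mul_assoc]
  have e4 : (a * (b * c)).trace = (a * (c * b)).trace := by rw [hbc]
  have f1 : (A * (b * C)).trace = (b * (C * A)).trace := by
    rw [Matrix.trace_mul_comm, Matrix.mul_assoc]
  have f2 : (A * (C * b)).trace = (b * (A * C)).trace := by
    rw [← Matrix.mul_assoc, Matrix.trace_mul_comm]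
  have f3 : (A * (c * B)).trace = (c * (B * A)).trace := by
    rw [Matrix.trace_mul_comm, Matrix.mul_assoc]
  have f4 : (A * (B * c)).trace = (c * (A * B)).trace := by
    rw [← Matrix.mul_assoc, Matrix.trace_mul_comm]
  simp only [Matrix.mul_add, Matrix.add_mul, Matrix.mul_sub, Matrix.trace_add, Matrix.trace_sub]
  linear_combination e1 + e2 - e3 + e4 + f1 - f2 - f3 + f4

/-- By flatness the commutator is an antisymmetrized derivative, so its pairing with a constant
matrix is a total derivative. -/
lemma integral_waveMatrix_commutator (hs : SmoothMatrix V) (hu : ∀ θ, (V θ)ᴴ * V θ = 1)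
    (E : Matrix ι ι ℂ) (j k : Fin 3) :
    ∫ θ in cube, (E * (conn V j θ * conn V k θ - conn V k θ * conn V j θ)).trace = 0 := by
  have h := integral_mul_commutator hs hu (E := fun _ => E) (fun a b => SmoothTorus.const _) j k
  simpa only [pderiv_const, Matrix.zero_mul, Matrix.trace_zero, integral_zero, sub_zero] using h

/-- The gauge transformation conjugates the connection and shifts it by constant diagonal matrices.
The shifts commute, and the terms linear in them integrate to zero. -/
lemma windingNumber_mul_modeMatrix (hs : SmoothMatrix V) (hu : ∀ θ, (V θ)ᴴ * V θ = 1)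
    (μ : ι → Fin 3 → ℤ) :
    windingNumber (fun θ => V θ * modeMatrix μ θ) = windingNumber V := by
  have hA := hs.conn
  rw [windingNumber_eq, windingNumber_eq]
  congr 2
  unfold windingIntegral
  simp only [conn_mul_modeMatrix hs hu, trace_conj_commutator (modeMatrix_mul_star μ _),
    trace_shift_commutator _ _ _ _ _ _ (waveMatrix_comm μ 0 1) (waveMatrix_comm μ 1 2)
      (waveMatrix_comm μ 2 0)]
  have hC : ∀ j k, SmoothMatrix fun θ => conn V j θ * conn V k θ - conn V k θ * conn V j θ :=
    fun j k => ((hA j).mul (hA k)).sub ((hA k).mul (hA j))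
  have hE : ∀ (E : Matrix ι ι ℂ) j k, IntegrableOn (fun θ =>
      (E * (conn V j θ * conn V k θ - conn V k θ * conn V j θ)).trace) cube := fun E j k =>
    integrableOn_trace (SmoothMatrix.mul (A := fun _ => E) (fun a b => SmoothTorus.const _) (hC j k))
  have h0 : IntegrableOn (fun θ => (conn V 0 θ *
      (conn V 1 θ * conn V 2 θ - conn V 2 θ * conn V 1 θ)).trace) cube :=
    integrableOn_trace ((hA 0).mul (hC 1 2))
  have h1 : IntegrableOn (fun θ => (conn V 0 θ *
      (conn V 1 θ * conn V 2 θ - conn V 2 θ * conn V 1 θ)).trace + (waveMatrix μ 0 *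
      (conn V 1 θ * conn V 2 θ - conn V 2 θ * conn V 1 θ)).trace) cube :=
    h0.add (hE (waveMatrix μ 0) 1 2)
  have h2 : IntegrableOn (fun θ => (conn V 0 θ *
      (conn V 1 θ * conn V 2 θ - conn V 2 θ * conn V 1 θ)).trace + (waveMatrix μ 0 *
      (conn V 1 θ * conn V 2 θ - conn V 2 θ * conn V 1 θ)).trace + (waveMatrix μ 1 *
      (conn V 2 θ * conn V 0 θ - conn V 0 θ * conn V 2 θ)).trace) cube :=
    h1.add (hE (waveMatrix μ 1) 2 0)
  rw [integral_add h2 (hE (waveMatrix μ 2) 0 1), integral_add h1 (hE (waveMatrix μ 1) 2 0),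
    integral_add h0 (hE (waveMatrix μ 0) 1 2)]
  simp only [integral_waveMatrix_commutator hs hu, add_zero]

/-- Multiplying the quasienergy states by Fourier modes shifts the quasienergies. -/
lemma IsMicromotion.mul_modeMatrix (hV : IsMicromotion d H Ω V ε) (μ : ι → Fin 3 → ℤ) :
    IsMicromotion d H Ω (fun θ => V θ * modeMatrix μ θ)
      (fun α θ => ε α θ - modeFreq Ω (μ α)) where
  smooth := (hV.smooth.smoothMatrix.mul (smoothMatrix_modeMatrix μ)).smoothPeriodic
  unitary θ := Submonoid.mul_mem _ (hV.unitary θ)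
    ((Matrix.mem_unitaryGroup_iff).2 (modeMatrix_mul_star μ θ))
  quasienergy α θ θ' h := by rw [hV.quasienergy α θ θ' h]
  schrodinger θ₀ α t a := by
    have key : ∀ (b : ι) (s : ℝ), Complex.exp (-Complex.I * (ε α θ₀ - modeFreq Ω (μ α) : ℝ) * s) *
        (V (phase Ω θ₀ s) * modeMatrix μ (phase Ω θ₀ s)) b α = fourierMode (μ α) θ₀ *
        (Complex.exp (-Complex.I * ε α θ₀ * s) * V (phase Ω θ₀ s) b α) := fun b s => by
      have e : Complex.exp (-Complex.I * ε α θ₀ * s) =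
          Complex.exp (-Complex.I * (ε α θ₀ - modeFreq Ω (μ α) : ℝ) * s) *
            Complex.exp ((-Complex.I * modeFreq Ω (μ α)) * s) := by
        rw [← Complex.exp_add]
        congr 1
        push_cast
        ring
      rw [modeMatrix, Matrix.mul_diagonal, fourierMode_phase, e]
      ring
    simp only [key]
    refine ((hV.schrodinger θ₀ α t a).const_mul (fourierMode (μ α) θ₀)).congr_deriv ?_
    simp only [Finset.mul_sum]
    refine Finset.sum_congr rfl fun b _ => by ring

end Gauge

/-! ### Exponential weights -/

section Weight

/-- The weight of a hop from `y` to the translate of `x` by `L m`: exponential in the spatial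
distance, polynomial in the drive directions. -/
noncomputable def hopWeight (d L : ℕ) (κ : ℝ) (s : ℕ) (x y m : Fin 3 → ℤ) : ℝ :=
  Real.exp (κ * spatialNorm d (x + L • m - y)) * (1 + driveNorm d m) ^ s

variable {d L : ℕ} {κ : ℝ} {s : ℕ}

lemma spatialNorm_nonneg (d : ℕ) (x : Fin 3 → ℤ) : 0 ≤ spatialNorm d x := norm_nonneg _

lemma driveNorm_nonneg (d : ℕ) (x : Fin 3 → ℤ) : 0 ≤ driveNorm d x := norm_nonneg _

lemma spatialNorm_add_le (d : ℕ) (x y : Fin 3 → ℤ) :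
    spatialNorm d (x + y) ≤ spatialNorm d x + spatialNorm d y := by
  unfold spatialNorm
  refine le_trans (le_of_eq ?_) (norm_add_le _ _)
  congr 1
  funext j
  simp

lemma driveNorm_add_le (d : ℕ) (x y : Fin 3 → ℤ) :
    driveNorm d (x + y) ≤ driveNorm d x + driveNorm d y := by
  unfold driveNorm
  refine le_trans (le_of_eq ?_) (norm_add_le _ _)
  congr 1
  funext j
  simp

lemma spatialNorm_neg (d : ℕ) (x : Fin 3 → ℤ) : spatialNorm d (-x) = spatialNorm d x := by
  unfold spatialNorm
  rw [← norm_neg]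
  congr 1
  funext j
  simp

lemma driveNorm_neg (d : ℕ) (x : Fin 3 → ℤ) : driveNorm d (-x) = driveNorm d x := by
  unfold driveNorm
  rw [← norm_neg]
  congr 1
  funext j
  simp

lemma one_le_hopWeight (hκ : 0 ≤ κ) (x y m : Fin 3 → ℤ) : 1 ≤ hopWeight d L κ s x y m :=
  one_le_mul_of_one_le_of_one_le
    (Real.one_le_exp (mul_nonneg hκ (spatialNorm_nonneg _ _)))
    (one_le_pow₀ (one_le_one_add_driveNorm d m))

lemma hopWeight_nonneg (x y m : Fin 3 → ℤ) : 0 ≤ hopWeight d L κ s x y m :=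
  mul_nonneg (Real.exp_pos _).le
    (pow_nonneg (zero_le_one.trans (one_le_one_add_driveNorm d m)) _)

/-- A hop from `z` to `x + L(m+n)` can pass through `y + Ln`: the displacements add, and the
triangle inequality makes the weight submultiplicative. Hence matrix products preserve the Fourier
bounds. -/
lemma hopWeight_add (hκ : 0 ≤ κ) (x y z m n : Fin 3 → ℤ) :
    hopWeight d L κ s x z (m + n) ≤ hopWeight d L κ s x y m * hopWeight d L κ s y z n := by
  unfold hopWeight
  rw [mul_mul_mul_comm, ← Real.exp_add, ← mul_add, ← mul_pow]
  have h1 : spatialNorm d (x + L • (m + n) - z) ≤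
      spatialNorm d (x + L • m - y) + spatialNorm d (y + L • n - z) := by
    have e : x + L • (m + n) - z = (x + L • m - y) + (y + L • n - z) := by
      rw [smul_add]; abel
    rw [e]
    exact spatialNorm_add_le _ _ _
  have h2 : 1 + driveNorm d (m + n) ≤ (1 + driveNorm d m) * (1 + driveNorm d n) := by
    have := driveNorm_add_le d m n
    have := mul_nonneg (driveNorm_nonneg d m) (driveNorm_nonneg d n)
    linarith
  exact mul_le_mul (Real.exp_le_exp.2 (mul_le_mul_of_nonneg_left h1 hκ))
    (pow_le_pow_left₀ (zero_le_one.trans (one_le_one_add_driveNorm d _)) h2 s)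
    (pow_nonneg (zero_le_one.trans (one_le_one_add_driveNorm d _)) s) (Real.exp_pos _).le

lemma hopWeight_neg (x y m : Fin 3 → ℤ) :
    hopWeight d L κ s y x (-m) = hopWeight d L κ s x y m := by
  unfold hopWeight
  rw [driveNorm_neg, ← spatialNorm_neg]
  congr 4
  rw [smul_neg]
  abel

lemma abs_mul_hopWeight {j : Fin 3} (hj : d ≤ (j : ℕ)) (x y m : Fin 3 → ℤ) :
    |(m j : ℝ)| * hopWeight d L κ s x y m ≤ 1 * hopWeight d L κ (s + 1) x y m := by
  unfold hopWeight
  rw [one_mul, pow_succ, mul_left_comm, mul_comm |(m j : ℝ)|]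
  refine mul_le_mul_of_nonneg_left (mul_le_mul_of_nonneg_left ?_ ?_) (Real.exp_pos _).le
  · linarith [abs_le_driveNorm m hj]
  · exact pow_nonneg (zero_le_one.trans (one_le_one_add_driveNorm d _)) s

lemma hopWeight_le_succ (x y m : Fin 3 → ℤ) :
    hopWeight d L κ s x y m ≤ 1 * hopWeight d L κ (s + 1) x y m := by
  unfold hopWeight
  rw [one_mul]
  exact mul_le_mul_of_nonneg_left
    (pow_le_pow_right₀ (one_le_one_add_driveNorm d m) (Nat.le_succ s)) (Real.exp_pos _).le

/-- For closed paths the weight depends only on the winding, so all diagonal entries of a trace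
share one weight. -/
lemma hopWeight_self (x m : Fin 3 → ℤ) : hopWeight d L κ s x x m = hopWeight d L κ s 0 0 m := by
  unfold hopWeight
  rw [add_sub_cancel_left, zero_add, sub_zero]

end Weight

/-! ### Bounds on the averaged circulation -/

section Estimate

set_option linter.unusedSectionVars false

variable {ι : Type} [Fintype ι] [DecidableEq ι]

/-- Quantitative control of the connection and of the quasienergies of a micromotion operator. -/
structure ConnEstimate (d L : ℕ) (κ : ℝ) (s : ℕ) (V : (Fin 3 → ℝ) → Matrix ι ι ℂ)
    (ε : ι → (Fin 3 → ℝ) → ℝ) (x : ι → Fin 3 → ℤ) (b : Fin 3 → ι → ι → ℝ) (E C P : ℝ) : Prop where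
  rate_nonneg : 0 ≤ κ
  const_nonneg : 0 ≤ C
  pers_nonneg : 0 ≤ P
  bound_conn : ∀ j α β, FourierBound (hopWeight d L κ (s + 1) (x α) (x β))
    (fun θ => conn V j θ α β) (b j α β)
  bound_energy : ∀ α, FourierBound (hopWeight d L κ s (x α) (x α)) (fun θ => (ε α θ : ℂ)) E
  energy_nonneg : 0 ≤ E
  sum_pair : ∀ c : Fin 3, d ≤ (c : ℕ) → ∑ α, ∑ β, b (c + 1) α β * b (c + 2) β α ≤ C
  sum_vec : ∀ j θ a a', ∑ α, ∑ β, ‖V θ a α‖ * b j α β * ‖V θ a' β‖ ≤ C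
  diag_le : ∀ j α, b j α α ≤ C
  sum_pers : ∀ j θ, ∑ α, ‖partialD j (fun θ => (ε α θ : ℂ)) θ‖ ≤ P

variable {d L s : ℕ} {κ : ℝ} {H V : (Fin 3 → ℝ) → Matrix ι ι ℂ} {Ω : Fin 3 → ℝ}
  {ε : ι → (Fin 3 → ℝ) → ℝ} {x : ι → Fin 3 → ℤ} {b : Fin 3 → ι → ι → ℝ} {E C P : ℝ}

lemma norm_trace_mul_le {A B : Matrix ι ι ℂ} {a b : ι → ι → ℝ} (hA : ∀ i j, ‖A i j‖ ≤ a i j)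
    (hB : ∀ i j, ‖B i j‖ ≤ b i j) : ‖(A * B).trace‖ ≤ ∑ i, ∑ j, a i j * b j i := by
  rw [Matrix.trace]
  refine (norm_sum_le _ _).trans (Finset.sum_le_sum fun i _ => ?_)
  rw [Matrix.diag_apply, Matrix.mul_apply]
  refine (norm_sum_le _ _).trans (Finset.sum_le_sum fun j _ => ?_)
  rw [norm_mul]
  exact mul_le_mul (hA i j) (hB j i) (norm_nonneg _) ((norm_nonneg _).trans (hA i j))

lemma norm_trace_diagonal_mul_le {A : Matrix ι ι ℂ} {e : ι → ℂ} {c p : ℝ}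
    (hA : ∀ i, ‖A i i‖ ≤ c) (he : ∑ i, ‖e i‖ ≤ p) (hc : 0 ≤ c) :
    ‖(Matrix.diagonal e * A).trace‖ ≤ p * c := by
  rw [Matrix.trace]
  refine (norm_sum_le _ _).trans (le_trans (Finset.sum_le_sum fun i _ => ?_)
    ((Finset.sum_mul _ _ _).symm.le.trans (mul_le_mul_of_nonneg_right he hc)))
  rw [Matrix.diag_apply, Matrix.diagonal_mul, norm_mul]
  exact mul_le_mul_of_nonneg_left (hA i) (norm_nonneg _)

namespace ConnEstimate

variable (hE : ConnEstimate d L κ s V ε x b E C P)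
include hE

lemma norm_conn_le (j : Fin 3) (θ : Fin 3 → ℝ) (α β : ι) : ‖conn V j θ α β‖ ≤ b j α β :=
  (hE.bound_conn j α β).norm_le (fun _ => one_le_hopWeight hE.rate_nonneg _ _ _) θ

/-- The drift contains drive derivatives only, each costing one power of the weight. This is why the
connection is controlled with exponent `s + 1`. -/
lemma bound_connRate (hΩ : ∀ j : Fin 3, (j : ℕ) < d → Ω j = 0) (j : Fin 3) (α β : ι) :
    FourierBound (hopWeight d L κ s (x α) (x β)) (fun θ => connRate Ω V ε j θ α β)
      ((2 * E + ∑ l, |Ω l|) * b j α β) := by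
  have hw : ∀ x y m, 1 ≤ hopWeight d L κ s x y m := one_le_hopWeight hE.rate_nonneg
  have h0 : FourierBound (hopWeight d L κ s (x α) (x β)) (fun θ => conn V j θ α β) (b j α β) :=
    (hE.bound_conn j α β).mono (fun _ => hopWeight_nonneg _ _ _) (hopWeight_le_succ _ _)
      zero_le_one (one_mul _).le
  have h1 := (hE.bound_energy α).mul h0 (hw _ _) (hw _ _)
    (w := hopWeight d L κ s (x α) (x β)) (fun _ => hopWeight_nonneg _ _ _)
    (hopWeight_add hE.rate_nonneg _ _ _)
  have h2 := h0.mul (hE.bound_energy β) (hw _ _) (hw _ _)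
    (w := hopWeight d L κ s (x α) (x β)) (fun _ => hopWeight_nonneg _ _ _)
    (hopWeight_add hE.rate_nonneg _ _ _)
  have h3 : ∀ l, FourierBound (hopWeight d L κ s (x α) (x β))
      (fun θ => (Ω l : ℂ) * partialD l (fun θ => conn V j θ α β) θ) (|Ω l| * b j α β) := fun l => by
    by_cases hl : (l : ℕ) < d
    · simpa [hΩ l hl] using FourierBound.zero (hopWeight d L κ s (x α) (x β))
    · have := ((hE.bound_conn j α β).partialD l (hw _ _)
        (abs_mul_hopWeight (not_lt.1 hl) _ _) zero_le_one).const_mul (Ω l : ℂ)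
      simpa using this
  have h4 := ((h1.sub (hw _ _) h2).const_mul Complex.I).add (hw _ _)
    (FourierBound.sum (hw _ _) h3)
  rw [Complex.norm_I, one_mul, ← Finset.sum_mul] at h4
  have e : (fun θ => connRate Ω V ε j θ α β) = fun θ =>
      Complex.I * ((ε α θ : ℂ) * conn V j θ α β - conn V j θ α β * (ε β θ : ℂ)) +
        ∑ l, (Ω l : ℂ) * partialD l (fun θ => conn V j θ α β) θ := funext fun θ => by
    simp [connRate, energyMatrix, driftM_apply, driftD]
  rw [e]
  exact h4.le_bound (le_of_eq (by ring))

lemma bound_trace (hΩ : ∀ j : Fin 3, (j : ℕ) < d → Ω j = 0) (j k : Fin 3) :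
    FourierBound (hopWeight d L κ s 0 0) (fun θ => (conn V j θ * connRate Ω V ε k θ).trace)
      ((2 * E + ∑ l, |Ω l|) * ∑ α, ∑ β, b j α β * b k β α) := by
  have hw : ∀ x y m, 1 ≤ hopWeight d L κ s x y m := one_le_hopWeight hE.rate_nonneg
  have h : ∀ α β, FourierBound (hopWeight d L κ s 0 0)
      (fun θ => conn V j θ α β * connRate Ω V ε k θ β α)
      (b j α β * ((2 * E + ∑ l, |Ω l|) * b k β α)) := fun α β => by
    have h0 : FourierBound (hopWeight d L κ s (x α) (x β)) (fun θ => conn V j θ α β) (b j α β) :=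
      (hE.bound_conn j α β).mono (fun _ => hopWeight_nonneg _ _ _) (hopWeight_le_succ _ _)
        zero_le_one (one_mul _).le
    refine h0.mul (hE.bound_connRate hΩ k β α) (hw _ _) (hw _ _)
      (fun _ => hopWeight_nonneg _ _ _) fun m n => ?_
    rw [← hopWeight_self (x α)]
    exact hopWeight_add hE.rate_nonneg _ _ _ _ _
  have h1 := FourierBound.sum (hw 0 0) fun α => FourierBound.sum (hw 0 0) (h α)
  simp only [Matrix.trace, Matrix.diag_apply, Matrix.mul_apply]
  refine h1.le_bound (le_of_eq ?_)
  simp only [Finset.mul_sum]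
  exact Finset.sum_congr rfl fun α _ => Finset.sum_congr rfl fun β _ => by ring

lemma sum_pair' (c : Fin 3) (hc : d ≤ (c : ℕ)) : ∑ α, ∑ β, b (c + 2) α β * b (c + 1) β α ≤ C := by
  rw [Finset.sum_comm]
  refine le_trans (le_of_eq ?_) (hE.sum_pair c hc)
  exact Finset.sum_congr rfl fun α _ => Finset.sum_congr rfl fun β _ => mul_comm _ _

/-- The quasi-periodic part of the circulation has a summable Fourier series. -/
lemma bound_planeSum (hΩ : ∀ j : Fin 3, (j : ℕ) < d → Ω j = 0) :
    FourierBound (hopWeight d L κ s 0 0) (fun θ => planeSum Ω fun j k => curvPair Ω V ε j k θ)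
      ((∑ c, |Ω c|) * (2 * (2 * E + ∑ l, |Ω l|) * C)) := by
  have hw : ∀ x y m, 1 ≤ hopWeight d L κ s x y m := one_le_hopWeight hE.rate_nonneg
  have hR : 0 ≤ 2 * E + ∑ l, |Ω l| := add_nonneg (mul_nonneg zero_le_two hE.energy_nonneg)
    (Finset.sum_nonneg fun _ _ => abs_nonneg _)
  rw [Finset.sum_mul]
  refine FourierBound.sum (hw 0 0) fun c => ?_
  -- Planes normal to a spatial direction carry zero frequency; only for the others is the pair sum
  -- under control.
  by_cases hc : (c : ℕ) < d
  · simpa [hΩ c hc] using FourierBound.zero (hopWeight d L κ s 0 0)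
  · have h1 := ((hE.bound_trace hΩ (c + 1) (c + 2)).sub (hw 0 0)
      (hE.bound_trace hΩ (c + 2) (c + 1))).const_mul (Ω c : ℂ)
    rw [Complex.norm_real, Real.norm_eq_abs, ← mul_add] at h1
    refine h1.le_bound (mul_le_mul_of_nonneg_left ?_ (abs_nonneg _))
    have h2 := mul_le_mul_of_nonneg_left (add_le_add (hE.sum_pair c (not_lt.1 hc))
      (hE.sum_pair' c (not_lt.1 hc))) hR
    exact h2.trans (le_of_eq (by ring))

end ConnEstimate

end Estimate

/-! ### Boundary terms, persistent currents and the deviation from quantization. -/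

section Deviation

set_option linter.unusedSectionVars false

variable {ι : Type} [Fintype ι] [DecidableEq ι]
  {d L s : ℕ} {κ : ℝ} {H V : (Fin 3 → ℝ) → Matrix ι ι ℂ} {Ω : Fin 3 → ℝ}
  {ε : ι → (Fin 3 → ℝ) → ℝ} {U : (Fin 3 → ℝ) → ℝ → Matrix ι ι ℂ}
  {x : ι → Fin 3 → ℤ} {b : Fin 3 → ι → ι → ℝ} {E C P : ℝ}

lemma norm_timeMean_le (Ω θ₀ : Fin 3 → ℝ) {f : (Fin 3 → ℝ) → ℂ} {M T : ℝ} (hT : 0 < T)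
    (h : ∀ θ, ‖f θ‖ ≤ M) : ‖timeMean Ω θ₀ f T‖ ≤ M := by
  rw [timeMean, norm_mul]
  have h1 : ‖∫ t in (0 : ℝ)..T, f (phase Ω θ₀ t)‖ ≤ M * |T - 0| :=
    intervalIntegral.norm_integral_le_of_norm_le_const fun t _ => h _
  rw [sub_zero, abs_of_pos hT] at h1
  have h2 : ‖(1 / T : ℂ)‖ = 1 / T := by
    rw [norm_div, norm_one, Complex.norm_real, Real.norm_of_nonneg hT.le]
  rw [h2, one_div_mul_eq_div, div_le_iff₀ hT]
  exact h1

lemma norm_torusMean_le {f : (Fin 3 → ℝ) → ℂ} {M : ℝ} (h : ∀ θ, ‖f θ‖ ≤ M) :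
    ‖torusMean f‖ ≤ M := by
  have hpi : (0 : ℝ) < (2 * Real.pi) ^ 3 := by positivity
  have h1 := norm_setIntegral_le_of_norm_le_const (μ := volume) (s := cube) (f := f) (C := M)
    isCompact_Icc.measure_lt_top (fun θ _ => h θ)
  rw [Measure.real, volume_cube] at h1
  have h2 : ‖(1 / (2 * Real.pi) ^ 3 : ℂ)‖ = 1 / (2 * Real.pi) ^ 3 := by
    have : (1 / (2 * Real.pi) ^ 3 : ℂ) = ((1 / (2 * Real.pi) ^ 3 : ℝ) : ℂ) := by push_cast; rfl
    rw [this, Complex.norm_real, Real.norm_of_nonneg (by positivity)]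
  rw [torusMean, norm_mul, h2, one_div_mul_eq_div, div_le_iff₀ hpi]
  exact h1

lemma norm_planeSum_le (hΩ : ∀ j : Fin 3, (j : ℕ) < d → Ω j = 0) {y : Fin 3 → Fin 3 → ℂ} {M : ℝ}
    (h : ∀ c : Fin 3, d ≤ (c : ℕ) → ‖y (c + 1) (c + 2)‖ ≤ M) :
    ‖planeSum Ω y‖ ≤ (∑ c, |Ω c|) * M := by
  rw [planeSum, Finset.sum_mul]
  refine (norm_sum_le _ _).trans (Finset.sum_le_sum fun c _ => ?_)
  rw [norm_mul, Complex.norm_real, Real.norm_eq_abs]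
  by_cases hc : (c : ℕ) < d
  · simp [hΩ c hc]
  · exact mul_le_mul_of_nonneg_left (h c (not_lt.1 hc)) (abs_nonneg _)

lemma norm_exp_energy (e t : ℝ) : ‖Complex.exp (-Complex.I * e * t)‖ = 1 := by
  rw [← Complex.norm_exp_ofReal_mul_I (-(e * t))]
  congr 2
  push_cast
  ring

lemma norm_frame_apply (V : (Fin 3 → ℝ) → Matrix ι ι ℂ) (ε : ι → (Fin 3 → ℝ) → ℝ)
    (θ₀ : Fin 3 → ℝ) (t : ℝ) (α a : ι) : ‖frame V ε θ₀ t α a‖ = ‖V θ₀ a α‖ := by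
  rw [frame, Matrix.diagonal_mul, norm_mul, norm_exp_energy, one_mul,
    Matrix.conjTranspose_apply, norm_star]

lemma frame_zero (V : (Fin 3 → ℝ) → Matrix ι ι ℂ) (ε : ι → (Fin 3 → ℝ) → ℝ) (θ₀ : Fin 3 → ℝ) :
    frame V ε θ₀ 0 = (V θ₀)ᴴ := by
  simp [frame]

lemma norm_entry_le_size (n₀ : Fin 3 → Matrix ι ι ℂ) (j : Fin 3) :
    ∑ a, ∑ a', ‖n₀ j a a'‖ ≤ size n₀ :=
  Finset.single_le_sum (f := fun j => ∑ a, ∑ a', ‖n₀ j a a'‖)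
    (fun _ _ => Finset.sum_nonneg fun _ _ => Finset.sum_nonneg fun _ _ => norm_nonneg _)
    (Finset.mem_univ j)

lemma size_nonneg (n₀ : Fin 3 → Matrix ι ι ℂ) : 0 ≤ size n₀ :=
  Finset.sum_nonneg fun _ _ => Finset.sum_nonneg fun _ _ => Finset.sum_nonneg fun _ _ =>
    norm_nonneg _

lemma norm_trace_position_mul_le (n₀ : Fin 3 → Matrix ι ι ℂ) (j : Fin 3) {A : Matrix ι ι ℂ}
    {M : ℝ} (hM : 0 ≤ M) (hA : ∀ a a', ‖A a a'‖ ≤ M) : ‖(n₀ j * A).trace‖ ≤ size n₀ * M := by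
  refine (norm_trace_mul_le (fun _ _ => le_rfl) hA).trans ?_
  simp only [← Finset.sum_mul]
  exact mul_le_mul_of_nonneg_right (norm_entry_le_size n₀ j) hM

namespace ConnEstimate

variable (hE : ConnEstimate d L κ s V ε x b E C P)
include hE

/-- Time enters the frame only through phases of modulus one, so the estimate is uniform in time. -/
lemma norm_heisConn_le (Ω θ₀ : Fin 3 → ℝ) (j : Fin 3) (t : ℝ) (a a' : ι) :
    ‖heisConn Ω V ε θ₀ j t a a'‖ ≤ C := by
  refine le_trans ?_ (hE.sum_vec j θ₀ a a')
  rw [heisConn, Matrix.mul_apply]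
  simp only [Matrix.mul_apply, Finset.sum_mul]
  rw [Finset.sum_comm]
  refine (norm_sum_le _ _).trans (Finset.sum_le_sum fun α _ =>
    (norm_sum_le _ _).trans (Finset.sum_le_sum fun β _ => ?_))
  rw [norm_mul, norm_mul, Matrix.conjTranspose_apply, norm_star, norm_frame_apply,
    norm_frame_apply]
  exact mul_le_mul_of_nonneg_right
    (mul_le_mul_of_nonneg_left (hE.norm_conn_le j _ α β) (norm_nonneg _)) (norm_nonneg _)

/-- The frames at times `0` and `t` differ by a diagonal unitary, which leaves the absolute values
of the entries of the connection unchanged. The trace in the state basis is thus bounded by the pair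
sum, without a volume factor. -/
lemma norm_trace_heisConn_mul_le (hV : IsMicromotion d H Ω V ε) (θ₀ : Fin 3 → ℝ) (j k : Fin 3)
    (t : ℝ) : ‖(heisConn Ω V ε θ₀ j 0 * heisConn Ω V ε θ₀ k t).trace‖ ≤
      ∑ α, ∑ β, b j α β * b k β α := by
  set D : Matrix ι ι ℂ := Matrix.diagonal fun α => Complex.exp (-Complex.I * ε α θ₀ * t) with hD
  have h1 : heisConn Ω V ε θ₀ k t = (frame V ε θ₀ 0)ᴴ *
      (Dᴴ * conn V k (phase Ω θ₀ t) * D) * frame V ε θ₀ 0 := by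
    rw [heisConn, frame_zero, frame, ← hD, Matrix.conjTranspose_mul]
    simp only [Matrix.mul_assoc]
  rw [h1, heisConn, trace_conj_mul_conj hV]
  refine norm_trace_mul_le (fun α β => hE.norm_conn_le j _ α β) fun α β => ?_
  rw [hD, Matrix.mul_diagonal, Matrix.diagonal_conjTranspose, Matrix.diagonal_mul, norm_mul,
    norm_mul, Pi.star_apply, norm_star, norm_exp_energy, norm_exp_energy, one_mul, mul_one]
  exact hE.norm_conn_le k _ α β

lemma norm_persistent_le (hV : IsMicromotion d H Ω V ε) (θ₀ : Fin 3 → ℝ) (j : Fin 3) (a a' : ι) :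
    ‖persistent V ε θ₀ j a a'‖ ≤ P := by
  refine le_trans ?_ (hE.sum_pers j θ₀)
  rw [persistent, pderiv_energyMatrix, Matrix.mul_apply]
  refine (norm_sum_le _ _).trans (Finset.sum_le_sum fun α _ => ?_)
  rw [Matrix.mul_diagonal, norm_mul, norm_mul, Matrix.conjTranspose_apply, norm_star]
  have h1 := entry_norm_bound_of_unitary (hV.unitary θ₀)
  calc _ ≤ 1 * ‖partialD j (fun θ => (ε α θ : ℂ)) θ₀‖ * 1 :=
        mul_le_mul (mul_le_mul_of_nonneg_right (h1 a α) (norm_nonneg _)) (h1 a' α)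
          (norm_nonneg _) (mul_nonneg zero_le_one (norm_nonneg _))
    _ = _ := by rw [one_mul, mul_one]

lemma norm_trace_pers_le (θ : Fin 3 → ℝ) (j k : Fin 3) :
    ‖(pderiv j (energyMatrix ε) θ * conn V k θ).trace‖ ≤ P * C := by
  rw [pderiv_energyMatrix]
  exact norm_trace_diagonal_mul_le (fun α => (hE.norm_conn_le k θ α α).trans (hE.diag_le k α))
    (hE.sum_pers j θ) hE.const_nonneg

lemma norm_persPair_le (θ : Fin 3 → ℝ) (j k : Fin 3) : ‖persPair V ε j k θ‖ ≤ 2 * (P * C) := by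
  rw [persPair, two_mul]
  exact (norm_sub_le _ _).trans
    (add_le_add (hE.norm_trace_pers_le θ j k) (hE.norm_trace_pers_le θ k j))

/-- The terms growing with `t` all contain the persistent-current bound `P`. Division by `T` leaves
a contribution of order `1/T` from the bounded terms and one of order `P`. -/
lemma norm_boundaryPair_le (hV : IsMicromotion d H Ω V ε)
    (hΩ : ∀ j : Fin 3, (j : ℕ) < d → Ω j = 0) (n₀ : Fin 3 → Matrix ι ι ℂ) (θ₀ : Fin 3 → ℝ)
    {c : Fin 3} (hc : d ≤ (c : ℕ)) {t : ℝ} (ht : 0 ≤ t) :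
    ‖boundaryPair Ω V ε n₀ θ₀ (c + 1) (c + 2) t‖ ≤
      2 * (size n₀ * C + C) + t * (2 * (P * C)) + t * (2 * (size n₀ * P + P * C)) := by
  have p1 : ∀ j k, ‖(persistent V ε θ₀ j * heisConn Ω V ε θ₀ k t).trace‖ ≤ P * C := fun j k => by
    rw [hV.trace_persistent_mul hΩ]
    exact hE.norm_trace_pers_le _ j k
  have p2 : ∀ j k, ‖((n₀ j + Complex.I • heisConn Ω V ε θ₀ j 0) *
      persistent V ε θ₀ k).trace‖ ≤ size n₀ * P + P * C := fun j k => by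
    rw [Matrix.add_mul, Matrix.trace_add, Matrix.smul_mul, Matrix.trace_smul]
    refine (norm_add_le _ _).trans (add_le_add
      (norm_trace_position_mul_le n₀ j hE.pers_nonneg (hE.norm_persistent_le hV θ₀ k)) ?_)
    rw [norm_smul, Complex.norm_I, one_mul, Matrix.trace_mul_comm, hV.trace_persistent_mul hΩ]
    exact hE.norm_trace_pers_le _ k j
  have p3 : ∀ j k, ∑ α, ∑ β, b j α β * b k β α ≤ C →
      ‖((n₀ j + Complex.I • heisConn Ω V ε θ₀ j 0) * heisConn Ω V ε θ₀ k t).trace‖ ≤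
        size n₀ * C + C := fun j k h => by
    rw [Matrix.add_mul, Matrix.trace_add, Matrix.smul_mul, Matrix.trace_smul]
    refine (norm_add_le _ _).trans (add_le_add
      (norm_trace_position_mul_le n₀ j hE.const_nonneg (hE.norm_heisConn_le Ω θ₀ k t)) ?_)
    rw [norm_smul, Complex.norm_I, one_mul]
    exact (hE.norm_trace_heisConn_mul_le hV θ₀ j k t).trans h
  have s2 : ∀ {a b : ℂ} {M : ℝ}, ‖a‖ ≤ M → ‖b‖ ≤ M → ‖a - b‖ ≤ 2 * M := fun ha hb => by
    rw [two_mul]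
    exact (norm_sub_le _ _).trans (add_le_add ha hb)
  have ht' : ‖(t : ℂ)‖ = t := by rw [Complex.norm_real, Real.norm_of_nonneg ht]
  rw [boundaryPair]
  refine (norm_sub_le _ _).trans (add_le_add ((norm_add_le _ _).trans (add_le_add ?_ ?_)) ?_)
  · rw [norm_mul, norm_neg, Complex.norm_I, one_mul]
    exact s2 (p3 _ _ (hE.sum_pair c hc)) (p3 _ _ (hE.sum_pair' c hc))
  · rw [norm_mul, Complex.norm_I, one_mul, norm_mul, ht']
    exact mul_le_mul_of_nonneg_left (s2 (p1 _ _) (p1 _ _)) ht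
  · rw [norm_mul, ht']
    exact mul_le_mul_of_nonneg_left (s2 (p2 _ _) (p2 _ _)) ht

end ConnEstimate

lemma planeSum_sub (Ω : Fin 3 → ℝ) (y z : Fin 3 → Fin 3 → ℂ) :
    planeSum Ω (fun j k => y j k - z j k) = planeSum Ω y - planeSum Ω z := by
  simp only [planeSum, mul_sub, Finset.sum_sub_distrib]

lemma planeSum_const_mul (Ω : Fin 3 → ℝ) (r : ℂ) (y : Fin 3 → Fin 3 → ℂ) :
    planeSum Ω (fun j k => r * y j k) = r * planeSum Ω y := by
  simp only [planeSum, Finset.mul_sum]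
  exact Finset.sum_congr rfl fun c _ => by ring

lemma IsMicromotion.smoothTorus_curvPair (hV : IsMicromotion d H Ω V ε) (hH : IsHamiltonian H)
    (j k : Fin 3) : SmoothTorus (curvPair Ω V ε j k) :=
  ((hV.smoothMatrix_conn j).mul (hV.smoothMatrix_connRate hH k)).trace.sub
    ((hV.smoothMatrix_conn k).mul (hV.smoothMatrix_connRate hH j)).trace

lemma timeMean_planeSum (Ω θ₀ : Fin 3 → ℝ) (T : ℝ) {f : Fin 3 → Fin 3 → (Fin 3 → ℝ) → ℂ}
    (hf : ∀ j k, Continuous (f j k)) : timeMean Ω θ₀ (fun θ => planeSum Ω fun j k => f j k θ) T =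
      planeSum Ω fun j k => timeMean Ω θ₀ (f j k) T := by
  simp only [timeMean, planeSum]
  rw [intervalIntegral.integral_finsetSum]
  · simp only [intervalIntegral.integral_const_mul, Finset.mul_sum]
    exact Finset.sum_congr rfl fun c _ => by ring
  · exact fun c _ => (continuous_const.mul
      ((hf _ _).comp (continuous_phase Ω θ₀))).intervalIntegrable _ _

lemma torusMean_planeSum (Ω : Fin 3 → ℝ) {f : Fin 3 → Fin 3 → (Fin 3 → ℝ) → ℂ}
    (hf : ∀ j k, Continuous (f j k)) : torusMean (fun θ => planeSum Ω fun j k => f j k θ) =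
      planeSum Ω fun j k => torusMean (f j k) := by
  simp only [torusMean, planeSum]
  rw [integral_finsetSum]
  · simp only [integral_const_mul, Finset.mul_sum]
    exact Finset.sum_congr rfl fun c _ => by ring
  · exact fun c _ => (SmoothTorus.integrableOn (hf _ _)).const_mul _

/-- The deviation from quantization is controlled by the boundary terms, the persistent currents,
and the convergence of the time average of the quasi-periodic part of the circulation. -/
lemma ConnEstimate.deviation_le (hE : ConnEstimate d L κ s V ε x b E C P)
    (hV : IsMicromotion d H Ω V ε) (hH : IsHamiltonian H) (hU : IsEvolution H Ω U)
    (hΩ : ∀ j : Fin 3, (j : ℕ) < d → Ω j = 0) (hΩ0 : freqNorm Ω ≠ 0)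
    (n₀ : Fin 3 → Matrix ι ι ℂ) (θ₀ : Fin 3 → ℝ) {T : ℝ} (hT : 0 < T) :
    deviation H Ω V U n₀ θ₀ T ≤ 1 / (2 * freqNorm Ω) *
      ((∑ c, |Ω c|) * (4 * C * (1 + size n₀) * T⁻¹ + 12 * P * (1 + C) * (1 + size n₀)) +
        ‖timeMean Ω θ₀ (fun θ => planeSum Ω fun j k => curvPair Ω V ε j k θ) T -
          torusMean fun θ => planeSum Ω fun j k => curvPair Ω V ε j k θ‖) := by
  have hT' : (T : ℂ) ≠ 0 := by exact_mod_cast hT.ne'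
  have hΩ' : (freqNorm Ω : ℂ) ≠ 0 := by exact_mod_cast hΩ0
  have hcurv := fun j k => (IsMicromotion.smoothTorus_curvPair hV hH j k).continuous
  have h1 := hV.timeAverage_eq hH hU hΩ n₀ θ₀ T _ rfl
  have h2 := hV.quantized_eq hH hΩ0 _ rfl
  simp only [hV.integral_pair hH hU hΩ n₀ θ₀ T, planeSum_sub, planeSum_const_mul] at h1
  rw [deviation, h1, h2, timeMean_planeSum Ω θ₀ T hcurv, torusMean_planeSum Ω hcurv]
  have key : ∀ z w : ℂ, ‖z + star z - (w + star w)‖ ≤ 2 * ‖z - w‖ := fun z w => by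
    have : z + star z - (w + star w) = (z - w) + star (z - w) := by rw [star_sub]; ring
    rw [this, two_mul]
    exact (norm_add_le _ _).trans (by rw [norm_star])
  refine (key _ _).trans ?_
  have e1 : ∀ f : Fin 3 → Fin 3 → (Fin 3 → ℝ) → ℂ, planeSum Ω (fun j k =>
      ∫ t in (0 : ℝ)..T, f j k (phase Ω θ₀ t)) = T * planeSum Ω fun j k =>
        timeMean Ω θ₀ (f j k) T := fun f => by
    rw [← planeSum_const_mul]
    simp only [timeMean, ← mul_assoc, mul_one_div_cancel hT', one_mul]
  have e2 : ∀ f : Fin 3 → Fin 3 → (Fin 3 → ℝ) → ℂ, (1 / (2 * Real.pi) ^ 3 : ℂ) *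
      planeSum Ω (fun j k => ∫ θ in cube, f j k θ) = planeSum Ω fun j k =>
        torusMean (f j k) := fun f => by
    rw [← planeSum_const_mul]
    rfl
  rw [e1, e1, mul_add, e2, mul_left_comm _ (2 * Complex.I), e2]
  -- Here `b` stands for boundary terms, `c` for averages of `curvPair` and `p` for averages of
  -- `persPair`; each pair is compared separately.
  have e3 : ∀ b₁ b₂ c₁ c₂ p₁ p₂ : ℂ, (1 / (4 * freqNorm Ω * T) : ℂ) *
      (b₁ - b₂ - T * c₁ - 2 * Complex.I * (T * p₁)) -
      -(1 / (4 * freqNorm Ω) : ℂ) * (c₂ + 2 * Complex.I * p₂) =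
      (1 / (4 * freqNorm Ω) : ℂ) * ((1 / T : ℂ) * (b₁ - b₂) - 2 * Complex.I * (p₁ - p₂)
        - (c₁ - c₂)) := fun b₁ b₂ c₁ c₂ p₁ p₂ => by
    field_simp
    ring
  rw [e3, norm_mul]
  have hn := size_nonneg n₀
  have hf : 0 < freqNorm Ω := lt_of_le_of_ne (Real.sqrt_nonneg _) (Ne.symm hΩ0)
  have hn1 : ‖(1 / (4 * freqNorm Ω) : ℂ)‖ = 1 / (4 * freqNorm Ω) := by
    have : (1 / (4 * freqNorm Ω) : ℂ) = ((1 / (4 * freqNorm Ω) : ℝ) : ℂ) := by push_cast; rfl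
    rw [this, Complex.norm_real, Real.norm_of_nonneg (by positivity)]
  have hn2 : ‖(1 / T : ℂ)‖ = T⁻¹ := by
    rw [norm_div, norm_one, Complex.norm_real, Real.norm_of_nonneg hT.le, one_div]
  have hb : ‖(1 / T : ℂ) * (planeSum Ω (fun j k => boundaryPair Ω V ε n₀ θ₀ j k T) -
      planeSum Ω fun j k => boundaryPair Ω V ε n₀ θ₀ j k 0)‖ ≤ (∑ c, |Ω c|) *
      (4 * C * (1 + size n₀) * T⁻¹ + (4 * (P * C) + 2 * (size n₀ * P))) := by
    rw [norm_mul, hn2, ← planeSum_sub]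
    have := norm_planeSum_le hΩ (y := fun j k => boundaryPair Ω V ε n₀ θ₀ j k T -
      boundaryPair Ω V ε n₀ θ₀ j k 0) fun c hc => (norm_sub_le _ _).trans (add_le_add
        (hE.norm_boundaryPair_le hV hΩ n₀ θ₀ hc hT.le)
        (hE.norm_boundaryPair_le hV hΩ n₀ θ₀ hc le_rfl))
    refine (mul_le_mul_of_nonneg_left this (inv_pos.2 hT).le).trans (le_of_eq ?_)
    field_simp
    ring
  have hp : ‖2 * Complex.I * (planeSum Ω (fun j k => timeMean Ω θ₀ (persPair V ε j k) T) -
      planeSum Ω fun j k => torusMean (persPair V ε j k))‖ ≤ (∑ c, |Ω c|) * (8 * (P * C)) := by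
    rw [norm_mul, norm_mul, Complex.norm_I, mul_one, ← planeSum_sub]
    have := norm_planeSum_le hΩ (y := fun j k => timeMean Ω θ₀ (persPair V ε j k) T -
      torusMean (persPair V ε j k)) fun c hc => (norm_sub_le _ _).trans (add_le_add
        (norm_timeMean_le Ω θ₀ hT fun θ => hE.norm_persPair_le θ _ _)
        (norm_torusMean_le fun θ => hE.norm_persPair_le θ _ _))
    have h2n : ‖(2 : ℂ)‖ = 2 := by simp
    rw [h2n]
    refine (mul_le_mul_of_nonneg_left this zero_le_two).trans (le_of_eq ?_)
    ring
  have htot := (norm_sub_le _ _).trans (add_le_add_left ((norm_sub_le _ _).trans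
    (add_le_add hb hp)) ‖planeSum Ω (fun j k => timeMean Ω θ₀ (curvPair Ω V ε j k) T) -
      planeSum Ω fun j k => torusMean (curvPair Ω V ε j k)‖)
  have hω : 0 ≤ ∑ c, |Ω c| := Finset.sum_nonneg fun _ _ => abs_nonneg _
  have hPC := mul_nonneg hE.pers_nonneg hE.const_nonneg
  -- The `12` collects `4PC` from the boundary terms and `8PC` from the two averages of `persPair`.
  have hlast : (∑ c, |Ω c|) * (4 * C * (1 + size n₀) * T⁻¹ + (4 * (P * C) + 2 * (size n₀ * P))) +
      (∑ c, |Ω c|) * (8 * (P * C)) ≤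
      (∑ c, |Ω c|) * (4 * C * (1 + size n₀) * T⁻¹ + 12 * P * (1 + C) * (1 + size n₀)) := by
    rw [← mul_add]
    refine mul_le_mul_of_nonneg_left ?_ hω
    have := mul_nonneg hE.pers_nonneg hn
    have := mul_nonneg hPC hn
    have := hE.pers_nonneg
    nlinarith
  calc _ = 1 / (2 * freqNorm Ω) * _ := by
        rw [hn1, ← mul_assoc]
        congr 1
        field_simp
        ring
    _ ≤ _ := mul_le_mul_of_nonneg_left (htot.trans (add_le_add_left hlast _)) (by positivity)

end Deviation

/-! ### Incommensurate and Diophantine frequencies -/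

section Frequencies

variable {d : ℕ} {Ω : Fin 3 → ℝ}

/-- The drive components of an integer vector. -/
def drivePart (d : ℕ) (m : Fin 3 → ℤ) : Fin 3 → ℤ := fun j => if (j : ℕ) < d then 0 else m j

lemma modeFreq_eq_drivePart (hΩ : ∀ j : Fin 3, (j : ℕ) < d → Ω j = 0) (m : Fin 3 → ℤ) :
    modeFreq Ω m = ∑ j, (drivePart d m j : ℝ) * Ω j := by
  refine Finset.sum_congr rfl fun j _ => ?_
  by_cases h : (j : ℕ) < d
  · simp [hΩ j h]
  · simp [drivePart, h]

lemma Incommensurate.freqNorm_pos (h : Incommensurate d Ω) (hd : d ≤ 2) : 0 < freqNorm Ω := by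
  refine Real.sqrt_pos.2 (lt_of_le_of_ne (Finset.sum_nonneg fun _ _ => sq_nonneg _) fun h0 => ?_)
  have h1 : ∀ j, Ω j = 0 := fun j => pow_eq_zero_iff two_ne_zero |>.1
    ((Finset.sum_eq_zero_iff_of_nonneg fun j _ => sq_nonneg (Ω j)).1 h0.symm j (Finset.mem_univ j))
  -- With `d ≤ 2` the last direction is always a drive, so its unit vector is an admissible test
  -- vector.
  have h2 := h.2 (Pi.single 2 1) (fun j hj => ?_) (by simp [h1])
  · exact one_ne_zero (α := ℤ) (by simpa using congrFun h2 2)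
  · refine Pi.single_eq_of_ne (fun e => ?_) _
    subst e
    exact absurd hj (not_lt.2 hd)

lemma Incommensurate.eq_zero_of_modeFreq (h : Incommensurate d Ω) {m : Fin 3 → ℤ}
    (hm : modeFreq Ω m = 0) {j : Fin 3} (hj : d ≤ (j : ℕ)) : m j = 0 := by
  rw [modeFreq_eq_drivePart h.1] at hm
  have := congrFun (h.2 (drivePart d m) (fun j hj => by simp [drivePart, hj]) hm) j
  simpa [drivePart, not_lt.2 hj] using this

/-- Incommensurability forces the drive components of a resonance to vanish, so it must wind around
a spatial direction. -/
lemma Incommensurate.exists_spatial_ne_zero (h : Incommensurate d Ω) {m : Fin 3 → ℤ} (hm0 : m ≠ 0)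
    (hm : modeFreq Ω m = 0) : ∃ j : Fin 3, (j : ℕ) < d ∧ m j ≠ 0 := by
  by_contra! hc
  refine hm0 (funext fun j => ?_)
  by_cases hj : (j : ℕ) < d
  · exact hc j hj
  · exact h.eq_zero_of_modeFreq hm (not_lt.1 hj)

/-- The small divisor depends only on the drive components of `m`, whose power `τ` is dominated by
the polynomial factor of the weight. The constants come from `Ω` alone and serve all `L` and `κ`. -/
lemma Diophantine.exists_inv_modeFreq_le (h : Diophantine d Ω) : ∃ D : ℝ, 0 ≤ D ∧ ∃ τ : ℕ,
    ∀ (L : ℕ) (κ : ℝ) (_ : 0 ≤ κ) (m : Fin 3 → ℤ), modeFreq Ω m ≠ 0 →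
      |modeFreq Ω m|⁻¹ ≤ D * hopWeight d L κ τ 0 0 m := by
  obtain ⟨hΩ, γ, hγ, τ, h⟩ := h
  refine ⟨γ⁻¹, (inv_pos.2 hγ).le, τ, fun L κ hκ m hm => ?_⟩
  have hpos : 0 < |modeFreq Ω m| := abs_pos.2 hm
  have hk0 : drivePart d m ≠ 0 := fun e => hm (by simp [modeFreq_eq_drivePart hΩ, e])
  have h1 := h (drivePart d m) (fun j hj => by simp [drivePart, hj]) hk0
  rw [← modeFreq_eq_drivePart hΩ] at h1
  have h2 : ‖fun j => (drivePart d m j : ℝ)‖ ≤ 1 + driveNorm d m := by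
    refine (pi_norm_le_iff_of_nonneg (by linarith [driveNorm_nonneg d m])).2 fun j => ?_
    by_cases hj : (j : ℕ) < d
    · simpa [drivePart, hj] using (by linarith [driveNorm_nonneg d m] : 0 ≤ 1 + driveNorm d m)
    · have := abs_le_driveNorm m (not_lt.1 hj)
      simp only [drivePart, hj, if_false, Real.norm_eq_abs]
      linarith
  have h3 : ‖fun j => (drivePart d m j : ℝ)‖ ^ τ ≤ hopWeight d L κ τ 0 0 m :=
    (pow_le_pow_left₀ (norm_nonneg _) h2 τ).trans (le_mul_of_one_le_left
      (pow_nonneg (zero_le_one.trans (one_le_one_add_driveNorm d m)) _)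
      (Real.one_le_exp (mul_nonneg hκ (spatialNorm_nonneg _ _))))
  rw [inv_le_iff_one_le_mul₀ hpos, mul_right_comm, mul_assoc, inv_mul_eq_div, le_div_iff₀ hγ, one_mul]
  exact h1.trans (mul_le_mul_of_nonneg_left h3 hpos.le)

end Frequencies

/-! ### Deviation bounds from resonances and small divisors. -/

section Convergence

set_option linter.unusedSectionVars false

variable {ι : Type} [Fintype ι] [DecidableEq ι]
  {d L s : ℕ} {κ : ℝ} {H V : (Fin 3 → ℝ) → Matrix ι ι ℂ} {Ω : Fin 3 → ℝ}
  {ε : ι → (Fin 3 → ℝ) → ℝ} {U : (Fin 3 → ℝ) → ℝ → Matrix ι ι ℂ}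
  {x : ι → Fin 3 → ℤ} {b : Fin 3 → ι → ι → ℝ} {E C P σ : ℝ}

namespace ConnEstimate

variable (hE : ConnEstimate d L κ s V ε x b E C P)
include hE

lemma deviation_rate (hV : IsMicromotion d H Ω V ε) (hH : IsHamiltonian H)
    (hU : IsEvolution H Ω U) (hΩ : Incommensurate d Ω) (hd : d ≤ 2) (hσ : 0 ≤ σ)
    (hσ' : ∀ m, m ≠ 0 → modeFreq Ω m = 0 → 1 ≤ σ * hopWeight d L κ s 0 0 m) {D : ℝ} (hD : 0 ≤ D)
    (hD' : ∀ m, modeFreq Ω m ≠ 0 → |modeFreq Ω m|⁻¹ ≤ D * hopWeight d L κ s 0 0 m)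
    (n₀ : Fin 3 → Matrix ι ι ℂ) (θ₀ : Fin 3 → ℝ) {T : ℝ} (hT : 0 < T) :
    deviation H Ω V U n₀ θ₀ T ≤ 1 / (2 * freqNorm Ω) *
      ((∑ c, |Ω c|) * (4 * C * (1 + size n₀) * T⁻¹ + 12 * P * (1 + C) * (1 + size n₀)) +
        (σ * ((∑ c, |Ω c|) * (2 * (2 * E + ∑ l, |Ω l|) * C)) +
          2 * D * ((∑ c, |Ω c|) * (2 * (2 * E + ∑ l, |Ω l|) * C)) * T⁻¹)) := by
  have hf := hΩ.freqNorm_pos hd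
  refine (hE.deviation_le hV hH hU hΩ.1 hf.ne' n₀ θ₀ hT).trans
    (mul_le_mul_of_nonneg_left (add_le_add le_rfl ?_) (by positivity))
  exact (hE.bound_planeSum hΩ.1).timeMean_rate
    (fun m => one_le_hopWeight hE.rate_nonneg 0 0 m) hσ hD hσ' hD' θ₀ hT

lemma eventually_deviation (hV : IsMicromotion d H Ω V ε) (hH : IsHamiltonian H)
    (hU : IsEvolution H Ω U) (hΩ : Incommensurate d Ω) (hd : d ≤ 2) (hσ : 0 ≤ σ)
    (hσ' : ∀ m, m ≠ 0 → modeFreq Ω m = 0 → 1 ≤ σ * hopWeight d L κ s 0 0 m)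
    (n₀ : Fin 3 → Matrix ι ι ℂ) (θ₀ : Fin 3 → ℝ) {δ : ℝ} (hδ : 0 < δ) :
    ∀ᶠ T : ℝ in atTop, deviation H Ω V U n₀ θ₀ T ≤ 1 / (2 * freqNorm Ω) *
      ((∑ c, |Ω c|) * (12 * P * (1 + C) * (1 + size n₀)) +
        σ * ((∑ c, |Ω c|) * (2 * (2 * E + ∑ l, |Ω l|) * C)) + δ) := by
  have hf := hΩ.freqNorm_pos hd
  have h1 := (hE.bound_planeSum hΩ.1).eventually_timeMean
    (fun m => one_le_hopWeight hE.rate_nonneg 0 0 m) hσ hσ' θ₀ (half_pos hδ)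
  have h2 : Tendsto (fun T : ℝ => (∑ c, |Ω c|) * (4 * C * (1 + size n₀)) * T⁻¹) atTop (𝓝 0) := by
    simpa using tendsto_inv_atTop_zero.const_mul ((∑ c, |Ω c|) * (4 * C * (1 + size n₀)))
  filter_upwards [h1, h2.eventually_le_const (half_pos hδ), eventually_gt_atTop 0] with T a1 a2 hT
  refine (hE.deviation_le hV hH hU hΩ.1 hf.ne' n₀ θ₀ hT).trans
    (mul_le_mul_of_nonneg_left ?_ (by positivity))
  have e : (∑ c, |Ω c|) * (4 * C * (1 + size n₀) * T⁻¹ + 12 * P * (1 + C) * (1 + size n₀)) =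
      (∑ c, |Ω c|) * (4 * C * (1 + size n₀)) * T⁻¹ +
        (∑ c, |Ω c|) * (12 * P * (1 + C) * (1 + size n₀)) := by ring
  rw [e]
  linarith

end ConnEstimate

/-! ### Qudits driven by three tones -/

/-- For a qudit the constants may depend on the system, so smoothness and finiteness of the index
set suffice. Without fluxes the quasienergies are constant, hence `P = 0`. -/
lemma IsMicromotion.exists_connEstimate (hV : IsMicromotion 0 H Ω V ε) (hH : IsHamiltonian H)
    (s : ℕ) : ∃ b E C, ConnEstimate 0 0 0 s V ε (fun _ => 0) b E C 0 := by
  have hw : ∀ s, (fun m => (1 + driveNorm 0 m) ^ s) = hopWeight 0 0 0 s 0 0 := fun s => by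
    funext m
    simp [hopWeight]
  have h1 : ∀ j α β, ∃ B, FourierBound (hopWeight 0 0 0 (s + 1) 0 0)
      (fun θ => conn V j θ α β) B := fun j α β => by
    rw [← hw]
    exact (hV.smoothMatrix_conn j α β).exists_fourierBound (s + 1)
  have h2 : ∀ α, ∃ B, FourierBound (hopWeight 0 0 0 s 0 0) (fun θ => (ε α θ : ℂ)) B := fun α => by
    rw [← hw]
    have := hV.smoothMatrix_energy hH α α
    simp only [energyMatrix, Matrix.diagonal_apply_eq] at this
    exact this.exists_fourierBound s
  choose b hb using h1
  choose e he using h2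
  have hb0 : ∀ j α β, 0 ≤ b j α β := fun j α β => (hb j α β).nonneg fun _ => hopWeight_nonneg _ _ _
  have he0 : ∀ α, 0 ≤ e α := fun α => (he α).nonneg fun _ => hopWeight_nonneg _ _ _
  have hS0 : ∀ j, 0 ≤ ∑ α, ∑ β, b j α β := fun j =>
    Finset.sum_nonneg fun α _ => Finset.sum_nonneg fun β _ => hb0 j α β
  have hQ0 : ∀ c : Fin 3, 0 ≤ ∑ α, ∑ β, b (c + 1) α β * b (c + 2) β α := fun c =>
    Finset.sum_nonneg fun α _ => Finset.sum_nonneg fun β _ => mul_nonneg (hb0 _ _ _) (hb0 _ _ _)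
  have hS := fun j => Finset.single_le_sum (f := fun j => ∑ α, ∑ β, b j α β) (fun j _ => hS0 j)
    (Finset.mem_univ j)
  have hQ := fun c => Finset.single_le_sum
    (f := fun c : Fin 3 => ∑ α, ∑ β, b (c + 1) α β * b (c + 2) β α) (fun j _ => hQ0 j)
    (Finset.mem_univ c)
  have hSS := Finset.sum_nonneg fun j (_ : j ∈ Finset.univ) => hS0 j
  have hQQ := Finset.sum_nonneg fun c (_ : c ∈ Finset.univ) => hQ0 c
  refine ⟨b, ∑ α, e α, ∑ c : Fin 3, (∑ α, ∑ β, b (c + 1) α β * b (c + 2) β α) +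
    ∑ j, ∑ α, ∑ β, b j α β, ⟨le_rfl, add_nonneg hQQ hSS, le_rfl, hb,
    fun α => (he α).le_bound (Finset.single_le_sum (fun α _ => he0 α) (Finset.mem_univ α)),
    Finset.sum_nonneg fun α _ => he0 α, fun c _ => (hQ c).trans (le_add_of_nonneg_right hSS),
    fun j θ a a' => ?_, fun j α => ?_, fun j θ => ?_⟩⟩
  · refine le_trans (Finset.sum_le_sum fun α _ => Finset.sum_le_sum fun β _ => ?_)
      ((hS j).trans (le_add_of_nonneg_left hQQ))
    have hu := entry_norm_bound_of_unitary (hV.unitary θ)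
    calc _ ≤ 1 * b j α β * 1 := mul_le_mul (mul_le_mul_of_nonneg_right (hu a α) (hb0 j α β))
          (hu a' β) (norm_nonneg _) (mul_nonneg zero_le_one (hb0 j α β))
      _ = _ := by rw [one_mul, mul_one]
  · refine le_trans ?_ ((hS j).trans (le_add_of_nonneg_left hQQ))
    exact (Finset.single_le_sum (fun β _ => hb0 j α β) (Finset.mem_univ α)).trans
      (Finset.single_le_sum (f := fun α => ∑ β, b j α β)
        (fun α _ => Finset.sum_nonneg fun β _ => hb0 j α β) (Finset.mem_univ α))
  · refine (Finset.sum_eq_zero fun α _ => ?_).le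
    have : (fun θ => (ε α θ : ℂ)) = fun _ => (ε α 0 : ℂ) := funext fun θ => by
      rw [hV.quasienergy α θ 0 fun j hj => absurd hj (Nat.not_lt_zero _)]
    rw [this, partialD_const, norm_zero]

/-- There are no nonzero resonances without spatial directions, so `σ = 0` is admissible. -/
lemma Incommensurate.resonance_zero (hΩ : Incommensurate 0 Ω) (w : (Fin 3 → ℤ) → ℝ)
    (m : Fin 3 → ℤ) (hm : m ≠ 0) (h : modeFreq Ω m = 0) : 1 ≤ 0 * w m := by
  obtain ⟨j, hj, -⟩ := hΩ.exists_spatial_ne_zero hm h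
  exact absurd hj (Nat.not_lt_zero _)

theorem tendsto_timeAverage_qudit (hΩ : Incommensurate 0 Ω) (hH : IsHamiltonian H)
    (hV : IsMicromotion 0 H Ω V ε) (hU : IsEvolution H Ω U) (θ₀ : Fin 3 → ℝ)
    (n₀ : Fin 3 → Matrix ι ι ℂ) :
    Tendsto (fun T : ℝ => timeAverage (circulation H Ω U n₀ θ₀) T) atTop
      (𝓝 ((freqNorm Ω / (2 * Real.pi) : ℂ) * windingNumber V)) := by
  obtain ⟨b, E, C, hE⟩ := hV.exists_connEstimate hH 0
  have hf := hΩ.freqNorm_pos (Nat.zero_le 2)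
  rw [Metric.tendsto_nhds]
  intro δ hδ
  -- The slack `|Ω|δ` turns into `δ/2` after the prefactor `1/(2|Ω|)`.
  have h := hE.eventually_deviation hV hH hU hΩ (Nat.zero_le 2) le_rfl
    (hΩ.resonance_zero _) n₀ θ₀ (mul_pos hf hδ)
  filter_upwards [h] with T hT
  rw [dist_eq_norm]
  refine lt_of_le_of_lt hT ?_
  have e : 1 / (2 * freqNorm Ω) * ((∑ c, |Ω c|) * (12 * 0 * (1 + C) * (1 + size n₀)) +
      0 * ((∑ c, |Ω c|) * (2 * (2 * E + ∑ l, |Ω l|) * C)) + freqNorm Ω * δ) = δ / 2 := by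
    field_simp
    ring
  rw [e]
  exact half_lt_self hδ

theorem deviation_qudit (hΩ : Incommensurate 0 Ω) (hD : Diophantine 0 Ω) (hH : IsHamiltonian H)
    (hV : IsMicromotion 0 H Ω V ε) (hU : IsEvolution H Ω U) :
    ∃ C : ℝ, ∀ (θ₀ : Fin 3 → ℝ) (n₀ : Fin 3 → Matrix ι ι ℂ) (T : ℝ), 0 < T →
      deviation H Ω V U n₀ θ₀ T ≤ C * (1 + size n₀) * T⁻¹ := by
  obtain ⟨D, hD0, τ, hD'⟩ := hD.exists_inv_modeFreq_le
  obtain ⟨b, E, C, hE⟩ := hV.exists_connEstimate hH τ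
  have hf := hΩ.freqNorm_pos (Nat.zero_le 2)
  refine ⟨1 / (2 * freqNorm Ω) * ((∑ c, |Ω c|) * (4 * C) +
    2 * D * ((∑ c, |Ω c|) * (2 * (2 * E + ∑ l, |Ω l|) * C))), fun θ₀ n₀ T hT => ?_⟩
  refine (hE.deviation_rate hV hH hU hΩ (Nat.zero_le 2) le_rfl (hΩ.resonance_zero _) hD0
    (hD' 0 0 le_rfl) n₀ θ₀ hT).trans ?_
  have hω : 0 ≤ ∑ c, |Ω c| := Finset.sum_nonneg fun _ _ => abs_nonneg _
  have hC := hE.const_nonneg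
  have hE0 := hE.energy_nonneg
  have hn := size_nonneg n₀
  have hTi := (inv_pos.2 hT).le
  simp only [mul_assoc (1 / (2 * freqNorm Ω))]
  refine mul_le_mul_of_nonneg_left ?_ (by positivity)
  have h0 : 0 ≤ 2 * D * ((∑ c, |Ω c|) * (2 * (2 * E + ∑ l, |Ω l|) * C)) * size n₀ * T⁻¹ := by
    positivity
  linarith

end Convergence

/-! ### Distances on the periodic lattice -/

section Lattice

/-- The distance of `z` to the multiples of `L`. -/
noncomputable def circNorm (L : ℕ) (z : ℤ) : ℝ := ‖((z : ℝ) : AddCircle (L : ℝ))‖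

/-- The sum over all integers of `exp (-c |k|)`. -/
noncomputable def expSum (c : ℝ) : ℝ := ∑' k : ℤ, Real.exp (-(c * |(k : ℝ)|))

variable {d L : ℕ} {c : ℝ}

lemma circNorm_nonneg (L : ℕ) (z : ℤ) : 0 ≤ circNorm L z := norm_nonneg _

lemma circNorm_add_le (L : ℕ) (y z : ℤ) : circNorm L (y + z) ≤ circNorm L y + circNorm L z := by
  unfold circNorm
  rw [Int.cast_add, AddCircle.coe_add]
  exact norm_add_le _ _

lemma circNorm_neg (L : ℕ) (z : ℤ) : circNorm L (-z) = circNorm L z := by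
  unfold circNorm
  rw [Int.cast_neg, AddCircle.coe_neg, norm_neg]

lemma circNorm_eq (L : ℕ) (z : ℤ) : ∃ k : ℤ, circNorm L z = |((z - k * L : ℤ) : ℝ)| :=
  ⟨_, by rw [circNorm, AddCircle.norm_eq]; push_cast; rfl⟩

lemma circNorm_add_mul (L : ℕ) (z k : ℤ) : circNorm L (z + L * k) = circNorm L z := by
  unfold circNorm
  congr 1
  rw [← sub_eq_zero, ← AddCircle.coe_sub, AddCircle.coe_eq_zero_iff]
  exact ⟨k, by push_cast; rw [zsmul_eq_mul]; ring⟩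

lemma circNorm_le_abs (L : ℕ) (z : ℤ) : circNorm L z ≤ |(z : ℝ)| :=
  QuotientAddGroup.norm_mk_le_norm

lemma circNorm_le_abs_add (L : ℕ) (z k : ℤ) : circNorm L z ≤ |((z + L * k : ℤ) : ℝ)| := by
  rw [← circNorm_add_mul L z k]
  exact circNorm_le_abs L _

lemma summable_exp_abs (hc : 0 < c) : Summable fun k : ℤ => Real.exp (-(c * |(k : ℝ)|)) := by
  have h : Summable fun n : ℕ => Real.exp (-(c * (n : ℝ))) := by
    have := Real.summable_exp_nat_mul_iff.2 (neg_lt_zero.2 hc)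
    refine this.congr fun n => ?_
    congr 1
    ring
  refine Summable.of_nat_of_neg ?_ ?_
  · simpa using h
  · simpa using h

lemma expSum_nonneg (c : ℝ) : 0 ≤ expSum c := tsum_nonneg fun _ => (Real.exp_pos _).le

/-- The representatives of smallest absolute value of distinct residues are distinct integers, so
the sum over the circle is part of the sum over `ℤ`, whatever `L` is. -/
lemma sum_circNorm_le (hc : 0 < c) (L : ℕ) (y : ℤ) :
    ∑ r : Fin L, Real.exp (-(c * circNorm L ((r : ℕ) - y))) ≤ expSum c := by
  choose k hk using fun r : Fin L => circNorm_eq L ((r : ℕ) - y)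
  have hinj : Function.Injective fun r : Fin L => ((r : ℕ) - y - k r * L : ℤ) := fun r r' h => by
    simp only at h
    have h1 : ((r : ℕ) : ℤ) % L = ((r' : ℕ) : ℤ) % L := by
      have : ((r : ℕ) : ℤ) = (r' : ℕ) + L * (k r - k r') := by linarith
      rw [this, Int.add_mul_emod_self_left]
    rw [Int.emod_eq_of_lt (by positivity) (by exact_mod_cast r.2),
      Int.emod_eq_of_lt (by positivity) (by exact_mod_cast r'.2)] at h1
    exact Fin.ext (by exact_mod_cast h1)
  simp only [hk]
  have hs := summable_exp_abs hc
  have h1 := tsum_comp_le_tsum_of_inj hs (fun _ => (Real.exp_pos _).le) hinj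
  rw [tsum_fintype] at h1
  exact h1

lemma tsum_translate_le (hc : 0 < c) (hL : 0 < L) (z : ℤ) :
    (Summable fun k : ℤ => Real.exp (-(c * |((z + L * k : ℤ) : ℝ)|))) ∧
      ∑' k : ℤ, Real.exp (-(c * |((z + L * k : ℤ) : ℝ)|)) ≤ expSum c := by
  have hinj : Function.Injective fun k : ℤ => z + L * k := fun k k' h => by
    have h1 : (L : ℤ) * k = L * k' := add_left_cancel h
    exact mul_left_cancel₀ (by exact_mod_cast hL.ne') h1
  exact ⟨(summable_exp_abs hc).comp_injective hinj,
    tsum_comp_le_tsum_of_inj (summable_exp_abs hc) (fun _ => (Real.exp_pos _).le) hinj⟩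

/-- The distance of two points on the spatial torus. -/
noncomputable def latDist (d L : ℕ) (x y : Fin 3 → ℤ) : ℝ :=
  ∑ j : {j : Fin 3 // (j : ℕ) < d}, circNorm L (x j - y j)

/-- The distance of the `j`th coordinate to the boundary of the home cell, if `j` is spatial. -/
noncomputable def wallDist (d L : ℕ) (j : Fin 3) (x : Fin 3 → ℤ) : ℝ :=
  if (j : ℕ) < d then circNorm L (x j + 1) else 0

lemma latDist_nonneg (x y : Fin 3 → ℤ) : 0 ≤ latDist d L x y :=
  Finset.sum_nonneg fun _ _ => circNorm_nonneg _ _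

lemma wallDist_nonneg (j : Fin 3) (x : Fin 3 → ℤ) : 0 ≤ wallDist d L j x := by
  unfold wallDist
  split_ifs
  · exact circNorm_nonneg _ _
  · exact le_rfl

lemma latDist_comm (x y : Fin 3 → ℤ) : latDist d L x y = latDist d L y x :=
  Finset.sum_congr rfl fun j _ => by rw [← circNorm_neg, neg_sub]

lemma latDist_triangle (x y z : Fin 3 → ℤ) :
    latDist d L x z ≤ latDist d L x y + latDist d L y z := by
  unfold latDist
  rw [← Finset.sum_add_distrib]
  refine Finset.sum_le_sum fun j _ => ?_
  rw [← sub_add_sub_cancel (x j) (y j)]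
  exact circNorm_add_le _ _ _

lemma wallDist_le (j : Fin 3) (x y : Fin 3 → ℤ) :
    wallDist d L j x ≤ wallDist d L j y + latDist d L x y := by
  unfold wallDist
  split_ifs with h
  · have h0 : ∀ i ∈ (Finset.univ : Finset {j : Fin 3 // (j : ℕ) < d}),
        0 ≤ circNorm L (x i - y i) := fun i _ => circNorm_nonneg _ _
    have h1 := Finset.single_le_sum h0 (Finset.mem_univ ⟨j, h⟩)
    rw [← latDist] at h1
    have h2 := circNorm_add_le L (y j + 1) (x j - y j)
    rw [show y j + 1 + (x j - y j) = x j + 1 by ring] at h2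
    linarith
  · simpa using latDist_nonneg x y

/-- Two directions that include all spatial ones control the distance to the corner of the home
cell. -/
lemma latDist_le_wallDist {c : Fin 3} (hc : d ≤ (c : ℕ)) (x : Fin 3 → ℤ) :
    latDist d L x (fun _ => -1) ≤ wallDist d L (c + 1) x + wallDist d L (c + 2) x := by
  have h1 : latDist d L x (fun _ => -1) = ∑ j : Fin 3, wallDist d L j x := by
    unfold latDist wallDist
    rw [← Finset.sum_filter]
    have h := Finset.sum_subtype (F := inferInstance) (Finset.univ.filter fun j : Fin 3 => (j : ℕ) < d)
      (p := fun j : Fin 3 => (j : ℕ) < d) (fun j => by rw [Finset.mem_filter_univ])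
      (fun j : Fin 3 => circNorm L (x j + 1))
    rw [h]
    exact Finset.sum_congr rfl fun j _ => by rw [sub_neg_eq_add]
  have h2 : wallDist d L c x = 0 := if_neg (not_lt.2 hc)
  have h3 : ∑ j : Fin 3, wallDist d L j x =
      wallDist d L c x + wallDist d L (c + 1) x + wallDist d L (c + 2) x := by
    rw [← Equiv.sum_comp (Equiv.addLeft c), Fin.sum_univ_three]
    simp
  rw [h1, h3, h2, zero_add]

lemma abs_le_spatialNorm (x : Fin 3 → ℤ) {j : Fin 3} (hj : (j : ℕ) < d) :
    |(x j : ℝ)| ≤ spatialNorm d x :=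
  norm_le_pi_norm (fun j : {j : Fin 3 // (j : ℕ) < d} => (x j : ℝ)) ⟨j, hj⟩

lemma card_spatial_le (d : ℕ) : (Fintype.card {j : Fin 3 // (j : ℕ) < d} : ℝ) ≤ 3 := by
  exact_mod_cast (Fintype.card_subtype_le _).trans (Fintype.card_fin 3).le

lemma sum_spatial_le (x : Fin 3 → ℤ) :
    ∑ j : {j : Fin 3 // (j : ℕ) < d}, |(x j : ℝ)| ≤ 3 * spatialNorm d x := by
  refine (Finset.sum_le_card_nsmul _ _ (spatialNorm d x) fun j _ =>
    abs_le_spatialNorm x j.2).trans ?_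
  rw [nsmul_eq_mul]
  exact mul_le_mul_of_nonneg_right (card_spatial_le d) (spatialNorm_nonneg d x)

/-- The torus distance sums over at most three coordinates and does not exceed the displacement to
any copy of `x`. -/
lemma latDist_le_spatialNorm (x y m : Fin 3 → ℤ) :
    latDist d L x y ≤ 3 * spatialNorm d (x + L • m - y) := by
  refine le_trans (Finset.sum_le_sum fun j _ => ?_) (sum_spatial_le _)
  have e : (x + L • m - y) j = x j - y j + L * m j := by
    simp
    ring
  rw [e]
  exact circNorm_le_abs_add L _ _

/-- The spatial coordinates lie in the home cell `[0, L)`. -/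
def InCell (d L : ℕ) (x : Fin 3 → ℤ) : Prop := ∀ j : Fin 3, (j : ℕ) < d → 0 ≤ x j ∧ x j < L

/-- A hop with `m_j ≠ 0` leaves the home cell through a wall. Going down it covers at least `y_j +
1`, going up more than `L - 1 - y_j`, and both dominate the distance of `y_j + 1` to the multiples
of `L`. -/
lemma wallDist_le_spatialNorm {x y m : Fin 3 → ℤ} (hx : InCell d L x) (hy : InCell d L y)
    {j : Fin 3} (hj : (j : ℕ) < d) (hm : m j ≠ 0) :
    wallDist d L j y ≤ spatialNorm d (x + L • m - y) := by
  obtain ⟨x0, x1⟩ := hx j hj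
  obtain ⟨y0, y1⟩ := hy j hj
  rw [wallDist, if_pos hj]
  refine le_trans ?_ (abs_le_spatialNorm _ hj)
  have e : (x + L • m - y) j = x j + L * m j - y j := by simp
  rw [e]
  have hL : (0 : ℤ) ≤ L := by positivity
  rcases lt_or_gt_of_ne hm with h | h
  · refine (circNorm_le_abs L _).trans ?_
    rw [← Int.cast_abs, ← Int.cast_abs]
    have h1 : (L : ℤ) * m j ≤ -L := by nlinarith
    have h2 : |y j + 1| = y j + 1 := abs_of_nonneg (by linarith)
    rw [h2]
    exact_mod_cast le_trans (by linarith) (neg_le_abs (x j + L * m j - y j))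
  · refine (circNorm_le_abs_add L _ (-1)).trans ?_
    rw [← Int.cast_abs, ← Int.cast_abs]
    have h1 : (L : ℤ) ≤ L * m j := by nlinarith
    have h2 : |y j + 1 + L * -1| = L - y j - 1 := by
      rw [abs_of_nonpos (by linarith)]
      ring
    rw [h2]
    exact_mod_cast le_trans (by linarith) (le_abs_self (x j + L * m j - y j))

/-- The factor `m_j` of a flux derivative is bounded by the hopping distance, without any power of
`L`; exponential decay can then absorb it. -/
lemma abs_coord_le {x y m : Fin 3 → ℤ} (hL : 0 < L) (hx : InCell d L x) (hy : InCell d L y)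
    {j : Fin 3} (hj : (j : ℕ) < d) : |(m j : ℝ)| ≤ spatialNorm d (x + L • m - y) + 1 := by
  obtain ⟨x0, x1⟩ := hx j hj
  obtain ⟨y0, y1⟩ := hy j hj
  refine le_trans ?_ (add_le_add_left (abs_le_spatialNorm (x + L • m - y) hj) 1)
  have e : (x + L • m - y) j = x j + L * m j - y j := by simp
  rw [e, ← Int.cast_abs, ← Int.cast_abs]
  have hL' : (1 : ℤ) ≤ L := by exact_mod_cast hL
  have : |m j| ≤ |x j + L * m j - y j| + 1 := by
    rcases le_total 0 (m j) with h | h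
    · rcases eq_or_lt_of_le h with h0 | h0
      · rw [← h0]; simp; positivity
      · rw [abs_of_nonneg h]
        have h1 : (m j - 1) * 1 ≤ (m j - 1) * L := mul_le_mul_of_nonneg_left hL' (by linarith)
        have h2 := le_abs_self (x j + L * m j - y j)
        nlinarith
    · rcases eq_or_lt_of_le h with h0 | h0
      · rw [h0]; simp; positivity
      · rw [abs_of_nonpos h]
        have h1 : (-m j - 1) * 1 ≤ (-m j - 1) * L := mul_le_mul_of_nonneg_left hL' (by linarith)
        have h2 := neg_le_abs (x j + L * m j - y j)
        nlinarith
  exact_mod_cast this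

/-- The position of a site in the home cell. -/
def sitePos {d L N : ℕ} (a : Site d L N) : Fin 3 → ℤ := latticePoint a.1 0

variable {N : ℕ}

lemma inCell_sitePos (a : Site d L N) : InCell d L (sitePos a) := fun j hj => by
  simp only [sitePos, latticePoint, hj, dif_pos, Pi.zero_apply, mul_zero, add_zero]
  exact ⟨by positivity, by exact_mod_cast (a.1 ⟨j, hj⟩).2⟩

/-- The sum of exponentially decaying weights over all sites is bounded uniformly in the size. -/
lemma sum_latDist_sitePos_le (hc : 0 < c) (y : Fin 3 → ℤ) :
    ∑ a : Site d L N, Real.exp (-(c * latDist d L (sitePos a) y)) ≤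
      N * expSum c ^ Fintype.card {j : Fin 3 // (j : ℕ) < d} := by
  have h1 : ∀ a : Site d L N, Real.exp (-(c * latDist d L (sitePos a) y)) =
      ∏ j : {j : Fin 3 // (j : ℕ) < d}, Real.exp (-(c * circNorm L ((a.1 j : ℕ) - y j))) :=
    fun a => by
      rw [← Real.exp_sum, latDist, Finset.mul_sum, ← Finset.sum_neg_distrib]
      congr 1
      refine Finset.sum_congr rfl fun j _ => ?_
      have : sitePos a j = (a.1 j : ℕ) := by
        have hj := j.2
        rw [sitePos, latticePoint, dif_pos hj]
        simp
      rw [this]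
  simp only [h1]
  rw [Fintype.sum_prod_type]
  simp only [Finset.sum_const, Finset.card_univ, Fintype.card_fin, nsmul_eq_mul]
  rw [← Finset.mul_sum]
  refine mul_le_mul_of_nonneg_left ?_ (Nat.cast_nonneg _)
  have h2 := Finset.prod_univ_sum (fun _ : {j : Fin 3 // (j : ℕ) < d} => (Finset.univ : Finset (Fin L)))
    (fun j r => Real.exp (-(c * circNorm L ((r : ℕ) - y j))))
  rw [Fintype.piFinset_univ] at h2
  rw [← h2, ← Finset.card_univ, ← Finset.prod_const]
  exact Finset.prod_le_prod (fun j _ => Finset.sum_nonneg fun _ _ => (Real.exp_pos _).le)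
    fun j _ => sum_circNorm_le hc L (y j)

end Lattice

/-! ### Fourier series of localized functions -/

section HopDecay

variable {d L s : ℕ} {κ μ δ Q : ℝ} {K : ℕ → ℝ} {x y : Fin 3 → ℤ} {f : (Fin 3 → ℝ) → ℂ}

/-- The constant in the summation of localized Fourier coefficients. -/
noncomputable def decayConst (c : ℝ) : ℝ := (expSum c + ∑' k : ℤ, ((1 + |(k : ℝ)|) ^ 2)⁻¹) ^ 3

lemma tsum_inv_sq_nonneg : 0 ≤ ∑' k : ℤ, ((1 + |(k : ℝ)|) ^ 2)⁻¹ :=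
  tsum_nonneg fun _ => by positivity

lemma decayConst_nonneg (c : ℝ) : 0 ≤ decayConst c :=
  pow_nonneg (add_nonneg (expSum_nonneg c) tsum_inv_sq_nonneg) 3

/-- The excess rate `6δ` is split in two. One `3δ` becomes decay in the torus distance through
`latDist_le_spatialNorm`; the other, `δ` per coordinate, pays for the sum over spatial windings. The
six extra drive powers pay for the sum over drive components. -/
lemma SmoothTorus.fourierBound_of_decay (hf : SmoothTorus f) (hL : 0 < L) (hκ : 0 ≤ κ)
    (hδ : 0 < δ) (hQ : 0 ≤ Q)
    (h : ∀ m, ‖torusCoeff f m‖ * (1 + driveNorm d m) ^ (s + 6) ≤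
      Q * Real.exp (-((κ + 6 * δ) * spatialNorm d (x + L • m - y)))) :
    FourierBound (hopWeight d L κ s x y) f
      (Q * Real.exp (-(δ * latDist d L x y)) * decayConst δ) := by
  set g : Fin 3 → ℤ → ℝ := fun j k => if (j : ℕ) < d then
    Real.exp (-(δ * |((x j - y j + L * k : ℤ) : ℝ)|)) else ((1 + |(k : ℝ)|) ^ 2)⁻¹ with hg
  refine hf.fourierBound (g := g) (fun m => one_le_hopWeight hκ x y m) (fun j k => ?_)
    (fun j => ?_) (mul_nonneg hQ (Real.exp_pos _).le) (fun m => ?_) (fun j => ?_)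
  · rw [hg]
    dsimp only
    split_ifs
    · exact (Real.exp_pos _).le
    · positivity
  · rw [hg]
    dsimp only
    split_ifs
    · exact (tsum_translate_le hδ hL _).1
    · exact summable_int_inv_sq
  · set S := spatialNorm d (x + L • m - y) with hS
    have hS0 : 0 ≤ S := spatialNorm_nonneg _ _
    set D := 1 + driveNorm d m with hD
    have hD1 : 1 ≤ D := one_le_one_add_driveNorm d m
    have hD0 : 0 < D := zero_lt_one.trans_le hD1
    have hgj : ∀ j, Real.exp (-(δ * S)) * (D ^ 2)⁻¹ ≤ g j (m j) := fun j => by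
      rw [hg]
      dsimp only
      split_ifs with hj
      · have e : x j - y j + L * m j = (x + L • m - y) j := by simp; ring
        rw [e]
        refine (mul_le_of_le_one_right (Real.exp_pos _).le
          (inv_le_one_of_one_le₀ (one_le_pow₀ hD1))).trans ?_
        exact Real.exp_le_exp.2 (neg_le_neg (mul_le_mul_of_nonneg_left
          (abs_le_spatialNorm _ hj) hδ.le))
      · refine (mul_le_of_le_one_left (by positivity)
          (Real.exp_le_one_iff.2 (neg_nonpos.2 (mul_nonneg hδ.le hS0)))).trans ?_
        have := abs_le_driveNorm m (not_lt.1 hj)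
        gcongr
        linarith
    have hprod : Real.exp (-(3 * δ * S)) * (D ^ 6)⁻¹ ≤ ∏ j, g j (m j) := by
      refine le_trans (le_of_eq ?_) (Finset.prod_le_prod (fun j _ => by positivity)
        fun j _ => hgj j)
      rw [Finset.prod_const, Finset.card_univ, Fintype.card_fin, mul_pow, ← Real.exp_nat_mul,
        inv_pow, ← pow_mul]
      congr 2
      push_cast
      ring
    have h1 := h m
    have h2 : Real.exp (-(3 * δ * S)) ≤ Real.exp (-(δ * latDist d L x y)) := by
      refine Real.exp_le_exp.2 (neg_le_neg ?_)
      have := mul_le_mul_of_nonneg_left (latDist_le_spatialNorm (d := d) (L := L) x y m) hδ.le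
      linarith
    have h3 : Real.exp (-((κ + 6 * δ) * S)) =
        Real.exp (-(κ * S)) * (Real.exp (-(3 * δ * S)) * Real.exp (-(3 * δ * S))) := by
      rw [← Real.exp_add, ← Real.exp_add]
      congr 1
      ring
    have h4 : Real.exp (-(κ * S)) * Real.exp (κ * S) = 1 := by
      rw [← Real.exp_add, neg_add_cancel, Real.exp_zero]
    calc ‖torusCoeff f m‖ * hopWeight d L κ s x y m
        = ‖torusCoeff f m‖ * D ^ (s + 6) * (Real.exp (κ * S) * (D ^ 6)⁻¹) := by
          rw [hopWeight, pow_add, ← hS, ← hD]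
          field_simp
      _ ≤ Q * Real.exp (-((κ + 6 * δ) * S)) * (Real.exp (κ * S) * (D ^ 6)⁻¹) :=
          mul_le_mul_of_nonneg_right h1 (by positivity)
      _ = Q * Real.exp (-(3 * δ * S)) * (Real.exp (-(3 * δ * S)) * (D ^ 6)⁻¹) := by
          rw [h3]
          linear_combination (Q * Real.exp (-(3 * δ * S)) * (Real.exp (-(3 * δ * S)) *
            (D ^ 6)⁻¹)) * h4
      _ ≤ Q * Real.exp (-(δ * latDist d L x y)) * ∏ j, g j (m j) :=
          mul_le_mul (mul_le_mul_of_nonneg_left h2 hQ) hprod (by positivity)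
            (mul_nonneg hQ (Real.exp_pos _).le)
  · rw [hg]
    dsimp only
    split_ifs
    · exact (tsum_translate_le hδ hL _).2.trans (le_add_of_nonneg_right tsum_inv_sq_nonneg)
    · exact le_add_of_nonneg_left (expSum_nonneg δ)

/-- Decay of the Fourier coefficients of a hopping amplitude from `y` to `x`. -/
def HopDecay (d L : ℕ) (ν : ℝ) (K : ℕ → ℝ) (x y : Fin 3 → ℤ) (f : (Fin 3 → ℝ) → ℂ) : Prop :=
  ∀ k m, ‖torusCoeff f m‖ ≤
    |K k| * Real.exp (-(ν * spatialNorm d (x + L • m - y))) / (1 + driveNorm d m) ^ k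

/-- The constant in the bounds on localized functions and their derivatives. -/
noncomputable def hopConst (μ : ℝ) (K : ℕ → ℝ) (s : ℕ) : ℝ :=
  (|K (s + 6)| + |K (s + 7)|) * (1 + (6 * μ)⁻¹) * decayConst (2 * μ)

lemma hopConst_nonneg (hμ : 0 < μ) (K : ℕ → ℝ) (s : ℕ) : 0 ≤ hopConst μ K s :=
  mul_nonneg (mul_nonneg (by positivity) (by positivity)) (decayConst_nonneg _)

lemma HopDecay.mul_pow_le (h : HopDecay d L (κ + 24 * μ) K x y f) (s : ℕ) (m : Fin 3 → ℤ) :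
    ‖torusCoeff f m‖ * (1 + driveNorm d m) ^ s ≤
      |K s| * Real.exp (-((κ + 24 * μ) * spatialNorm d (x + L • m - y))) :=
  (le_div_iff₀ (pow_pos (zero_lt_one.trans_le (one_le_one_add_driveNorm d m)) s)).1 (h s m)

lemma HopDecay.fourierBound (h : HopDecay d L (κ + 24 * μ) K x y f) (hf : SmoothTorus f)
    (hL : 0 < L) (hκ : 0 ≤ κ) (hμ : 0 < μ) (s : ℕ) :
    FourierBound (hopWeight d L κ s x y) f
      (hopConst μ K s * Real.exp (-(2 * μ * latDist d L x y))) := by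
  have h1 := hf.fourierBound_of_decay (d := d) (L := L) (s := s) (x := x) (y := y) hL hκ
    (δ := 2 * μ) (by positivity)
    (Q := |K (s + 6)|) (abs_nonneg _) fun m => (h.mul_pow_le (s + 6) m).trans
      (mul_le_mul_of_nonneg_left (Real.exp_le_exp.2 (neg_le_neg (mul_le_mul_of_nonneg_right
        (by linarith) (spatialNorm_nonneg _ _)))) (abs_nonneg _))
  refine h1.le_bound ?_
  rw [hopConst, mul_right_comm]
  refine mul_le_mul_of_nonneg_right (mul_le_mul_of_nonneg_right ?_ (decayConst_nonneg _))
    (Real.exp_pos _).le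
  refine (le_add_of_nonneg_right (abs_nonneg _)).trans (le_mul_of_one_le_right (by positivity) ?_)
  exact le_add_of_nonneg_right (by positivity)

lemma add_one_mul_exp_le (hμ : 0 < μ) {S : ℝ} (hS : 0 ≤ S) :
    (S + 1) * Real.exp (-(μ * S)) ≤ 1 + μ⁻¹ := by
  have h1 : μ * S + 1 ≤ Real.exp (μ * S) := Real.add_one_le_exp _
  rw [Real.exp_neg, ← div_eq_mul_inv, div_le_iff₀ (Real.exp_pos _)]
  have h2 : S ≤ μ⁻¹ * Real.exp (μ * S) := by
    rw [inv_mul_eq_div, le_div_iff₀ hμ]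
    linarith
  have h3 : 1 ≤ Real.exp (μ * S) := Real.one_le_exp (by positivity)
  linarith

/-- Only modes with `m_j ≠ 0` survive a flux derivative, and these cross a wall. Of the excess
`24μ`, half goes into `fourierBound_of_decay` with `δ = 2μ`, `6μ` absorbs the factor `m_j`, and the
last `6μ` yields decay away from the wall. -/
lemma HopDecay.fourierBound_flux (h : HopDecay d L (κ + 24 * μ) K x y f) (hf : SmoothTorus f)
    (hL : 0 < L) (hκ : 0 ≤ κ) (hμ : 0 < μ) (hx : InCell d L x) (hy : InCell d L y) (s : ℕ)
    {j : Fin 3} (hj : (j : ℕ) < d) :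
    FourierBound (hopWeight d L κ s x y) (partialD j f)
      (hopConst μ K s * Real.exp (-(2 * μ * latDist d L x y)) *
        Real.exp (-(2 * μ * wallDist d L j y))) := by
  have h1 := (hf.partialD j).fourierBound_of_decay (d := d) (L := L) (s := s) (x := x) (y := y)
    hL hκ (δ := 2 * μ) (by positivity)
    (Q := |K (s + 6)| * (1 + (6 * μ)⁻¹) * Real.exp (-(2 * μ * wallDist d L j y)))
    (by positivity) fun m => ?_
  · refine h1.le_bound ?_
    have h2 : |K (s + 6)| * (1 + (6 * μ)⁻¹) ≤
        (|K (s + 6)| + |K (s + 7)|) * (1 + (6 * μ)⁻¹) :=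
      mul_le_mul_of_nonneg_right (le_add_of_nonneg_right (abs_nonneg _)) (by positivity)
    have h3 : 0 ≤ decayConst (2 * μ) * Real.exp (-(2 * μ * latDist d L x y)) *
        Real.exp (-(2 * μ * wallDist d L j y)) :=
      mul_nonneg (mul_nonneg (decayConst_nonneg _) (Real.exp_pos _).le) (Real.exp_pos _).le
    rw [hopConst]
    have := mul_le_mul_of_nonneg_right h2 h3
    linarith
  · rw [hf.torusCoeff_partialD, norm_mul, norm_mul, norm_neg, Complex.norm_I, one_mul,
      Complex.norm_intCast]
    set S := spatialNorm d (x + L • m - y) with hS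
    have hS0 : 0 ≤ S := spatialNorm_nonneg _ _
    by_cases hm : m j = 0
    · rw [hm]
      simp only [Int.cast_zero, abs_zero, zero_mul]
      positivity
    · have h2 := h.mul_pow_le (s + 6) m
      have h3 : |(m j : ℝ)| ≤ S + 1 := abs_coord_le hL hx hy hj
      have h4 : wallDist d L j y ≤ S := wallDist_le_spatialNorm hx hy hj hm
      have h5 := add_one_mul_exp_le (μ := 6 * μ) (by positivity) hS0
      have h6 : Real.exp (-(6 * μ * S)) ≤ Real.exp (-(2 * μ * wallDist d L j y)) := by
        refine Real.exp_le_exp.2 (neg_le_neg ?_)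
        have := mul_le_mul_of_nonneg_left h4 hμ.le
        have := mul_nonneg hμ.le hS0
        linarith
      have h7 : Real.exp (-((κ + 24 * μ) * S)) = Real.exp (-((κ + 6 * (2 * μ)) * S)) *
          (Real.exp (-(6 * μ * S)) * Real.exp (-(6 * μ * S))) := by
        rw [← Real.exp_add, ← Real.exp_add]
        congr 1
        ring
      calc |(m j : ℝ)| * ‖torusCoeff f m‖ * (1 + driveNorm d m) ^ (s + 6)
          = |(m j : ℝ)| * (‖torusCoeff f m‖ * (1 + driveNorm d m) ^ (s + 6)) := mul_assoc _ _ _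
        _ ≤ (S + 1) * (|K (s + 6)| * Real.exp (-((κ + 24 * μ) * S))) :=
            mul_le_mul h3 h2 (mul_nonneg (norm_nonneg _) (pow_nonneg
              (zero_le_one.trans (one_le_one_add_driveNorm d m)) _)) (by positivity)
        _ = |K (s + 6)| * ((S + 1) * Real.exp (-(6 * μ * S))) * Real.exp (-(6 * μ * S)) *
              Real.exp (-((κ + 6 * (2 * μ)) * S)) := by rw [h7]; ring
        _ ≤ |K (s + 6)| * (1 + (6 * μ)⁻¹) * Real.exp (-(2 * μ * wallDist d L j y)) *
              Real.exp (-((κ + 6 * (2 * μ)) * S)) := by gcongr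

lemma HopDecay.fourierBound_partialD (h : HopDecay d L (κ + 24 * μ) K x y f) (hf : SmoothTorus f)
    (hL : 0 < L) (hκ : 0 ≤ κ) (hμ : 0 < μ) (hx : InCell d L x) (hy : InCell d L y) (s : ℕ)
    (j : Fin 3) :
    FourierBound (hopWeight d L κ s x y) (partialD j f)
      ((hopConst μ K s + hopConst μ K (s + 1)) * Real.exp (-(2 * μ * latDist d L x y)) *
        Real.exp (-(2 * μ * wallDist d L j y))) := by
  have h0 := hopConst_nonneg hμ K s
  have h1 := hopConst_nonneg hμ K (s + 1)
  by_cases hj : (j : ℕ) < d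
  · refine (h.fourierBound_flux hf hL hκ hμ hx hy s hj).le_bound ?_
    gcongr
    exact le_add_of_nonneg_right h1
  · refine ((h.fourierBound hf hL hκ hμ (s + 1)).partialD j
      (fun m => one_le_hopWeight hκ x y m) (abs_mul_hopWeight (not_lt.1 hj) x y)
      zero_le_one).le_bound ?_
    rw [wallDist, if_neg hj, mul_zero, neg_zero, Real.exp_zero, mul_one, one_mul]
    gcongr
    exact le_add_of_nonneg_left h0

end HopDecay

/-! ### Localized quasienergy states -/

section Localized

set_option linter.unusedSectionVars false

variable {d L N : ℕ}

/-- A tight-binding Hamiltonian and quasienergy states localized in the home cell. -/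
structure LocalizedFrame (d L N : ℕ) (κ μ : ℝ) (K : ℕ → ℝ)
    (H V : (Fin 3 → ℝ) → Matrix (Site d L N) (Site d L N) ℂ)
    (x : Site d L N → Fin 3 → ℤ) : Prop where
  size_pos : 0 < L
  rate_pos : 0 < κ
  loss_pos : 0 < μ
  inCell : ∀ α, InCell d L (x α)
  hop_state : ∀ a α, HopDecay d L (κ + 24 * μ) K (sitePos a) (x α) fun θ => V θ a α
  hop_ham : ∀ a a', HopDecay d L (κ + 24 * μ) K (sitePos a) (sitePos a') fun θ => H θ a a'

/-- The constant in the bounds on the states and their derivatives. -/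
noncomputable def stateConst (μ : ℝ) (K : ℕ → ℝ) (s : ℕ) : ℝ :=
  hopConst μ K s + hopConst μ K (s + 1)

/-- The constant in sums over sites. -/
noncomputable def siteConst (d N : ℕ) (μ : ℝ) : ℝ :=
  N * expSum μ ^ Fintype.card {j : Fin 3 // (j : ℕ) < d}

/-- The constant in sums over states. -/
noncomputable def countConst (d N : ℕ) (μ : ℝ) (K : ℕ → ℝ) (s : ℕ) : ℝ :=
  stateConst μ K s ^ 2 * siteConst d N μ * siteConst d N μ

/-- The constant in the bound on the quasienergies. -/
noncomputable def energyConst (d N : ℕ) (Ω : Fin 3 → ℝ) (μ : ℝ) (K : ℕ → ℝ) (s : ℕ) : ℝ :=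
  stateConst μ K s ^ 3 * siteConst d N μ ^ 2 +
    (∑ l, |Ω l|) * (stateConst μ K s ^ 2 * siteConst d N μ)

lemma stateConst_nonneg {μ : ℝ} (hμ : 0 < μ) (K : ℕ → ℝ) (s : ℕ) : 0 ≤ stateConst μ K s :=
  add_nonneg (hopConst_nonneg hμ K s) (hopConst_nonneg hμ K (s + 1))

lemma siteConst_nonneg (d N : ℕ) (μ : ℝ) : 0 ≤ siteConst d N μ :=
  mul_nonneg (Nat.cast_nonneg _) (pow_nonneg (expSum_nonneg _) _)

lemma countConst_nonneg (d N : ℕ) (μ : ℝ) (K : ℕ → ℝ) (s : ℕ) : 0 ≤ countConst d N μ K s :=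
  mul_nonneg (mul_nonneg (sq_nonneg _) (siteConst_nonneg _ _ _)) (siteConst_nonneg _ _ _)

lemma energyConst_nonneg (d N : ℕ) (Ω : Fin 3 → ℝ) {μ : ℝ} (hμ : 0 < μ) (K : ℕ → ℝ) (s : ℕ) :
    0 ≤ energyConst d N Ω μ K s := by
  have h1 := stateConst_nonneg hμ K s
  have h2 := siteConst_nonneg d N μ
  have h3 : 0 ≤ ∑ l, |Ω l| := Finset.sum_nonneg fun _ _ => abs_nonneg _
  unfold energyConst
  positivity

/-- Half of the decay along a path through an intermediate site gives decay between its endpoints;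
the other half keeps the sum over that site finite. -/
lemma exp_mul_exp_le {μ r₁ r₂ r₃ : ℝ} (hμ : 0 < μ) (h : r₃ ≤ r₁ + r₂) (h₂ : 0 ≤ r₂) :
    Real.exp (-(2 * μ * r₁)) * Real.exp (-(2 * μ * r₂)) ≤
      Real.exp (-(μ * r₃)) * Real.exp (-(μ * r₁)) := by
  rw [← Real.exp_add, ← Real.exp_add]
  refine Real.exp_le_exp.2 ?_
  have := mul_le_mul_of_nonneg_left h hμ.le
  have := mul_nonneg hμ.le h₂
  linarith

lemma exp_two_mul_le {μ r : ℝ} (hμ : 0 < μ) (h : 0 ≤ r) :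
    Real.exp (-(2 * μ * r)) ≤ Real.exp (-(μ * r)) := by
  refine Real.exp_le_exp.2 ?_
  have := mul_nonneg hμ.le h
  linarith

namespace LocalizedFrame

variable {κ μ : ℝ} {K : ℕ → ℝ} {H V : (Fin 3 → ℝ) → Matrix (Site d L N) (Site d L N) ℂ}
  {x : Site d L N → Fin 3 → ℤ} {Ω : Fin 3 → ℝ} {ε : Site d L N → (Fin 3 → ℝ) → ℝ}
  (h : LocalizedFrame d L N κ μ K H V x)
include h

lemma sum_site_le (y : Fin 3 → ℤ) :
    ∑ a : Site d L N, Real.exp (-(μ * latDist d L (sitePos a) y)) ≤ siteConst d N μ :=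
  sum_latDist_sitePos_le h.loss_pos y

lemma bound_state (hV : IsMicromotion d H Ω V ε) (s : ℕ) (a α : Site d L N) :
    FourierBound (hopWeight d L κ s (sitePos a) (x α)) (fun θ => V θ a α)
      (stateConst μ K s * Real.exp (-(2 * μ * latDist d L (sitePos a) (x α)))) := by
  refine ((h.hop_state a α).fourierBound (hV.smooth.smoothMatrix a α) h.size_pos h.rate_pos.le
    h.loss_pos s).le_bound (mul_le_mul_of_nonneg_right ?_ (Real.exp_pos _).le)
  exact le_add_of_nonneg_right (hopConst_nonneg h.loss_pos K (s + 1))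

lemma bound_partialD_state (hV : IsMicromotion d H Ω V ε) (s : ℕ) (j : Fin 3) (a α : Site d L N) :
    FourierBound (hopWeight d L κ s (sitePos a) (x α)) (partialD j fun θ => V θ a α)
      (stateConst μ K s * Real.exp (-(2 * μ * latDist d L (sitePos a) (x α))) *
        Real.exp (-(2 * μ * wallDist d L j (x α)))) :=
  (h.hop_state a α).fourierBound_partialD (hV.smooth.smoothMatrix a α) h.size_pos h.rate_pos.le
    h.loss_pos (inCell_sitePos a) (h.inCell α) s j

lemma bound_ham (hH : IsHamiltonian H) (s : ℕ) (a a' : Site d L N) :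
    FourierBound (hopWeight d L κ s (sitePos a) (sitePos a')) (fun θ => H θ a a')
      (stateConst μ K s * Real.exp (-(2 * μ * latDist d L (sitePos a) (sitePos a')))) := by
  refine ((h.hop_ham a a').fourierBound (hH.1.smoothMatrix a a') h.size_pos h.rate_pos.le
    h.loss_pos s).le_bound (mul_le_mul_of_nonneg_right ?_ (Real.exp_pos _).le)
  exact le_add_of_nonneg_right (hopConst_nonneg h.loss_pos K (s + 1))

lemma bound_star_state (hV : IsMicromotion d H Ω V ε) (s : ℕ) (a α : Site d L N) :
    FourierBound (hopWeight d L κ s (x α) (sitePos a)) (fun θ => star (V θ a α))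
      (stateConst μ K s * Real.exp (-(2 * μ * latDist d L (sitePos a) (x α)))) :=
  (h.bound_state hV s a α).star fun _ => hopWeight_neg _ _ _

/-- Multiplication of localized functions of a common site. -/
lemma bound_mul {f g : (Fin 3 → ℝ) → ℂ} {u v y : Fin 3 → ℤ} {B₁ B₂ : ℝ} {s : ℕ}
    (hf : FourierBound (hopWeight d L κ s u v) f B₁)
    (hg : FourierBound (hopWeight d L κ s v y) g B₂) :
    FourierBound (hopWeight d L κ s u y) (fun θ => f θ * g θ) (B₁ * B₂) :=
  hf.mul hg (fun m => one_le_hopWeight h.rate_pos.le _ _ m)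
    (fun m => one_le_hopWeight h.rate_pos.le _ _ m) (fun m => hopWeight_nonneg _ _ m)
    (hopWeight_add h.rate_pos.le _ _ _)

/-- The connection decays away from the diagonal, and its flux components are supported near the
boundary of the home cell. -/
lemma bound_conn (hV : IsMicromotion d H Ω V ε) (s : ℕ) (j : Fin 3) (α β : Site d L N) :
    FourierBound (hopWeight d L κ s (x α) (x β)) (fun θ => conn V j θ α β)
      (stateConst μ K s ^ 2 * siteConst d N μ * Real.exp (-(μ * latDist d L (x α) (x β))) *
        Real.exp (-(2 * μ * wallDist d L j (x β)))) := by
  have h1 := FourierBound.sum (fun m => one_le_hopWeight h.rate_pos.le (x α) (x β) m) fun a =>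
    h.bound_mul (h.bound_star_state hV s a α) (h.bound_partialD_state hV s j a β)
  have e : (fun θ => conn V j θ α β) = fun θ =>
      ∑ a, star (V θ a α) * partialD j (fun θ => V θ a β) θ := funext fun θ => by
    simp [conn, Matrix.mul_apply, pderiv_apply]
  rw [e]
  refine h1.le_bound ?_
  have hA := stateConst_nonneg h.loss_pos K s
  calc _ = ∑ a, stateConst μ K s ^ 2 * (Real.exp (-(2 * μ * latDist d L (sitePos a) (x α))) *
          Real.exp (-(2 * μ * latDist d L (sitePos a) (x β)))) *
          Real.exp (-(2 * μ * wallDist d L j (x β))) :=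
        Finset.sum_congr rfl fun a _ => by ring
    _ ≤ ∑ a, stateConst μ K s ^ 2 * (Real.exp (-(μ * latDist d L (x α) (x β))) *
          Real.exp (-(μ * latDist d L (sitePos a) (x α)))) *
          Real.exp (-(2 * μ * wallDist d L j (x β))) := by
        refine Finset.sum_le_sum fun a _ => ?_
        have ht := latDist_triangle (d := d) (L := L) (x α) (sitePos a) (x β)
        rw [latDist_comm (x α) (sitePos a)] at ht
        have := exp_mul_exp_le h.loss_pos ht (latDist_nonneg _ _)
        gcongr
    _ = (stateConst μ K s ^ 2 * Real.exp (-(μ * latDist d L (x α) (x β))) *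
          Real.exp (-(2 * μ * wallDist d L j (x β)))) *
          ∑ a : Site d L N, Real.exp (-(μ * latDist d L (sitePos a) (x α))) := by
        rw [Finset.mul_sum]
        exact Finset.sum_congr rfl fun a _ => by ring
    _ ≤ (stateConst μ K s ^ 2 * Real.exp (-(μ * latDist d L (x α) (x β))) *
          Real.exp (-(2 * μ * wallDist d L j (x β)))) * siteConst d N μ :=
        mul_le_mul_of_nonneg_left (h.sum_site_le _) (by positivity)
    _ = _ := by ring

lemma norm_state_le (hV : IsMicromotion d H Ω V ε) (s : ℕ) (θ : Fin 3 → ℝ) (a α : Site d L N) :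
    ‖V θ a α‖ ≤ stateConst μ K s * Real.exp (-(2 * μ * latDist d L (sitePos a) (x α))) :=
  (h.bound_state hV s a α).norm_le (fun m => one_le_hopWeight h.rate_pos.le _ _ m) θ

/-- The density of the centres of the states is bounded uniformly in the size. -/
lemma sum_state_le (hV : IsMicromotion d H Ω V ε) (s : ℕ) (y : Fin 3 → ℤ) :
    ∑ α, Real.exp (-(μ * latDist d L (x α) y)) ≤ countConst d N μ K s := by
  have hA := stateConst_nonneg h.loss_pos K s
  set A := stateConst μ K s with hAdef
  set S := siteConst d N μ with hSdef
  have hS : 0 ≤ S := siteConst_nonneg d N μ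
  have hrow : ∀ a, ∑ α, ‖V 0 a α‖ ^ 2 = 1 := fun a => by
    have h1 := congrFun (congrFun (hV.mul_star_self 0) a) a
    rw [Matrix.mul_apply, Matrix.one_apply_eq] at h1
    have h2 : ((∑ α, ‖V 0 a α‖ ^ 2 : ℝ) : ℂ) = 1 := by
      rw [← h1]
      push_cast
      exact Finset.sum_congr rfl fun α _ => (Complex.mul_conj' _).symm
    exact_mod_cast h2
  have hcol : ∀ α, ∑ a, ‖V 0 a α‖ ^ 2 = 1 := fun α => by
    have h1 := congrFun (congrFun (hV.star_mul_self 0) α) α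
    rw [Matrix.mul_apply, Matrix.one_apply_eq] at h1
    have h2 : ((∑ a, ‖V 0 a α‖ ^ 2 : ℝ) : ℂ) = 1 := by
      rw [← h1]
      push_cast
      exact Finset.sum_congr rfl fun a _ => (Complex.conj_mul' _).symm
    exact_mod_cast h2
  have hup : ∀ α, ∑ a, (‖V 0 a α‖ * Real.exp (μ * latDist d L (sitePos a) (x α) / 2)) ^ 2 ≤
      A ^ 2 * S := fun α => by
    refine le_trans (Finset.sum_le_sum fun a _ => ?_)
      ((Finset.mul_sum _ _ _).symm.le.trans
        (mul_le_mul_of_nonneg_left (h.sum_site_le (x α)) (sq_nonneg A)))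
    have h1 := h.norm_state_le hV s 0 a α
    have h2 := latDist_nonneg (d := d) (L := L) (sitePos a) (x α)
    calc _ ≤ (A * Real.exp (-(2 * μ * latDist d L (sitePos a) (x α))) *
          Real.exp (μ * latDist d L (sitePos a) (x α) / 2)) ^ 2 := by gcongr
      _ = A ^ 2 * Real.exp (-(3 * μ * latDist d L (sitePos a) (x α))) := by
          rw [mul_assoc, ← Real.exp_add, mul_pow, ← Real.exp_nat_mul]
          congr 2
          push_cast
          ring
      _ ≤ _ := by
          refine mul_le_mul_of_nonneg_left (Real.exp_le_exp.2 ?_) (sq_nonneg A)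
          have := mul_nonneg h.loss_pos.le h2
          linarith
  -- Cauchy–Schwarz with weights `e^{±μr/2}`: a normalized localized state has a definite amount of
  -- its mass near its centre.
  have hcs : ∀ α, 1 ≤ A ^ 2 * S *
      ∑ a, (‖V 0 a α‖ * Real.exp (-(μ * latDist d L (sitePos a) (x α) / 2))) ^ 2 := fun α => by
    have h1 := Finset.sum_mul_sq_le_sq_mul_sq Finset.univ
      (fun a => ‖V 0 a α‖ * Real.exp (μ * latDist d L (sitePos a) (x α) / 2))
      (fun a => ‖V 0 a α‖ * Real.exp (-(μ * latDist d L (sitePos a) (x α) / 2)))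
    have h2 : ∀ a, ‖V 0 a α‖ * Real.exp (μ * latDist d L (sitePos a) (x α) / 2) *
        (‖V 0 a α‖ * Real.exp (-(μ * latDist d L (sitePos a) (x α) / 2))) = ‖V 0 a α‖ ^ 2 :=
      fun a => by
        rw [mul_mul_mul_comm, ← Real.exp_add, add_neg_cancel, Real.exp_zero, mul_one, sq]
    simp only [h2, hcol, one_pow] at h1
    exact h1.trans (mul_le_mul_of_nonneg_right (hup α)
      (Finset.sum_nonneg fun _ _ => sq_nonneg _))
  have hα : ∀ α, Real.exp (-(μ * latDist d L (x α) y)) ≤ A ^ 2 * S *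
      ∑ a, ‖V 0 a α‖ ^ 2 * Real.exp (-(μ * latDist d L (sitePos a) y)) := fun α => by
    have h1 := mul_le_mul_of_nonneg_right (hcs α) (Real.exp_pos (-(μ * latDist d L (x α) y))).le
    rw [one_mul, mul_assoc, Finset.sum_mul] at h1
    refine h1.trans (mul_le_mul_of_nonneg_left (Finset.sum_le_sum fun a _ => ?_) (by positivity))
    rw [mul_pow, mul_assoc, ← Real.exp_nat_mul, ← Real.exp_add]
    refine mul_le_mul_of_nonneg_left (Real.exp_le_exp.2 ?_) (sq_nonneg _)
    have := mul_le_mul_of_nonneg_left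
      (latDist_triangle (d := d) (L := L) (sitePos a) (x α) y) h.loss_pos.le
    push_cast
    linarith
  refine (Finset.sum_le_sum fun α _ => hα α).trans ?_
  rw [← Finset.mul_sum, Finset.sum_comm, countConst]
  refine mul_le_mul_of_nonneg_left (le_trans (Finset.sum_le_sum fun a _ => ?_)
    (h.sum_site_le y)) (by positivity)
  -- Completeness at each site: the masses of all states there add up to one, so few centres fit
  -- into any region.
  rw [← Finset.sum_mul, hrow, one_mul]

lemma sum_state_le' (hV : IsMicromotion d H Ω V ε) (s : ℕ) (y : Fin 3 → ℤ) :
    ∑ α, Real.exp (-(μ * latDist d L y (x α))) ≤ countConst d N μ K s := by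
  simp only [latDist_comm y]
  exact h.sum_state_le hV s y

/-- By `energyMatrix_eq` a quasienergy is a sum over closed paths from its centre through sites and
back, so its flux harmonics carry the weight of a full winding. -/
lemma bound_energy (hV : IsMicromotion d H Ω V ε) (hH : IsHamiltonian H) (s : ℕ)
    (α : Site d L N) :
    FourierBound (hopWeight d L κ s (x α) (x α)) (fun θ => (ε α θ : ℂ))
      (energyConst d N Ω μ K s) := by
  have hA := stateConst_nonneg h.loss_pos K s
  have hS := siteConst_nonneg d N μ
  have hw : ∀ u v m, 1 ≤ hopWeight d L κ s u v m := one_le_hopWeight h.rate_pos.le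
  have hsum := fun y => h.sum_site_le y
  have hsum' : ∀ y, ∑ a : Site d L N, Real.exp (-(2 * μ * latDist d L (sitePos a) y)) ≤
      siteConst d N μ := fun y => (Finset.sum_le_sum fun a _ =>
        exp_two_mul_le h.loss_pos (latDist_nonneg _ _)).trans (hsum y)
  have h1 : ∀ a, FourierBound (hopWeight d L κ s (sitePos a) (x α))
      (fun θ => ∑ a', H θ a a' * V θ a' α) (stateConst μ K s ^ 2 * siteConst d N μ) := fun a => by
    refine (FourierBound.sum (hw _ _) fun a' => h.bound_mul (h.bound_ham hH s a a')
      (h.bound_state hV s a' α)).le_bound ?_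
    calc _ ≤ ∑ a' : Site d L N, stateConst μ K s ^ 2 *
          Real.exp (-(2 * μ * latDist d L (sitePos a') (x α))) := by
          refine Finset.sum_le_sum fun a' _ => ?_
          have : Real.exp (-(2 * μ * latDist d L (sitePos a) (sitePos a'))) ≤ 1 :=
            Real.exp_le_one_iff.2 (neg_nonpos.2
              (mul_nonneg (mul_nonneg zero_le_two h.loss_pos.le) (latDist_nonneg _ _)))
          calc _ = stateConst μ K s ^ 2 * Real.exp (-(2 * μ * latDist d L (sitePos a') (x α))) *
                Real.exp (-(2 * μ * latDist d L (sitePos a) (sitePos a'))) := by ring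
            _ ≤ _ := mul_le_of_le_one_right (by positivity) this
      _ ≤ _ := by
          rw [← Finset.mul_sum]
          exact mul_le_mul_of_nonneg_left (hsum' _) (sq_nonneg _)
  have h2 : FourierBound (hopWeight d L κ s (x α) (x α))
      (fun θ => ∑ a, star (V θ a α) * ∑ a', H θ a a' * V θ a' α)
      (stateConst μ K s ^ 3 * siteConst d N μ ^ 2) := by
    refine (FourierBound.sum (hw _ _) fun a => h.bound_mul (h.bound_star_state hV s a α)
      (h1 a)).le_bound ?_
    rw [← Finset.sum_mul, ← Finset.mul_sum]
    calc _ ≤ stateConst μ K s * siteConst d N μ * (stateConst μ K s ^ 2 * siteConst d N μ) := by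
          gcongr
          exact hsum' _
      _ = _ := by ring
  have h3 : ∀ a, FourierBound (hopWeight d L κ s (sitePos a) (x α))
      (fun θ => ∑ l, (Ω l : ℂ) * partialD l (fun θ => V θ a α) θ)
      ((∑ l, |Ω l|) * (stateConst μ K s *
        Real.exp (-(2 * μ * latDist d L (sitePos a) (x α))))) := fun a => by
    refine (FourierBound.sum (hw _ _) fun l =>
      (h.bound_partialD_state hV s l a α).const_mul (Ω l : ℂ)).le_bound ?_
    rw [Finset.sum_mul]
    refine Finset.sum_le_sum fun l _ => ?_
    rw [Complex.norm_real, Real.norm_eq_abs]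
    refine mul_le_mul_of_nonneg_left (mul_le_of_le_one_right (by positivity) ?_) (abs_nonneg _)
    exact Real.exp_le_one_iff.2 (neg_nonpos.2
      (mul_nonneg (mul_nonneg zero_le_two h.loss_pos.le) (wallDist_nonneg _ _)))
  have h4 : FourierBound (hopWeight d L κ s (x α) (x α))
      (fun θ => ∑ a, star (V θ a α) * ∑ l, (Ω l : ℂ) * partialD l (fun θ => V θ a α) θ)
      ((∑ l, |Ω l|) * (stateConst μ K s ^ 2 * siteConst d N μ)) := by
    refine (FourierBound.sum (hw _ _) fun a => h.bound_mul (h.bound_star_state hV s a α)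
      (h3 a)).le_bound ?_
    have h0 : 0 ≤ ∑ l, |Ω l| := Finset.sum_nonneg fun _ _ => abs_nonneg _
    calc _ ≤ ∑ a : Site d L N, (∑ l, |Ω l|) * stateConst μ K s ^ 2 *
          Real.exp (-(2 * μ * latDist d L (sitePos a) (x α))) := by
          refine Finset.sum_le_sum fun a _ => ?_
          have : Real.exp (-(2 * μ * latDist d L (sitePos a) (x α))) ≤ 1 :=
            Real.exp_le_one_iff.2 (neg_nonpos.2
              (mul_nonneg (mul_nonneg zero_le_two h.loss_pos.le) (latDist_nonneg _ _)))
          calc _ = (∑ l, |Ω l|) * stateConst μ K s ^ 2 *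
                Real.exp (-(2 * μ * latDist d L (sitePos a) (x α))) *
                Real.exp (-(2 * μ * latDist d L (sitePos a) (x α))) := by ring
            _ ≤ _ := mul_le_of_le_one_right (by positivity) this
      _ ≤ _ := by
          rw [← Finset.mul_sum, ← mul_assoc]
          exact mul_le_mul_of_nonneg_left (hsum' _) (by positivity)
  have h5 := h2.sub (hw _ _) (h4.const_mul Complex.I)
  rw [Complex.norm_I, one_mul] at h5
  have e : (fun θ => (ε α θ : ℂ)) = fun θ =>
      (∑ a, star (V θ a α) * ∑ a', H θ a a' * V θ a' α) -
        Complex.I * ∑ a, star (V θ a α) * ∑ l, (Ω l : ℂ) * partialD l (fun θ => V θ a α) θ :=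
    funext fun θ => by
      have h6 := congrFun (congrFun (congrFun hV.energyMatrix_eq θ) α) α
      rw [energyMatrix, Matrix.diagonal_apply_eq] at h6
      rw [h6]
      simp only [Matrix.sub_apply, Matrix.smul_apply, smul_eq_mul, Matrix.mul_apply,
        Matrix.conjTranspose_apply, driftM_apply, driftD]
  rw [e]
  exact h5

/-- The quasienergies depend exponentially weakly on the fluxes. -/
lemma norm_partialD_energy_le (hV : IsMicromotion d H Ω V ε) (hH : IsHamiltonian H) (s : ℕ)
    (j : Fin 3) (θ : Fin 3 → ℝ) (α : Site d L N) :
    ‖partialD j (fun θ => (ε α θ : ℂ)) θ‖ ≤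
      (1 + κ⁻¹) * Real.exp (-(κ * L)) * energyConst d N Ω μ K s := by
  have hκ := h.rate_pos
  have hE := energyConst_nonneg d N Ω h.loss_pos K s
  by_cases hj : (j : ℕ) < d
  · refine ((h.bound_energy hV hH s α).partialD j (w' := fun _ => 1) (fun _ => le_rfl)
      (c := (1 + κ⁻¹) * Real.exp (-(κ * L))) (fun m => ?_) (by positivity)).norm_le
      (fun _ => le_rfl) θ
    rw [mul_one]
    have h1 : 1 ≤ (1 + driveNorm d m) ^ s := one_le_pow₀ (one_le_one_add_driveNorm d m)
    have h2 : (L : ℝ) * |(m j : ℝ)| ≤ spatialNorm d (x α + L • m - x α) := by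
      refine le_trans (le_of_eq ?_) (abs_le_spatialNorm _ hj)
      rw [add_sub_cancel_left]
      simp [abs_mul]
    have h3 : Real.exp (κ * (L * |(m j : ℝ)|)) ≤ hopWeight d L κ s (x α) (x α) m :=
      (Real.exp_le_exp.2 (mul_le_mul_of_nonneg_left h2 hκ.le)).trans
        (le_mul_of_one_le_right (Real.exp_pos _).le h1)
    by_cases hm : m j = 0
    · rw [hm, Int.cast_zero, abs_zero]
      exact mul_nonneg (by positivity) (hopWeight_nonneg _ _ _)
    · have h4 : (1 : ℝ) ≤ |(m j : ℝ)| := by exact_mod_cast Int.one_le_abs hm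
      have hL : (1 : ℝ) ≤ L := by exact_mod_cast h.size_pos
      -- One winding supplies the factor `e^{-κL}`; the remaining `|m_j| - 1` windings absorb the
      -- factor `|m_j|` of the derivative.
      have h5 := add_one_mul_exp_le hκ (sub_nonneg.2 h4)
      rw [sub_add_cancel, Real.exp_neg, ← div_eq_mul_inv, div_le_iff₀ (Real.exp_pos _)] at h5
      refine h5.trans ?_
      rw [mul_assoc]
      refine mul_le_mul_of_nonneg_left ?_ (by positivity)
      refine le_trans ?_ (mul_le_mul_of_nonneg_left h3 (Real.exp_pos _).le)
      rw [← Real.exp_add]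
      refine Real.exp_le_exp.2 ?_
      have h6 : |(m j : ℝ)| - 1 ≤ L * (|(m j : ℝ)| - 1) :=
        le_mul_of_one_le_left (sub_nonneg.2 h4) hL
      have := mul_le_mul_of_nonneg_left h6 hκ.le
      linarith
  · have : partialD j (fun θ => (ε α θ : ℂ)) θ = 0 := by
      have h1 := congrFun (congrFun (hV.pderiv_energyMatrix_drive (not_lt.1 hj) θ) α) α
      rw [pderiv_energyMatrix, Matrix.diagonal_apply_eq] at h1
      exact h1
    rw [this, norm_zero]
    positivity

end LocalizedFrame

end Localized

/-! ### Uniform estimates for localized systems and reduction to the home cell. -/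

section Lattices

set_option linter.unusedSectionVars false

variable {d L N : ℕ}

/-- The constant controlling the connection of a localized system. -/
noncomputable def connConst (d N : ℕ) (μ : ℝ) (K : ℕ → ℝ) (s : ℕ) : ℝ :=
  stateConst μ K s ^ 2 * siteConst d N μ

/-- The constant controlling the boundary terms of a localized system. -/
noncomputable def circConst (d N : ℕ) (μ : ℝ) (K : ℕ → ℝ) (s : ℕ) : ℝ :=
  connConst d N μ K s ^ 2 * countConst d N μ K s ^ 2 +
    stateConst μ K s * connConst d N μ K s * countConst d N μ K s ^ 2 + connConst d N μ K s

/-- The constant controlling the persistent currents of a localized system. -/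
noncomputable def persConst (d N : ℕ) (Ω : Fin 3 → ℝ) (κ κ' μ : ℝ) (K : ℕ → ℝ) (s : ℕ) : ℝ :=
  (((Fintype.card {j : Fin 3 // (j : ℕ) < d}).factorial : ℝ) /
    (κ - κ') ^ Fintype.card {j : Fin 3 // (j : ℕ) < d} * N) *
    ((1 + κ⁻¹) * energyConst d N Ω μ K s)

lemma connConst_nonneg (d N : ℕ) (μ : ℝ) (K : ℕ → ℝ) (s : ℕ) : 0 ≤ connConst d N μ K s :=
  mul_nonneg (sq_nonneg _) (siteConst_nonneg _ _ _)

lemma circConst_nonneg (d N : ℕ) {μ : ℝ} (hμ : 0 < μ) (K : ℕ → ℝ) (s : ℕ) :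
    0 ≤ circConst d N μ K s := by
  have h1 := connConst_nonneg d N μ K s
  have h2 := stateConst_nonneg hμ K s
  unfold circConst
  positivity

lemma persConst_nonneg (d N : ℕ) (Ω : Fin 3 → ℝ) {κ κ' μ : ℝ} (hκ : 0 < κ) (hκ' : κ' < κ)
    (hμ : 0 < μ) (K : ℕ → ℝ) (s : ℕ) : 0 ≤ persConst d N Ω κ κ' μ K s := by
  have h1 := energyConst_nonneg d N Ω hμ K s
  have h2 := sub_pos.2 hκ'
  unfold persConst
  positivity

/-- The polynomial volume factor is absorbed by the gap between `κ` and `κ'`. -/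
lemma card_site_mul_exp_le {κ κ' : ℝ} (hκ' : κ' < κ) :
    (Fintype.card (Site d L N) : ℝ) * Real.exp (-(κ * L)) ≤
      ((Fintype.card {j : Fin 3 // (j : ℕ) < d}).factorial : ℝ) /
        (κ - κ') ^ Fintype.card {j : Fin 3 // (j : ℕ) < d} * N * Real.exp (-(κ' * L)) := by
  set k := Fintype.card {j : Fin 3 // (j : ℕ) < d} with hk
  have hc : Fintype.card (Site d L N) = L ^ k * N := by
    rw [Fintype.card_prod, Fintype.card_fun, Fintype.card_fin, Fintype.card_fin]
  have h1 := Real.pow_div_factorial_le_exp ((κ - κ') * L)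
    (mul_nonneg (sub_pos.2 hκ').le (Nat.cast_nonneg _)) k
  have hp : 0 < (κ - κ') ^ k := pow_pos (sub_pos.2 hκ') k
  have hf : (0 : ℝ) < k.factorial := by exact_mod_cast k.factorial_pos
  rw [div_le_iff₀ hf, mul_pow] at h1
  have h2 : (L : ℝ) ^ k ≤ k.factorial / (κ - κ') ^ k * Real.exp ((κ - κ') * L) := by
    rw [div_mul_eq_mul_div, le_div_iff₀ hp]
    linarith
  have h3 : Real.exp (-(κ' * L)) = Real.exp ((κ - κ') * L) * Real.exp (-(κ * L)) := by
    rw [← Real.exp_add]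
    congr 1
    ring
  rw [hc, h3]
  push_cast
  calc _ = (L : ℝ) ^ k * (N * Real.exp (-(κ * L))) := by ring
    _ ≤ k.factorial / (κ - κ') ^ k * Real.exp ((κ - κ') * L) * (N * Real.exp (-(κ * L))) :=
        mul_le_mul_of_nonneg_right h2 (by positivity)
    _ = _ := by ring

namespace LocalizedFrame

variable {κ κ' μ : ℝ} {K : ℕ → ℝ} {H V : (Fin 3 → ℝ) → Matrix (Site d L N) (Site d L N) ℂ}
  {x : Site d L N → Fin 3 → ℤ} {Ω : Fin 3 → ℝ} {ε : Site d L N → (Fin 3 → ℝ) → ℝ}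

/-- The constants of the boundary and quasi-periodic terms are independent of `L`. The pair sum is
finite because its two factors are pinned to walls that meet at one corner, and the sums with a
fixed site by localization. Only the persistent currents are summed over all states, and there each
term is exponentially small. -/
lemma connEstimate (h : LocalizedFrame d L N κ μ K H V x) (hV : IsMicromotion d H Ω V ε)
    (hH : IsHamiltonian H) (hκ' : κ' < κ) (s : ℕ) :
    ConnEstimate d L κ s V ε x
      (fun j α β => connConst d N μ K (s + 1) * Real.exp (-(μ * latDist d L (x α) (x β))) *
        Real.exp (-(2 * μ * wallDist d L j (x β))))
      (energyConst d N Ω μ K s) (circConst d N μ K (s + 1))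
      (persConst d N Ω κ κ' μ K s * Real.exp (-(κ' * L))) := by
  have hμ := h.loss_pos
  have hB := connConst_nonneg d N μ K (s + 1)
  have hA := stateConst_nonneg hμ K (s + 1)
  have hQ := countConst_nonneg d N μ K (s + 1)
  have hD := fun α β => latDist_nonneg (d := d) (L := L) (x α) (x β)
  have hW := fun j α => wallDist_nonneg (d := d) (L := L) j (x α)
  have hE := energyConst_nonneg d N Ω hμ K s
  have hle : ∀ j α β, connConst d N μ K (s + 1) * Real.exp (-(μ * latDist d L (x α) (x β))) *
        Real.exp (-(2 * μ * wallDist d L j (x β))) ≤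
        connConst d N μ K (s + 1) * Real.exp (-(μ * latDist d L (x α) (x β))) := fun j α β =>
    mul_le_of_le_one_right (by positivity) (Real.exp_le_one_iff.2 (neg_nonpos.2
      (mul_nonneg (by positivity) (hW j β))))
  have hsum2 : ∀ y, ∑ α, ∑ β, Real.exp (-(μ * latDist d L (x α) (x β))) *
      Real.exp (-(μ * latDist d L (x α) y)) ≤ countConst d N μ K (s + 1) ^ 2 := fun y => by
    calc _ ≤ ∑ α, countConst d N μ K (s + 1) * Real.exp (-(μ * latDist d L (x α) y)) := by
          refine Finset.sum_le_sum fun α _ => ?_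
          rw [← Finset.sum_mul]
          exact mul_le_mul_of_nonneg_right (h.sum_state_le' hV (s + 1) _) (Real.exp_pos _).le
      _ ≤ _ := by
          rw [← Finset.mul_sum, sq]
          exact mul_le_mul_of_nonneg_left (h.sum_state_le hV (s + 1) y) hQ
  refine ⟨h.rate_pos.le, circConst_nonneg d N hμ K (s + 1),
    mul_nonneg (persConst_nonneg d N Ω h.rate_pos hκ' hμ K s) (Real.exp_pos _).le,
    fun j α β => h.bound_conn hV (s + 1) j α β, fun α => h.bound_energy hV hH s α, hE,
    fun c hc => ?_, fun j θ a a' => ?_, fun j α => ?_, fun j θ => ?_⟩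
  · calc _ ≤ ∑ α, ∑ β, connConst d N μ K (s + 1) ^ 2 *
          (Real.exp (-(μ * latDist d L (x α) (x β))) *
            Real.exp (-(μ * latDist d L (x α) fun _ => -1))) := by
          refine Finset.sum_le_sum fun α _ => Finset.sum_le_sum fun β _ => ?_
          -- The decay from the wall in direction `c + 1` is centred at `β`. Carrying it over to `α`
          -- costs one distance between the two, and the product of the two entries provides two.
          have h1 := latDist_le_wallDist (L := L) hc (x α)
          have h2 := wallDist_le (d := d) (L := L) (c + 1) (x α) (x β)
          have h3 := mul_le_mul_of_nonneg_left (h1.trans (add_le_add_left h2 _)) hμ.le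
          have h4 := mul_nonneg hμ.le (hW (c + 1) β)
          have h5 := mul_nonneg hμ.le (hW (c + 2) α)
          have h6 : Real.exp (-(μ * latDist d L (x α) (x β))) *
              Real.exp (-(2 * μ * wallDist d L (c + 1) (x β))) *
              (Real.exp (-(μ * latDist d L (x β) (x α))) *
              Real.exp (-(2 * μ * wallDist d L (c + 2) (x α)))) ≤
              Real.exp (-(μ * latDist d L (x α) (x β))) *
            Real.exp (-(μ * latDist d L (x α) fun _ => -1)) := by
            rw [latDist_comm (x β), ← Real.exp_add, ← Real.exp_add, ← Real.exp_add,
              ← Real.exp_add]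
            refine Real.exp_le_exp.2 ?_
            linarith
          calc _ = connConst d N μ K (s + 1) ^ 2 * (Real.exp (-(μ * latDist d L (x α) (x β))) *
              Real.exp (-(2 * μ * wallDist d L (c + 1) (x β))) *
              (Real.exp (-(μ * latDist d L (x β) (x α))) *
              Real.exp (-(2 * μ * wallDist d L (c + 2) (x α))))) := by ring
            _ ≤ _ := mul_le_mul_of_nonneg_left h6 (sq_nonneg _)
      _ = connConst d N μ K (s + 1) ^ 2 * ∑ α, ∑ β,
          (Real.exp (-(μ * latDist d L (x α) (x β))) *
            Real.exp (-(μ * latDist d L (x α) fun _ => -1))) := by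
          simp only [Finset.mul_sum]
      _ ≤ connConst d N μ K (s + 1) ^ 2 * countConst d N μ K (s + 1) ^ 2 :=
          mul_le_mul_of_nonneg_left (hsum2 _) (sq_nonneg _)
      _ ≤ _ := by
          rw [circConst, add_assoc]
          exact le_add_of_nonneg_right (by positivity)
  · have hu := entry_norm_bound_of_unitary (hV.unitary θ)
    calc _ ≤ ∑ α, ∑ β, stateConst μ K (s + 1) * connConst d N μ K (s + 1) *
          (Real.exp (-(μ * latDist d L (x α) (x β))) *
            Real.exp (-(μ * latDist d L (x α) (sitePos a)))) := by
          refine Finset.sum_le_sum fun α _ => Finset.sum_le_sum fun β _ => ?_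
          have h1 := h.norm_state_le hV (s + 1) θ a α
          have h2 := exp_two_mul_le hμ (latDist_nonneg (d := d) (L := L) (sitePos a) (x α))
          rw [latDist_comm (x α) (sitePos a)]
          calc _ ≤ stateConst μ K (s + 1) * Real.exp (-(μ * latDist d L (sitePos a) (x α))) *
                (connConst d N μ K (s + 1) * Real.exp (-(μ * latDist d L (x α) (x β)))) * 1 := by
                refine mul_le_mul (mul_le_mul (h1.trans (mul_le_mul_of_nonneg_left h2 hA))
                  (hle j α β) (by positivity) (by positivity)) (hu a' β) (norm_nonneg _)
                  (by positivity)
            _ = _ := by ring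
      _ = stateConst μ K (s + 1) * connConst d N μ K (s + 1) * ∑ α, ∑ β,
          (Real.exp (-(μ * latDist d L (x α) (x β))) *
            Real.exp (-(μ * latDist d L (x α) (sitePos a)))) := by
          simp only [Finset.mul_sum]
      _ ≤ stateConst μ K (s + 1) * connConst d N μ K (s + 1) * countConst d N μ K (s + 1) ^ 2 :=
          mul_le_mul_of_nonneg_left (hsum2 _) (by positivity)
      _ ≤ _ := by
          rw [circConst, add_assoc]
          exact (le_add_of_nonneg_right hB).trans (le_add_of_nonneg_left (by positivity))
  · refine (hle j α α).trans ((mul_le_of_le_one_right hB (Real.exp_le_one_iff.2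
      (neg_nonpos.2 (mul_nonneg hμ.le (hD α α))))).trans ?_)
    rw [circConst]
    exact le_add_of_nonneg_left (by positivity)
  · refine (Finset.sum_le_card_nsmul _ _ _ fun α _ =>
      h.norm_partialD_energy_le hV hH s j θ α).trans ?_
    have hκ := h.rate_pos
    rw [nsmul_eq_mul, Finset.card_univ, persConst]
    have h1 := mul_le_mul_of_nonneg_right (card_site_mul_exp_le (d := d) (L := L) (N := N) hκ')
      (by positivity : 0 ≤ (1 + κ⁻¹) * energyConst d N Ω μ K s)
    linarith

end LocalizedFrame

lemma spatialNorm_congr {x y : Fin 3 → ℤ} (h : ∀ j : Fin 3, (j : ℕ) < d → x j = y j) :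
    spatialNorm d x = spatialNorm d y := by
  unfold spatialNorm
  congr 1
  funext j
  rw [h j j.2]

lemma driveNorm_congr {x y : Fin 3 → ℤ} (h : ∀ j : Fin 3, d ≤ (j : ℕ) → x j = y j) :
    driveNorm d x = driveNorm d y := by
  unfold driveNorm
  congr 1
  funext j
  rw [h j j.2]

/-- Localization at `X` is hop decay from the representative of `X` in the home cell. -/
lemma LocalizedAt.hopDecay {ξ ν : ℝ} {K : ℕ → ℝ} {ψ : (Fin 3 → ℝ) → Site d L N → ℂ}
    {X x n : Fin 3 → ℤ} (h : LocalizedAt ξ K ψ X) (hν : ν = 1 / ξ)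
    (hx : ∀ j : Fin 3, (j : ℕ) < d → x j = X j + L * n j)
    (hn : ∀ j : Fin 3, d ≤ (j : ℕ) → X j = -n j) (a : Site d L N) :
    HopDecay d L ν K (sitePos a) x fun θ => ψ θ a * fourierMode n θ := fun k m => by
  rw [torusCoeff_mul_fourierMode]
  have h1 := h k a (m - n)
  have e1 : spatialNorm d (latticePoint a.1 (m - n) - X) =
      spatialNorm d (sitePos a + L • m - x) := spatialNorm_congr fun j hj => by
    simp [sitePos, latticePoint, dif_pos hj, hx j hj, -Fin.val_fin_lt]
    ring
  have e2 : driveNorm d (latticePoint a.1 (m - n) - X) = driveNorm d m :=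
    driveNorm_congr fun j hj => by
      simp [latticePoint, not_lt.2 hj, hn j hj]
  rw [e1, e2] at h1
  refine h1.trans (div_le_div_of_nonneg_right ?_
    (pow_nonneg (zero_le_one.trans (one_le_one_add_driveNorm d m)) k))
  refine mul_le_mul (le_abs_self _) (le_of_eq ?_) (Real.exp_pos _).le (abs_nonneg _)
  congr 1
  rw [hν]
  ring

variable {H V : (Fin 3 → ℝ) → Matrix (Site d L N) (Site d L N) ℂ}
  {Ω : Fin 3 → ℝ} {ε : Site d L N → (Fin 3 → ℝ) → ℝ}
  {U : (Fin 3 → ℝ) → ℝ → Matrix (Site d L N) (Site d L N) ℂ} {ξ κ μ : ℝ} {K : ℕ → ℝ}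

/-- The centres of localized states can be moved to the home cell by a gauge transformation. -/
lemma IsMicromotion.exists_localizedFrame (hV : IsMicromotion d H Ω V ε)
    (hT : IsTightBinding ξ K H) (hloc : IsLocalized ξ K V) (hL : 0 < L) (hκ : 0 < κ) (hμ : 0 < μ)
    (hξ : κ + 24 * μ = 1 / ξ) :
    ∃ V' ε' x, IsMicromotion d H Ω V' ε' ∧ windingNumber V' = windingNumber V ∧
      LocalizedFrame d L N κ μ K H V' x := by
  choose X hX using hloc
  -- Spatial coordinates are reduced modulo `L`, with the quotient removed by the gauge
  -- transformation; drive coordinates are shifted all the way to `0`.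
  set n : Site d L N → Fin 3 → ℤ := fun α j => if (j : ℕ) < d then -(X α j / L) else -X α j with hn
  set x : Site d L N → Fin 3 → ℤ := fun α j => if (j : ℕ) < d then X α j % L else 0 with hx
  have hL0 : (L : ℤ) ≠ 0 := by exact_mod_cast hL.ne'
  refine ⟨_, _, x, hV.mul_modeMatrix n,
    windingNumber_mul_modeMatrix hV.smooth.smoothMatrix hV.star_mul_self n,
    ⟨hL, hκ, hμ, fun α j hj => ?_, fun a α => ?_, fun a a' => ?_⟩⟩
  · simp only [hx, if_pos hj]
    exact ⟨Int.emod_nonneg _ hL0, Int.emod_lt_of_pos _ (by exact_mod_cast hL)⟩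
  · simp only [modeMatrix, Matrix.mul_diagonal]
    refine (hX α).hopDecay hξ (fun j hj => ?_) (fun j hj => ?_) a
    · simp only [hx, hn, if_pos hj]
      rw [Int.emod_def]
      ring
    · simp only [hn, if_neg (not_lt.2 hj), neg_neg]
  · have := (hT a').hopDecay (n := 0) (x := sitePos a') hξ (fun j _ => by simp [sitePos])
      (fun j hj => by simp [latticePoint, not_lt.2 hj]) a
    simpa only [fourierMode_zero, mul_one] using this

lemma deviation_of_isEmpty {ι : Type} [Fintype ι] [DecidableEq ι] [IsEmpty ι]
    (H V : (Fin 3 → ℝ) → Matrix ι ι ℂ) (Ω : Fin 3 → ℝ) (U : (Fin 3 → ℝ) → ℝ → Matrix ι ι ℂ)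
    (n₀ : Fin 3 → Matrix ι ι ℂ) (θ₀ : Fin 3 → ℝ) (T : ℝ) : deviation H Ω V U n₀ θ₀ T = 0 := by
  simp [deviation, timeAverage, windingNumber, Matrix.trace]

lemma isEmpty_site (hd : 1 ≤ d) (N : ℕ) : IsEmpty (Site d 0 N) :=
  ⟨fun a => (a.1 ⟨0, hd⟩).elim0⟩

/-- A resonance winds around a spatial direction and so has weight at least `e^{κL}`; this provides
`σ = e^{-κL}`. -/
lemma Incommensurate.resonance_exp (hΩ : Incommensurate d Ω) (hκ : 0 < κ) (L s : ℕ)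
    (m : Fin 3 → ℤ) (hm : m ≠ 0) (h : modeFreq Ω m = 0) :
    1 ≤ Real.exp (-(κ * L)) * hopWeight d L κ s 0 0 m := by
  obtain ⟨j, hj, hmj⟩ := hΩ.exists_spatial_ne_zero hm h
  have h1 : (1 : ℝ) ≤ |(m j : ℝ)| := by exact_mod_cast Int.one_le_abs hmj
  have h2 : (L : ℝ) ≤ spatialNorm d (0 + L • m - 0) := by
    refine le_trans ?_ (abs_le_spatialNorm _ hj)
    rw [zero_add, sub_zero]
    simp only [Pi.smul_apply, nsmul_eq_mul, Int.cast_mul, Int.cast_natCast, abs_mul, Nat.abs_cast]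
    exact le_mul_of_one_le_right (Nat.cast_nonneg _) h1
  rw [hopWeight, ← mul_assoc, ← Real.exp_add]
  refine one_le_mul_of_one_le_of_one_le (Real.one_le_exp ?_)
    (one_le_pow₀ (one_le_one_add_driveNorm d m))
  have := mul_le_mul_of_nonneg_left h2 hκ.le
  linarith

end Lattices

/-! ### Periodic lattices of finite size -/

section FiniteSize

set_option linter.unusedSectionVars false

/-- The constant in the finite-size bound. -/
noncomputable def sizeConst (d N : ℕ) (Ω : Fin 3 → ℝ) (κ κ' μ D : ℝ) (K : ℕ → ℝ) (s : ℕ) : ℝ :=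
  1 / (2 * freqNorm Ω) * ((∑ c, |Ω c|) * (4 * circConst d N μ K (s + 1)) +
    (∑ c, |Ω c|) * (12 * persConst d N Ω κ κ' μ K s * (1 + circConst d N μ K (s + 1))) +
    (1 + 2 * D) * ((∑ c, |Ω c|) * (2 * (2 * energyConst d N Ω μ K s + ∑ l, |Ω l|) *
      circConst d N μ K (s + 1))) + 1)

variable {d L N : ℕ} {Ω : Fin 3 → ℝ} {κ κ' μ D : ℝ} {K : ℕ → ℝ}
  {H V : (Fin 3 → ℝ) → Matrix (Site d L N) (Site d L N) ℂ}
  {x : Site d L N → Fin 3 → ℤ} {ε : Site d L N → (Fin 3 → ℝ) → ℝ}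
  {U : (Fin 3 → ℝ) → ℝ → Matrix (Site d L N) (Site d L N) ℂ}

lemma sizeConst_nonneg (d N : ℕ) (Ω : Fin 3 → ℝ) (hκ : 0 < κ) (hκ' : κ' < κ) (hμ : 0 < μ)
    (hD : 0 ≤ D) (K : ℕ → ℝ) (s : ℕ) : 0 ≤ sizeConst d N Ω κ κ' μ D K s := by
  have h1 := circConst_nonneg d N hμ K (s + 1)
  have h2 := persConst_nonneg d N Ω hκ hκ' hμ K s
  have h3 := energyConst_nonneg d N Ω hμ K s
  have h4 : 0 ≤ ∑ c, |Ω c| := Finset.sum_nonneg fun _ _ => abs_nonneg _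
  have h5 : 0 ≤ freqNorm Ω := Real.sqrt_nonneg _
  unfold sizeConst
  positivity

lemma LocalizedFrame.deviation_rate (h : LocalizedFrame d L N κ μ K H V x)
    (hV : IsMicromotion d H Ω V ε) (hH : IsHamiltonian H) (hU : IsEvolution H Ω U)
    (hΩ : Incommensurate d Ω) (hd : d ≤ 2) (hκ' : κ' < κ) (hD : 0 ≤ D) {s : ℕ}
    (hD' : ∀ m, modeFreq Ω m ≠ 0 → |modeFreq Ω m|⁻¹ ≤ D * hopWeight d L κ s 0 0 m)
    (n₀ : Fin 3 → Matrix (Site d L N) (Site d L N) ℂ) (θ₀ : Fin 3 → ℝ) {T : ℝ} (hT : 0 < T) :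
    deviation H Ω V U n₀ θ₀ T ≤ sizeConst d N Ω κ κ' μ D K s * (1 + size n₀) *
      (T⁻¹ + Real.exp (-(κ' * L))) := by
  refine ((h.connEstimate hV hH hκ' s).deviation_rate hV hH hU hΩ hd (Real.exp_pos _).le
    (hΩ.resonance_exp h.rate_pos L s) hD hD' n₀ θ₀ hT).trans ?_
  have hC := circConst_nonneg d N h.loss_pos K (s + 1)
  have hP := persConst_nonneg d N Ω h.rate_pos hκ' h.loss_pos K s
  have hE := energyConst_nonneg d N Ω h.loss_pos K s
  have hω : 0 ≤ ∑ c, |Ω c| := Finset.sum_nonneg fun _ _ => abs_nonneg _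
  have hf := hΩ.freqNorm_pos hd
  have hσ : Real.exp (-(κ * L)) ≤ Real.exp (-(κ' * L)) := by
    refine Real.exp_le_exp.2 (neg_le_neg ?_)
    exact mul_le_mul_of_nonneg_right hκ'.le (Nat.cast_nonneg L)
  have he := (Real.exp_pos (-(κ' * L))).le
  have ht := (inv_pos.2 hT).le
  have hn := size_nonneg n₀
  rw [sizeConst]
  generalize circConst d N μ K (s + 1) = C at *
  generalize persConst d N Ω κ κ' μ K s = P at *
  set X := (∑ c, |Ω c|) * (2 * (2 * energyConst d N Ω μ K s + ∑ l, |Ω l|) * C) with hX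
  have hX0 : 0 ≤ X := by positivity
  clear_value X
  clear hX
  generalize (∑ c, |Ω c|) = w at *
  generalize size n₀ = n at *
  generalize Real.exp (-(κ' * L)) = e at *
  generalize T⁻¹ = t at *
  simp only [mul_assoc (1 / (2 * freqNorm Ω))]
  refine mul_le_mul_of_nonneg_left ?_ (by positivity)
  have h1 : Real.exp (-(κ * L)) * X ≤ e * X := mul_le_mul_of_nonneg_right hσ hX0
  have h2 : 0 ≤ w * (4 * C) * (1 + n) * e + w * (12 * P * (1 + C)) * (1 + n) * t +
      X * (t + n * t + n * e) + 2 * D * X * (n * t + e + n * e) + (1 + n) * (t + e) := by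
    positivity
  linarith

lemma LocalizedFrame.eventually_deviation (h : LocalizedFrame d L N κ μ K H V x)
    (hV : IsMicromotion d H Ω V ε) (hH : IsHamiltonian H) (hU : IsEvolution H Ω U)
    (hΩ : Incommensurate d Ω) (hd : d ≤ 2) (hκ' : κ' < κ)
    (n₀ : Fin 3 → Matrix (Site d L N) (Site d L N) ℂ) (θ₀ : Fin 3 → ℝ) :
    ∀ᶠ T : ℝ in atTop, deviation H Ω V U n₀ θ₀ T ≤
      sizeConst d N Ω κ κ' μ 0 K 0 * (1 + size n₀) * Real.exp (-(κ' * L)) := by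
  -- The slack in the limit is chosen as `e^{-κ'L}` itself; it accounts for the final `1` in
  -- `sizeConst`.
  filter_upwards [(h.connEstimate hV hH hκ' 0).eventually_deviation hV hH hU hΩ hd
    (Real.exp_pos _).le (hΩ.resonance_exp h.rate_pos L 0) n₀ θ₀
    (Real.exp_pos (-(κ' * L)))] with T hT
  refine hT.trans ?_
  have hC := circConst_nonneg d N h.loss_pos K (0 + 1)
  have hP := persConst_nonneg d N Ω h.rate_pos hκ' h.loss_pos K 0
  have hE := energyConst_nonneg d N Ω h.loss_pos K 0
  have hω : 0 ≤ ∑ c, |Ω c| := Finset.sum_nonneg fun _ _ => abs_nonneg _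
  have hf := hΩ.freqNorm_pos hd
  have hσ : Real.exp (-(κ * L)) ≤ Real.exp (-(κ' * L)) := by
    refine Real.exp_le_exp.2 (neg_le_neg ?_)
    exact mul_le_mul_of_nonneg_right hκ'.le (Nat.cast_nonneg L)
  have he := (Real.exp_pos (-(κ' * L))).le
  have hn := size_nonneg n₀
  rw [sizeConst]
  generalize circConst d N μ K (0 + 1) = C at *
  generalize persConst d N Ω κ κ' μ K 0 = P at *
  set X := (∑ c, |Ω c|) * (2 * (2 * energyConst d N Ω μ K 0 + ∑ l, |Ω l|) * C) with hX
  have hX0 : 0 ≤ X := by positivity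
  clear_value X
  clear hX
  generalize (∑ c, |Ω c|) = w at *
  generalize size n₀ = n at *
  generalize Real.exp (-(κ' * L)) = e at *
  simp only [mul_assoc (1 / (2 * freqNorm Ω))]
  refine mul_le_mul_of_nonneg_left ?_ (by positivity)
  have h1 : Real.exp (-(κ * L)) * X ≤ e * X := mul_le_mul_of_nonneg_right hσ hX0
  have h2 : 0 ≤ w * (4 * C) * (1 + n) * e + X * (n * e) + n * e := by positivity
  linarith

/-- The gap between `1/ξ` and `1/ξ'` pays for all sums and for the volume. The final constant adds
the one for the limit and the one for the Diophantine rate, so that a single constant serves both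
estimates. -/
theorem deviation_lattice (d N : ℕ) (Ω : Fin 3 → ℝ) (hd1 : 1 ≤ d) (hd2 : d ≤ 2)
    (hΩ : Incommensurate d Ω) (ξ ξ' : ℝ) (K : ℕ → ℝ) (hξ : 0 < ξ) (hξ' : ξ < ξ') :
    ∃ C : ℝ, ∀ (L : ℕ)
      (H V : (Fin 3 → ℝ) → Matrix (Site d L N) (Site d L N) ℂ)
      (ε : Site d L N → (Fin 3 → ℝ) → ℝ)
      (U : (Fin 3 → ℝ) → ℝ → Matrix (Site d L N) (Site d L N) ℂ),
      IsHamiltonian H → IsTightBinding ξ K H → IsMicromotion d H Ω V ε → IsLocalized ξ K V →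
      IsEvolution H Ω U →
      ∀ (θ₀ : Fin 3 → ℝ) (n₀ : Fin 3 → Matrix (Site d L N) (Site d L N) ℂ),
        (∀ᶠ T : ℝ in atTop, deviation H Ω V U n₀ θ₀ T ≤
          C * (1 + size n₀) * Real.exp (-(L : ℝ) / ξ')) ∧
        (Diophantine d Ω → ∀ T : ℝ, 0 < T →
          deviation H Ω V U n₀ θ₀ T ≤
            C * (1 + size n₀) * (T⁻¹ + Real.exp (-(L : ℝ) / ξ'))) := by
  have hξ'0 := hξ.trans hξ'
  have hgap : 1 / ξ' < 1 / ξ := one_div_lt_one_div_of_lt hξ hξ'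
  have hpos : 0 < 1 / ξ' := one_div_pos.2 hξ'0
  -- The rate `κ` is the midpoint: the upper half of the gap is the excess `24μ` used in the Fourier
  -- sums, and the lower half absorbs the number of states.
  obtain ⟨κ, hκ⟩ : ∃ κ, κ = (1 / ξ + 1 / ξ') / 2 := ⟨_, rfl⟩
  obtain ⟨μ, hμ⟩ : ∃ μ, μ = (1 / ξ - 1 / ξ') / 48 := ⟨_, rfl⟩
  have hκ0 : 0 < κ := by linarith
  have hμ0 : 0 < μ := by linarith
  have hκ' : 1 / ξ' < κ := by linarith
  have hsum : κ + 24 * μ = 1 / ξ := by linarith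
  -- The small-divisor constants must be fixed before `L` and the system; for frequencies that are
  -- not Diophantine, dummy values are used.
  obtain ⟨D, hD0, τ, hD⟩ : ∃ D : ℝ, 0 ≤ D ∧ ∃ τ : ℕ, Diophantine d Ω → ∀ (L : ℕ) (m : Fin 3 → ℤ),
      modeFreq Ω m ≠ 0 → |modeFreq Ω m|⁻¹ ≤ D * hopWeight d L κ τ 0 0 m := by
    by_cases hdio : Diophantine d Ω
    · obtain ⟨D, hD0, τ, hD⟩ := hdio.exists_inv_modeFreq_le
      exact ⟨D, hD0, τ, fun _ L => hD L κ hκ0.le⟩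
    · exact ⟨0, le_rfl, 0, fun h => absurd h hdio⟩
  have hC0 := sizeConst_nonneg d N Ω hκ0 hκ' hμ0 le_rfl K 0
  have hC1 := sizeConst_nonneg d N Ω hκ0 hκ' hμ0 hD0 K τ
  refine ⟨sizeConst d N Ω κ (1 / ξ') μ 0 K 0 + sizeConst d N Ω κ (1 / ξ') μ D K τ,
    fun L H V ε U hH hT hV hloc hU θ₀ n₀ => ?_⟩
  have hn := size_nonneg n₀
  -- For `L = 0` there are no sites, as `d ≥ 1`, and both sides of the comparison are zero traces.
  rcases Nat.eq_zero_or_pos L with rfl | hL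
  · have := isEmpty_site hd1 N
    simp only [deviation_of_isEmpty]
    exact ⟨Eventually.of_forall fun T => by positivity, fun _ T hT => by positivity⟩
  obtain ⟨V', ε', x, hV', hw, hF⟩ := hV.exists_localizedFrame hT hloc hL hκ0 hμ0 hsum
  -- The circulation is defined by `H`, `U` and `n₀` alone, so the choice of micromotion operator
  -- enters only through the invariant winding number.
  have hdev : ∀ T, deviation H Ω V U n₀ θ₀ T = deviation H Ω V' U n₀ θ₀ T := fun T => by
    rw [deviation, deviation, hw]
  have hexp : Real.exp (-(L : ℝ) / ξ') = Real.exp (-(1 / ξ' * L)) := by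
    congr 1
    ring
  simp only [hdev, hexp]
  refine ⟨?_, fun hdio T hT => ?_⟩
  · filter_upwards [hF.eventually_deviation hV' hH hU hΩ hd2 hκ' n₀ θ₀] with T h
    refine h.trans ?_
    gcongr
    exact le_add_of_nonneg_right hC1
  · refine (hF.deviation_rate hV' hH hU hΩ hd2 hκ' hD0 (hD hdio L) n₀ θ₀ hT).trans ?_
    gcongr
    exact le_add_of_nonneg_left hC0

end FiniteSize

end ALTP

theorem mainTheorem2 :
    -- qudits driven by three tones
    (∀ (N : ℕ) (Ω : Fin 3 → ℝ) (H V : (Fin 3 → ℝ) → Matrix (Fin N) (Fin N) ℂ)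
        (ε : Fin N → (Fin 3 → ℝ) → ℝ) (U : (Fin 3 → ℝ) → ℝ → Matrix (Fin N) (Fin N) ℂ),
      ALTP.Incommensurate 0 Ω → ALTP.IsHamiltonian H → ALTP.IsMicromotion 0 H Ω V ε →
      ALTP.IsEvolution H Ω U →
      (∀ (θ₀ : Fin 3 → ℝ) (n₀ : Fin 3 → Matrix (Fin N) (Fin N) ℂ),
        Tendsto (fun T : ℝ => ALTP.timeAverage (ALTP.circulation H Ω U n₀ θ₀) T) atTop
          (𝓝 ((ALTP.freqNorm Ω / (2 * Real.pi) : ℂ) * ALTP.windingNumber V))) ∧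
      (ALTP.Diophantine 0 Ω →
        ∃ C : ℝ, ∀ (θ₀ : Fin 3 → ℝ) (n₀ : Fin 3 → Matrix (Fin N) (Fin N) ℂ) (T : ℝ), 0 < T →
          ALTP.deviation H Ω V U n₀ θ₀ T ≤ C * (1 + ALTP.size n₀) * T⁻¹)) ∧
    -- lattices with one or two spatial dimensions driven by two tones or one tone
    (∀ (d N : ℕ) (Ω : Fin 3 → ℝ), (d = 1 ∨ d = 2) → ALTP.Incommensurate d Ω →
      ∀ (ξ ξ' : ℝ) (K : ℕ → ℝ), 0 < ξ → ξ < ξ' →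
      ∃ C : ℝ, ∀ (L : ℕ)
        (H V : (Fin 3 → ℝ) → Matrix (ALTP.Site d L N) (ALTP.Site d L N) ℂ)
        (ε : ALTP.Site d L N → (Fin 3 → ℝ) → ℝ)
        (U : (Fin 3 → ℝ) → ℝ → Matrix (ALTP.Site d L N) (ALTP.Site d L N) ℂ),
        ALTP.IsHamiltonian H → ALTP.IsTightBinding ξ K H →
        ALTP.IsMicromotion d H Ω V ε → ALTP.IsLocalized ξ K V →
        ALTP.IsEvolution H Ω U →
        ∀ (θ₀ : Fin 3 → ℝ) (n₀ : Fin 3 → Matrix (ALTP.Site d L N) (ALTP.Site d L N) ℂ),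
          (∀ᶠ T : ℝ in atTop, ALTP.deviation H Ω V U n₀ θ₀ T ≤
            C * (1 + ALTP.size n₀) * Real.exp (-(L : ℝ) / ξ')) ∧
          (ALTP.Diophantine d Ω → ∀ T : ℝ, 0 < T →
            ALTP.deviation H Ω V U n₀ θ₀ T ≤
              C * (1 + ALTP.size n₀) * (T⁻¹ + Real.exp (-(L : ℝ) / ξ')))) := by
  refine ⟨fun N Ω H V ε U hΩ hH hV hU => ⟨fun θ₀ n₀ => ?_, fun hD => ?_⟩,
    fun d N Ω hd hΩ ξ ξ' K hξ hξ' => ?_⟩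
  · exact ALTP.tendsto_timeAverage_qudit hΩ hH hV hU θ₀ n₀
  · exact ALTP.deviation_qudit hΩ hD hH hV hU
  · exact ALTP.deviation_lattice d N Ω (by omega) (by omega) hΩ ξ ξ' K hξ hξ'
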